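/- Let $\mathfrak A$ be a countably infinite alphabet and $\mathfrak A^*$ the free monoid of words over $\mathfrak A$, and let $a,b,t,s\in\mathfrak A$ be distinct letters. For a congruence $\tau$ on $\mathfrak A^*$ let $[w]_\tau$ be the $\tau$-class of $w$. For a set of words $W$ let $M_{synt}(W)=\mathfrak A^*/{\sim_W}$, where $u\sim_W v$ iff $pus\in W\Leftrightarrow pvs\in W$ for all $p,s\in\mathfrak A^*$. For a union $W$ of $\tau$-classes let $M_\tau(W)$ be the Rees quotient of $\mathfrak A^*/\tau$ over the ideal of all classes of words that are not contiguous subwords of words in $W$ (and $\mathfrak A^*/\tau$ itself if there are none). Let $\mathbb M_{synt}(W)$ and $\mathbb M_\tau(W)$ be the varieties of monoids generated by $M_{synt}(W)$ and $M_\tau(W)$. Let $\tau_1$ be the congruence on $\mathfrak A^*$ induced by the relations $x=x^2$, $x\in\mathfrak A$; let $\gamma$ and $\zeta$ be the fully invariant congruences of the varieties of monoids defined by $\{xy\approx yx,\ x^2\approx x^3\}$ and by $\{xtxs\approx xtxsx\}$, respectively; $\wedge$ denotes intersection of congruences. Let $A_0=\langle a,b\mid a^2=a,\ b^2=b,\ ab=0\rangle=\{a,b,ba,0\}$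 and $A=\langle a,b,c\mid a^2=a,\ b^2=b,\ ab=ca=0,\ ac=cb=c\rangle=\{a,b,c,ba,bc,0\}$, and let $\mathbb A_0^1$ and $\mathbb A^1$ be the varieties of monoids generated by $A_0^1$ and $A^1$, where $S^1$ is $S$ with a new identity element adjoined. Let $\mathbb J$ be the variety of monoids defined by the identities $$xyx\approx xyx^2,\quad xyxztx\approx xyxzxtx,\quad xzxyxty\approx xzx^2yty,\quad xyzxy\approx yxzxy,\quad xzytxy\approx xzytyx$$ together with $$\Bigl(\prod_{i=1}^n z_it_i\Bigr)x\Bigl(\prod_{i=1}^n z_{\pi(i)}z_{n+\rho(i)}\Bigr)x\Bigl(\prod_{i=1}^{n} t_{n+i}z_{n+i}\Bigr)\approx\Bigl(\prod_{i=1}^n z_it_i\Bigr)x^2\Bigl(\prod_{i=1}^n z_{\pi(i)}z_{n+\rho(i)}\Bigr)\Bigl(\prod_{i=1}^{n} t_{n+i}z_{n+i}\Bigr)$$ for all $n\ge 0$ and all permutations $\pi,\rho$ of $\{1,\dots,n\}$. Let $\mathbb K$ be the variety of monoids defined by the identities $$xyx\approx xyx^2,\quad xyxztx\approx xyxzxtx,\quad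 xyzxty\approx yxzxty,\quad xzytyxy\approx xzytxy^2$$ together with $p\,x\,q\,y\,r\,xy\,u\approx p\,x\,q\,y\,r\,yx\,u$ for all letters $x,y$ and all words $p,q,r,u$ such that each letter of $q$ occurs at least twice in the word $p\,x\,q\,y\,r\,xy\,u$. Then: (i) $\mathbb A_0^1=\mathbb M_{\tau_1}([ab]_{\tau_1})=\mathbb M_{synt}(a^+b^+)$; (ii) $\mathbb A^1=\mathbb M_{\tau_1\wedge\gamma}([ab^2ta]_{\tau_1\wedge\gamma})=\mathbb M_{synt}(a^+bb^+ta^+)$; (iii) $\mathbb J=\mathbb M_{\tau_1\wedge\zeta}([atbasb]_{\tau_1\wedge\zeta})=\mathbb M_{synt}(atba^+sb^+)$; (iv) $\mathbb K=\mathbb M_{\tau_1\wedge\zeta}([atb^2a]_{\tau_1\wedge\zeta})=\mathbb M_{synt}(atbb^+a^+)$. -/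

import Mathlib

open scoped Pointwise

/-- Words over a fixed countably infinite alphabet, whose letters are indexed by `ℕ`. -/
abbrev Word : Type := FreeMonoid ℕ

/-- The one-letter word. -/
abbrev letter (i : ℕ) : Word := FreeMonoid.of i

/-! ### Identities and varieties of monoids -/

/-- The monoid `M` satisfies the identity `e.1 ≈ e.2`. -/
def Satisfies (M : Type*) [Monoid M] (e : Word × Word) : Prop :=
  ∀ φ : Word →* M, φ e.1 = φ e.2

/-- The variety of monoids defined by a set of identities. -/
def varOf.{w} (S : Set (Word × Word)) : Set MonCat.{w} :=
  {N | ∀ e ∈ S, Satisfies N e}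

/-- A class of monoids is a variety if some set of identities defines it. -/
def IsMonoidVariety.{w} (V : Set MonCat.{w}) : Prop :=
  ∃ S : Set (Word × Word), V = varOf S

/-- The variety generated by the monoid `M`: all monoids that satisfy every identity of `M`.
By the next theorem it is the smallest variety that contains `M`. -/
def generatedVariety.{w, v} (M : Type v) [Monoid M] : Set MonCat.{w} :=
  varOf {e | Satisfies M e}

theorem generatedVariety_isLeast.{w} (M : Type w) [Monoid M] :
    IsLeast {V : Set MonCat.{w} | IsMonoidVariety V ∧ MonCat.of M ∈ V} (generatedVariety M) := by
  refine ⟨⟨⟨_, rfl⟩, fun e he => he⟩, ?_⟩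
  rintro V ⟨⟨S, rfl⟩, hM⟩ N hN e he
  exact hN e (hM e he)

/-- The fully invariant congruence of a class of monoids: `u` and `v` are related
when every member of the class satisfies `u ≈ v`. -/
def fullyInvariantCon (V : Set MonCat.{0}) : Con Word where
  r u v := ∀ N ∈ V, Satisfies N (u, v)
  iseqv :=
    { refl := fun _ _ _ _ => rfl
      symm := fun h N hN φ => (h N hN φ).symm
      trans := fun h k N hN φ => (h N hN φ).trans (k N hN φ) }
  mul' := by
    intro u v u' v' h k N hN φ
    have h1 : φ u = φ v := h N hN φ
    have h2 : φ u' = φ v' := k N hN φ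
    simp only [map_mul, h1, h2]

/-! ### Syntactic monoids and the monoids `M_τ(W)` -/

/-- The syntactic congruence of a set of words. -/
def syntacticCon (W : Set Word) : Con Word where
  r u v := ∀ p s : Word, p * u * s ∈ W ↔ p * v * s ∈ W
  iseqv :=
    { refl := fun _ _ _ => Iff.rfl
      symm := fun h p s => (h p s).symm
      trans := fun h k p s => (h p s).trans (k p s) }
  mul' := by
    intro u v u' v' h k p s
    have h1 := h p (u' * s)
    have h2 := k (p * v) s
    simp only [mul_assoc] at h1 h2 ⊢
    exact h1.trans h2

/-- The syntactic monoid of a set of words. -/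
abbrev SyntacticMonoid (W : Set Word) : Type := (syntacticCon W).Quotient

/-- The words whose `τ`-class divides the `τ`-class of some word in `W`.  When `W` is a union of
`τ`-classes, these are exactly the (contiguous) subwords of words in `W`. -/
def divisorClosure (τ : Con Word) (W : Set Word) : Set Word :=
  {v | ∃ p s : Word, ∃ w ∈ W, τ (p * v * s) w}

/-- The congruence that identifies `τ`-related words and collapses to one class all words outside
`divisorClosure τ W`. -/
def reesCon (τ : Con Word) (W : Set Word) : Con Word where
  r u v := τ u v ∨ (u ∉ divisorClosure τ W ∧ v ∉ divisorClosure τ W)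
  iseqv := by
    have key : ∀ {u v : Word}, τ u v → u ∈ divisorClosure τ W → v ∈ divisorClosure τ W := by
      rintro u v h ⟨p, s, w, hw, hpw⟩
      exact ⟨p, s, w, hw,
        τ.trans (τ.mul (τ.mul (τ.refl p) (τ.symm h)) (τ.refl s)) hpw⟩
    refine ⟨fun u => Or.inl (τ.refl u), ?_, ?_⟩
    · rintro u v (h | ⟨h, k⟩)
      · exact Or.inl (τ.symm h)
      · exact Or.inr ⟨k, h⟩
    · rintro u v w (h | ⟨h, k⟩) (h' | ⟨h', k'⟩)
      · exact Or.inl (τ.trans h h')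
      · exact Or.inr ⟨fun hu => h' (key h hu), k'⟩
      · exact Or.inr ⟨h, fun hw => k (key (τ.symm h') hw)⟩
      · exact Or.inr ⟨h, k'⟩
  mul' := by
    have left : ∀ {u x : Word}, u * x ∈ divisorClosure τ W → u ∈ divisorClosure τ W := by
      rintro u x ⟨p, s, w, hw, hpw⟩
      exact ⟨p, x * s, w, hw, by simpa only [mul_assoc] using hpw⟩
    have right : ∀ {u x : Word}, x * u ∈ divisorClosure τ W → u ∈ divisorClosure τ W := by
      rintro u x ⟨p, s, w, hw, hpw⟩
      exact ⟨p * x, s, w, hw, by simpa only [mul_assoc] using hpw⟩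
    rintro u v u' v' (h | ⟨h, k⟩) (h' | ⟨h', k'⟩)
    · exact Or.inl (τ.mul h h')
    · exact Or.inr ⟨fun hu => h' (right hu), fun hv => k' (right hv)⟩
    · exact Or.inr ⟨fun hu => h (left hu), fun hv => k (left hv)⟩
    · exact Or.inr ⟨fun hu => h (left hu), fun hv => k (left hv)⟩

/-- The monoid `M_τ(W)`: the Rees quotient of `Word / τ` over the ideal of all `τ`-classes that do
not divide a class in `W` (and `Word / τ` itself if there are no such classes). -/
abbrev MTau (τ : Con Word) (W : Set Word) : Type := (reesCon τ W).Quotient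

/-- The class of the word `w` under the congruence `τ`. -/
def conClass (τ : Con Word) (w : Word) : Set Word := {v | τ v w}

/-- The language `a⁺`. -/
def plus (a : ℕ) : Set Word := {w | ∃ n : ℕ, 1 ≤ n ∧ w = letter a ^ n}

/-! ### The congruences `τ₁`, `γ` and `ζ` -/

/-- The congruence on words induced by the relations `a = a²` for all letters `a`. -/
def tauOne : Con Word := conGen fun u v => ∃ i : ℕ, u = letter i ∧ v = letter i * letter i

/-- The fully invariant congruence of the variety defined by `xy ≈ yx` and `x² ≈ x³`. -/
def gammaCon : Con Word :=
  let x := letter 0; let y := letter 1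
  fullyInvariantCon (varOf {(x * y, y * x), (x ^ 2, x ^ 3)})

/-- The fully invariant congruence of the variety defined by `xtxs ≈ xtxsx`. -/
def zetaCon : Con Word :=
  let x := letter 0; let t := letter 1; let s := letter 2
  fullyInvariantCon (varOf {(x * t * x * s, x * t * x * s * x)})

/-! ### The semigroups `A₀` and `A`

Adjoining a new identity element is Mathlib's `WithOne`. -/

/-- `A₀ = ⟨a, b ∣ a² = a, b² = b, ab = 0⟩ = {a, b, ba, 0}`. -/
inductive SemigroupA0 : Type
  | a | b | ba | zero

namespace SemigroupA0

/-- The multiplication table of `A₀`. -/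
def mul : SemigroupA0 → SemigroupA0 → SemigroupA0
  | a, a => a
  | b, b => b
  | b, a => ba
  | b, ba => ba
  | ba, a => ba
  | _, _ => zero

instance : Semigroup SemigroupA0 where
  mul := mul
  mul_assoc := by rintro ⟨⟩ ⟨⟩ ⟨⟩ <;> rfl

theorem relations :
    a * a = a ∧ b * b = b ∧ a * b = zero ∧ b * a = ba ∧
      ∀ x : SemigroupA0, x * zero = zero ∧ zero * x = zero := by
  refine ⟨rfl, rfl, rfl, rfl, ?_⟩
  rintro ⟨⟩ <;> exact ⟨rfl, rfl⟩

end SemigroupA0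

/-- `A = ⟨a, b, c ∣ a² = a, b² = b, ab = ca = 0, ac = cb = c⟩ = {a, b, c, ba, bc, 0}`. -/
inductive SemigroupA : Type
  | a | b | c | ba | bc | zero

namespace SemigroupA

/-- The multiplication table of `A`. -/
def mul : SemigroupA → SemigroupA → SemigroupA
  | a, a => a
  | a, c => c
  | b, a => ba
  | b, b => b
  | b, c => bc
  | b, ba => ba
  | b, bc => bc
  | c, b => c
  | ba, a => ba
  | ba, c => bc
  | bc, b => bc
  | _, _ => zero

instance : Semigroup SemigroupA where
  mul := mul
  mul_assoc := by rintro ⟨⟩ ⟨⟩ ⟨⟩ <;> rfl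

theorem relations :
    a * a = a ∧ b * b = b ∧ a * b = zero ∧ c * a = zero ∧ a * c = c ∧ c * b = c ∧
      b * a = ba ∧ b * c = bc ∧ ∀ x : SemigroupA, x * zero = zero ∧ zero * x = zero := by
  refine ⟨rfl, rfl, rfl, rfl, rfl, rfl, rfl, rfl, ?_⟩
  rintro ⟨⟩ <;> exact ⟨rfl, rfl⟩

end SemigroupA

/-! ### The limit varieties `J` and `K` -/

/-- The left side of the identity `w_n(π, ρ)`:
`(z₁t₁ ⋯ zₙtₙ) x (z_{π1} z_{n+ρ1} ⋯ z_{πn} z_{n+ρn}) x (t_{n+1}z_{n+1} ⋯ t_{2n}z_{2n})`.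
The letter `x` is `0`, and `zᵢ`, `tᵢ` are the letters `2i - 1` and `2i`. -/
def jLeft (n : ℕ) (π ρ : Equiv.Perm (Fin n)) : Word :=
  let x := letter 0
  let z : ℕ → Word := fun i => letter (2 * i + 1)
  let t : ℕ → Word := fun i => letter (2 * i + 2)
  (List.ofFn fun i : Fin n => z i * t i).prod * x *
    (List.ofFn fun i : Fin n => z (π i) * z (n + ρ i)).prod * x *
    (List.ofFn fun i : Fin n => t (n + i) * z (n + i)).prod

/-- The right side of the identity `w_n(π, ρ)`:
`(z₁t₁ ⋯ zₙtₙ) x² (z_{π1} z_{n+ρ1} ⋯ z_{πn} z_{n+ρn}) (t_{n+1}z_{n+1} ⋯ t_{2n}z_{2n})`. -/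
def jRight (n : ℕ) (π ρ : Equiv.Perm (Fin n)) : Word :=
  let x := letter 0
  let z : ℕ → Word := fun i => letter (2 * i + 1)
  let t : ℕ → Word := fun i => letter (2 * i + 2)
  (List.ofFn fun i : Fin n => z i * t i).prod * x ^ 2 *
    (List.ofFn fun i : Fin n => z (π i) * z (n + ρ i)).prod *
    (List.ofFn fun i : Fin n => t (n + i) * z (n + i)).prod

/-- The identities `xyx ≈ xyx²`, `xyxztx ≈ xyxzxtx`, `xzxyxty ≈ xzx²yty`, `xyzxy ≈ yxzxy`,
`xzytxy ≈ xzytyx`, and `w_n(π, ρ)` for all `n` and all permutations `π`, `ρ`. -/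
def identitiesJ : Set (Word × Word) :=
  let x := letter 0; let y := letter 1; let z := letter 2; let t := letter 3
  {(x * y * x, x * y * x ^ 2),
   (x * y * x * z * t * x, x * y * x * z * x * t * x),
   (x * z * x * y * x * t * y, x * z * x ^ 2 * y * t * y),
   (x * y * z * x * y, y * x * z * x * y),
   (x * z * y * t * x * y, x * z * y * t * y * x)} ∪
  {e | ∃ (n : ℕ) (π ρ : Equiv.Perm (Fin n)), e = (jLeft n π ρ, jRight n π ρ)}

/-- The variety `J`. -/
def varietyJ.{w} : Set MonCat.{w} := varOf identitiesJ

/-- The identities `xyx ≈ xyx²`, `xyxztx ≈ xyxzxtx`, `xyzxty ≈ yxzxty`, `xzytyxy ≈ xzytxy²`, and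
`p x q y r xy s ≈ p x q y r yx s` for all letters `x`, `y` and all words `p`, `q`, `r`, `s`
such that every letter of `q` occurs at least twice in the word `p x q y r xy s`. -/
def identitiesK : Set (Word × Word) :=
  let x := letter 0; let y := letter 1; let z := letter 2; let t := letter 3
  {(x * y * x, x * y * x ^ 2),
   (x * y * x * z * t * x, x * y * x * z * x * t * x),
   (x * y * z * x * t * y, y * x * z * x * t * y),
   (x * z * y * t * y * x * y, x * z * y * t * x * y ^ 2)} ∪
  {e | ∃ (p q r s : Word) (i j : ℕ),
    (∀ k ∈ q.toList,
      2 ≤ (p * letter i * q * letter j * r * letter i * letter j * s).toList.count k) ∧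
    e = (p * letter i * q * letter j * r * letter i * letter j * s,
      p * letter i * q * letter j * r * letter j * letter i * s)}

/-- The variety `K`. -/
def varietyK.{w} : Set MonCat.{w} := varOf identitiesK

universe w

/-! ### Identities of quotients of the free monoid -/

/-! Varieties are compared through their identities. The languages are first recognised as
congruence classes: `tauOne` fixes the sequence of runs of a word, `gammaCon` fixes the number of
occurrences of each letter up to two, and `zetaCon` fixes the first two letters of every projection
to a set of letters, hence which runs have length one. For a single τ-class `W`, the Rees congruence
lies below the syntactic congruence (`reesCon_le_syntacticCon`), so every identity of `MTau` holds
in the syntactic monoid. What remains is to close the circle.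

For `A₀¹` and `A¹`, the words not sent to zero by the natural evaluation are `aⁱbʲ`, and for `A¹`
also `aⁱbʲtaᵏ`. On them an identity of the finite monoid forces τ-equivalence, so it passes to
`MTau`. Conversely, the finite monoid is the syntactic monoid of an inverse image of the language
under an endomorphism, so it satisfies the identities of the syntactic monoid
(`satisfies_of_syntactic`).

For `J` and `K`, the defining identities are shown sound for `MTau` and complete for the syntactic
monoid. Soundness: a letter that occurs twice can only be mapped to a power of `a` or of `b` when
the value divides a word of the language. Since words of the language contain at most one direct
change between `a` and `b`, the blocks that an identity permutes are powers of the same letter.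

Completeness: the identities `xyx ≈ xyx²` and `xyxztx ≈ xyxzxtx` bring each word to a form in which
a letter occurs once or exactly three times (`HasBasic.exists_reduced`). In such words an identity
of the syntactic monoid preserves the number of occurrences of each letter before each linear letter
(`Separates.count_prefix_eq`). Then `u` is sorted into `v` from left to right: the next letter of
`v` is moved left by adjacent swaps. If no defining identity allows a swap, some substitution
separates `u` from `v` (`deriv_step_K`, `deriv_step_J`). For `J` the sorted prefix must also satisfy
`Spread`; where this would fail, the infinite family of identities pulls the second occurrence of a
letter next to the first (`deriv_pull`). -/

theorem generatedVariety_congr.{v, v'} {M : Type v} {M' : Type v'} [Monoid M] [Monoid M']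
    (h : ∀ e, Satisfies M e ↔ Satisfies M' e) :
    generatedVariety.{w} M = generatedVariety.{w} M' := by
  unfold generatedVariety
  congr 1
  exact Set.ext h

theorem Satisfies.subst {M : Type*} [Monoid M] {u v : Word} (h : Satisfies M (u, v))
    (φ : Word →* Word) : Satisfies M (φ u, φ v) := fun χ => h (χ.comp φ)

theorem satisfies_quotient_iff (C : Con Word) (e : Word × Word) :
    Satisfies C.Quotient e ↔ ∀ φ : Word →* Word, C (φ e.1) (φ e.2) := by
  constructor
  · intro h φ
    exact (Con.eq C).1 (h (C.mk'.comp φ))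
  · intro h φ
    choose g hg using fun q : C.Quotient => C.mk'_surjective q
    have hφ : φ = C.mk'.comp (FreeMonoid.lift fun i => g (φ (letter i))) := by
      apply FreeMonoid.hom_eq
      intro i
      simpa using (hg (φ (letter i))).symm
    rw [hφ]
    exact (Con.eq C).2 (h _)

theorem Satisfies.quotient_mono {C D : Con Word} (hCD : C ≤ D) {e : Word × Word}
    (h : Satisfies C.Quotient e) : Satisfies D.Quotient e :=
  (satisfies_quotient_iff D e).2 fun φ => hCD ((satisfies_quotient_iff C e).1 h φ)

/-- Replacing a factor by a τ-related one does not leave a τ-class, and a word outside the divisor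
closure is not a factor of any word in the class. -/
theorem reesCon_le_syntacticCon (τ : Con Word) (w : Word) :
    reesCon τ (conClass τ w) ≤ syntacticCon (conClass τ w) := by
  rintro u v (h | ⟨hu, hv⟩) p s
  · have h' : τ (p * u * s) (p * v * s) := τ.mul (τ.mul (τ.refl p) h) (τ.refl s)
    exact ⟨fun k => τ.trans (τ.symm h') k, fun k => τ.trans h' k⟩
  · exact ⟨fun k => (hu ⟨p, s, w, τ.refl w, k⟩).elim, fun k => (hv ⟨p, s, w, τ.refl w, k⟩).elim⟩

/-- Substitutions under which neither side divides the class send both sides to zero and impose no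
condition. -/
theorem satisfies_MTau_of {τ : Con Word} {w : Word} {e : Word × Word}
    (h : ∀ (φ : Word →* Word) (p s : Word),
      (p * φ e.1 * s ∈ conClass τ w ∨ p * φ e.2 * s ∈ conClass τ w) → τ (φ e.1) (φ e.2)) :
    Satisfies (MTau τ (conClass τ w)) e := by
  rw [satisfies_quotient_iff]
  intro φ
  by_cases h1 : φ e.1 ∈ divisorClosure τ (conClass τ w)
  · obtain ⟨p, s, x, hx, hpx⟩ := h1
    exact Or.inl (h φ p s (Or.inl (τ.trans hpx hx)))
  by_cases h2 : φ e.2 ∈ divisorClosure τ (conClass τ w)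
  · obtain ⟨p, s, x, hx, hpx⟩ := h2
    exact Or.inl (h φ p s (Or.inr (τ.trans hpx hx)))
  exact Or.inr ⟨h1, h2⟩

/-- The hypotheses say that `S` is the syntactic monoid of the inverse image of `W` under `ψ`. A
context in `S` lifts along `f` and is carried by `ψ` to a context for `W`. -/
theorem satisfies_of_syntactic {S : Type*} [Monoid S] {W : Set Word} (f : Word →* S)
    (hf : Function.Surjective f) (ψ : Word →* Word) (T : Set S)
    (hW : ∀ w, ψ w ∈ W ↔ f w ∈ T)
    (hT : ∀ m m' : S, (∀ p q, p * m * q ∈ T ↔ p * m' * q ∈ T) → m = m')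
    {e : Word × Word} (h : Satisfies (SyntacticMonoid W) e) : Satisfies S e := by
  rw [satisfies_quotient_iff] at h
  intro φ
  choose g hg using hf
  have hφ : φ = f.comp (FreeMonoid.lift fun i => g (φ (letter i))) := by
    apply FreeMonoid.hom_eq
    intro i
    simp [hg]
  rw [hφ]
  set χ : Word →* Word := FreeMonoid.lift fun i => g (φ (letter i))
  refine hT _ _ fun p q => ?_
  have := h (ψ.comp χ) (ψ (g p)) (ψ (g q))
  simp only [MonoidHom.comp_apply, ← map_mul, hW] at this
  simpa only [map_mul, hg, MonoidHom.comp_apply] using this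

/-! ### The congruence of identities that are derivable from a given set -/

/-- The congruence on words generated by all substitution instances of the identities in `S`. -/
def derivCon (S : Set (Word × Word)) : Con Word :=
  conGen fun u v => ∃ e ∈ S, ∃ φ : Word →* Word, u = φ e.1 ∧ v = φ e.2

theorem derivCon_subst {S : Set (Word × Word)} {u v : Word} (h : (u, v) ∈ S) (φ : Word →* Word) :
    derivCon S (φ u) (φ v) :=
  ConGen.Rel.of _ _ ⟨_, h, φ, rfl, rfl⟩

theorem derivCon_sound {S : Set (Word × Word)} {M : Type*} [Monoid M]
    (hM : ∀ e ∈ S, Satisfies M e) {u v : Word} (h : derivCon S u v) : Satisfies M (u, v) := by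
  intro χ
  have : derivCon S ≤ Con.ker χ := by
    refine Con.conGen_le.2 ?_
    rintro _ _ ⟨e, he, φ, rfl, rfl⟩
    exact hM e he (χ.comp φ)
  exact this h

theorem varOf_eq_generatedVariety {S : Set (Word × Word)} {M : Type} [Monoid M]
    (hsound : ∀ e ∈ S, Satisfies M e) (hcomplete : ∀ u v, Satisfies M (u, v) → derivCon S u v) :
    varOf.{w} S = generatedVariety.{w} M := by
  ext N
  constructor
  · rintro hN ⟨u, v⟩ he
    exact derivCon_sound hN (hcomplete u v he)
  · intro hN e he
    exact hN e (hsound e he)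

/-! ### Classes of the congruences `τ₁`, `γ` and `ζ` -/

theorem tauOne_letter_pow (i n : ℕ) : tauOne (letter i ^ (n + 1)) (letter i) := by
  induction n with
  | zero => simpa using tauOne.refl _
  | succ n ih =>
    rw [pow_succ]
    exact tauOne.trans (tauOne.mul ih (tauOne.refl _))
      (tauOne.symm (ConGen.Rel.of _ _ ⟨i, rfl, rfl⟩))

theorem tauOne_letter_pow_of_pos (i : ℕ) {n : ℕ} (hn : 1 ≤ n) :
    tauOne (letter i ^ n) (letter i) := by
  obtain ⟨m, rfl⟩ := Nat.exists_eq_add_of_le' hn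
  exact tauOne_letter_pow i m

/-- The word obtained by collapsing runs of equal letters. -/
def collapse : List ℕ → List ℕ
  | [] => []
  | x :: l => if (collapse l).head? = some x then collapse l else x :: collapse l

theorem head?_collapse_cons (x : ℕ) (l : List ℕ) : (collapse (x :: l)).head? = some x := by
  rw [collapse]
  split_ifs with h
  · exact h
  · rfl

theorem collapse_append_dup (p : List ℕ) (x : ℕ) (s : List ℕ) :
    collapse (p ++ x :: x :: s) = collapse (p ++ x :: s) := by
  induction p with
  | nil =>
    rw [List.nil_append, List.nil_append, collapse, if_pos (head?_collapse_cons x s)]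
  | cons y p ih => rw [List.cons_append, List.cons_append, collapse, ih, collapse]

/-- The syntactic congruence of the set of words with a given collapse contains the generators of
`tauOne`. -/
theorem collapse_eq_of_tauOne {u v : Word} (h : tauOne u v) :
    collapse u.toList = collapse v.toList := by
  have : tauOne ≤ syntacticCon {w | collapse w.toList = collapse v.toList} := by
    refine Con.conGen_le.2 ?_
    rintro _ _ ⟨i, rfl, rfl⟩ p s
    have := collapse_append_dup p.toList i s.toList
    simp only [Set.mem_ofPred_eq, FreeMonoid.toList_mul, FreeMonoid.toList_of, List.append_assoc,
      List.cons_append, List.nil_append, this]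
  simpa using this h 1 1

theorem exists_of_collapse_eq_cons {w : List ℕ} {c : ℕ} {l : List ℕ} (h : collapse w = c :: l) :
    ∃ (n : ℕ) (w' : List ℕ), w = List.replicate (n + 1) c ++ w' ∧ collapse w' = l := by
  induction w with
  | nil => simp [collapse] at h
  | cons x w ih =>
    rw [collapse] at h
    split_ifs at h with hx
    · obtain ⟨n, w', rfl, hw'⟩ := ih h
      rw [h] at hx
      obtain rfl : c = x := by simpa using hx
      exact ⟨n + 1, w', by simp [List.replicate_succ], hw'⟩
    · obtain ⟨rfl, rfl⟩ := List.cons.inj h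
      exact ⟨0, w, by simp, rfl⟩

theorem eq_nil_of_collapse_eq_nil {w : List ℕ} (h : collapse w = []) : w = [] := by
  cases w with
  | nil => rfl
  | cons x w => have := head?_collapse_cons x w; simp [h] at this

/-- The words whose projection to the letters in `p` starts with `l`, up to two letters. -/
def prefixLanguage (p : ℕ → Bool) (l : List ℕ) : Set Word :=
  {w | (w.toList.filter p).take 2 = l}

/-- The syntactic monoid of `prefixLanguage` belongs to the variety, so it detects this invariant;
the empty context is enough. -/
theorem take_two_filter_of_fullyInvariantCon {S : Set (Word × Word)} {p : ℕ → Bool}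
    (hS : ∀ l, ∀ e ∈ S, Satisfies (SyntacticMonoid (prefixLanguage p l)) e)
    {u v : Word} (h : fullyInvariantCon (varOf S) u v) :
    (u.toList.filter p).take 2 = (v.toList.filter p).take 2 := by
  have h1 := h (MonCat.of (SyntacticMonoid (prefixLanguage p ((v.toList.filter p).take 2))))
    (fun e he => hS _ e he)
  have h2 := (satisfies_quotient_iff _ _).1 h1 (MonoidHom.id _) 1 1
  have h3 : u ∈ prefixLanguage p ((v.toList.filter p).take 2) := by
    simpa using h2.2 (by simp [prefixLanguage])
  exact h3

/-- If the value of `x` has a letter in `p`, then `xtx` already supplies two such letters and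
nothing after it is seen. Otherwise the projections of both sides coincide. -/
theorem take_two_filter_of_zetaCon {u v : Word} (p : ℕ → Bool) (h : zetaCon u v) :
    (u.toList.filter p).take 2 = (v.toList.filter p).take 2 := by
  refine take_two_filter_of_fullyInvariantCon ?_ h
  rintro l _ rfl
  rw [satisfies_quotient_iff]
  intro φ q r
  simp only [map_mul, prefixLanguage, Set.mem_ofPred_eq, FreeMonoid.toList_mul, List.filter_append]
  generalize List.filter p (φ (letter 0)).toList = X
  generalize List.filter p (φ (letter 1)).toList = T
  generalize List.filter p (φ (letter 2)).toList = Y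
  generalize List.filter p q.toList = Q
  generalize List.filter p r.toList = R
  rcases X with _ | ⟨x, X⟩
  · simp
  have key : ∀ A : List ℕ, (Q ++ (x :: X ++ T ++ x :: X ++ A)).take 2 =
      (Q ++ (x :: X ++ T ++ x :: X)).take 2 := by
    intro A
    rw [← List.append_assoc]
    apply List.take_append_of_le_length
    simp
    omega
  have h1 := key (Y ++ R)
  have h2 := key (Y ++ (x :: X ++ R))
  simp only [List.append_assoc] at h1 h2 ⊢
  rw [h1, h2]

theorem count_of_gammaCon {u v : Word} (h : gammaCon u v) (x : ℕ) :
    min (u.toList.count x) 2 = min (v.toList.count x) 2 := by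
  have hrep : ∀ w : List ℕ, w.filter (fun y => y == x) = List.replicate (w.count x) x :=
    fun w => List.filter_beq x
  have := take_two_filter_of_fullyInvariantCon (p := fun y => y == x) ?_ h
  · simpa only [hrep, List.take_replicate, List.length_replicate,
      min_comm 2] using congrArg List.length this
  · rintro l _ (rfl | rfl) <;>
    · rw [satisfies_quotient_iff]
      intro φ q r
      simp only [map_mul, prefixLanguage, Set.mem_ofPred_eq, FreeMonoid.toList_mul,
        hrep, List.take_replicate, pow_succ, pow_zero, one_mul, List.count_append]
      have : ∀ a b : ℕ, a = b → (List.replicate a x = l ↔ List.replicate b x = l) := by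
        rintro a _ rfl; rfl
      apply this
      omega

/-- In a commutative monoid the value of a word is a product of powers, and `x² = x³` makes each
exponent matter only up to two. -/
theorem gammaCon_of_count {u v : Word}
    (h : ∀ x, min (u.toList.count x) 2 = min (v.toList.count x) 2) : gammaCon u v := by
  intro N hN φ
  let φ' : Word →* N := φ
  have hcomm : ∀ m n : N, m * n = n * m := fun m n => by
    simpa using hN _ (Or.inl rfl) (FreeMonoid.lift fun i => if i = 0 then m else n)
  have hpow : ∀ m : N, m ^ 2 = m ^ 3 := fun m => by
    simpa using hN _ (Or.inr rfl) (FreeMonoid.lift fun _ => m)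
  let : CommMonoid N := { (inferInstance : Monoid N) with mul_comm := hcomm }
  have hpow' : ∀ (m : N) (k : ℕ), m ^ (k + 2) = m ^ 2 := by
    intro m k
    induction k with
    | zero => rfl
    | succ k ih => rw [show k + 1 + 2 = (k + 2) + 1 by ring, pow_succ, ih, ← pow_succ, hpow]
  have hmin : ∀ (m : N) (k : ℕ), m ^ k = m ^ min k 2 := by
    intro m k
    rcases le_total k 2 with hk | hk
    · rw [min_eq_left hk]
    · obtain ⟨j, rfl⟩ := Nat.exists_eq_add_of_le' hk
      rw [min_eq_right hk, hpow']
  have hprod : ∀ w : Word, φ' w = (w.toList.map fun i => φ' (letter i)).prod := by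
    intro w
    induction w using FreeMonoid.inductionOn' with
    | one => simp
    | of_mul i w ih => simp [ih]
  have hsupp : u.toList.toFinset = v.toList.toFinset := by
    ext x
    have := h x
    simp only [List.mem_toFinset, ← List.count_pos_iff]
    omega
  change φ' u = φ' v
  rw [hprod u, hprod v, Finset.prod_list_map_count, Finset.prod_list_map_count, hsupp]
  exact Finset.prod_congr rfl fun x _ => by rw [hmin, h x, ← hmin]

/-! ### The languages of the theorem as congruence classes -/

theorem toList_letter_pow (i n : ℕ) : (letter i ^ n).toList = List.replicate n i := by
  induction n with
  | zero => rfl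
  | succ n ih => rw [pow_succ, FreeMonoid.toList_mul, ih, FreeMonoid.toList_of,
      List.replicate_succ']

theorem exists_pow_of_collapse_eq_cons {w : Word} {c : ℕ} {l : List ℕ}
    (h : collapse w.toList = c :: l) :
    ∃ (n : ℕ) (w' : Word), 1 ≤ n ∧ w = letter c ^ n * w' ∧ collapse w'.toList = l := by
  obtain ⟨n, w', h1, h2⟩ := exists_of_collapse_eq_cons h
  refine ⟨n + 1, FreeMonoid.ofList w', by omega, ?_, h2⟩
  apply FreeMonoid.toList.injective
  rw [FreeMonoid.toList_mul, toList_letter_pow, h1, FreeMonoid.toList_ofList]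

theorem eq_one_of_collapse_eq_nil {w : Word} (h : collapse w.toList = []) : w = 1 :=
  FreeMonoid.toList.injective (eq_nil_of_collapse_eq_nil h)

theorem conClass_tauOne_ab {a b : ℕ} (hab : a ≠ b) :
    conClass tauOne (letter a * letter b) = plus a * plus b := by
  ext w
  constructor
  · intro h
    have h1 := collapse_eq_of_tauOne h
    rw [show collapse (letter a * letter b).toList = [a, b] by
      simp [collapse, hab.symm]] at h1
    obtain ⟨i, w, hi, rfl, h2⟩ := exists_pow_of_collapse_eq_cons h1
    obtain ⟨j, w, hj, rfl, h3⟩ := exists_pow_of_collapse_eq_cons h2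
    rw [eq_one_of_collapse_eq_nil h3, mul_one]
    exact Set.mul_mem_mul ⟨i, hi, rfl⟩ ⟨j, hj, rfl⟩
  · rintro ⟨_, ⟨i, hi, rfl⟩, _, ⟨j, hj, rfl⟩, rfl⟩
    exact tauOne.mul (tauOne_letter_pow_of_pos a hi) (tauOne_letter_pow_of_pos b hj)

theorem mem_languageA_iff {a b t : ℕ} {w : Word} :
    w ∈ plus a * {letter b} * plus b * {letter t} * plus a ↔
      ∃ i j k : ℕ, 1 ≤ i ∧ 2 ≤ j ∧ 1 ≤ k ∧
        w = letter a ^ i * letter b ^ j * letter t * letter a ^ k := by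
  simp only [plus, Set.mem_mul, Set.mem_ofPred_eq, Set.mem_singleton_iff]
  constructor
  · rintro ⟨_, ⟨_, ⟨_, ⟨_, ⟨i, hi, rfl⟩, _, rfl, rfl⟩, _, ⟨j, hj, rfl⟩, rfl⟩, _, rfl, rfl⟩, _,
      ⟨k, hk, rfl⟩, rfl⟩
    exact ⟨i, j + 1, k, hi, by omega, hk, by simp only [pow_succ', mul_assoc]⟩
  · rintro ⟨i, j, k, hi, hj, hk, rfl⟩
    obtain ⟨j, rfl⟩ := Nat.exists_eq_add_of_le' hj
    exact ⟨_, ⟨_, ⟨_, ⟨_, ⟨i, hi, rfl⟩, _, rfl, rfl⟩, _, ⟨j + 1, by omega, rfl⟩, rfl⟩, _, rfl,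
      rfl⟩, _, ⟨k, hk, rfl⟩, by simp only [pow_succ', mul_assoc]⟩

theorem conClass_languageA {a b t : ℕ} (hab : a ≠ b) (hat : a ≠ t) (hbt : b ≠ t) :
    conClass (tauOne ⊓ gammaCon) (letter a * letter b ^ 2 * letter t * letter a) =
      plus a * {letter b} * plus b * {letter t} * plus a := by
  ext w
  rw [mem_languageA_iff]
  constructor
  · rintro ⟨h, hγ⟩
    have h1 := collapse_eq_of_tauOne h
    rw [show collapse (letter a * letter b ^ 2 * letter t * letter a).toList = [a, b, t, a] by
      simp [collapse, pow_two, hab.symm, hat, hbt.symm]] at h1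
    obtain ⟨i, w, hi, rfl, h2⟩ := exists_pow_of_collapse_eq_cons h1
    obtain ⟨j, w, hj, rfl, h3⟩ := exists_pow_of_collapse_eq_cons h2
    obtain ⟨k, w, hk, rfl, h4⟩ := exists_pow_of_collapse_eq_cons h3
    obtain ⟨m, w, hm, rfl, h5⟩ := exists_pow_of_collapse_eq_cons h4
    rw [eq_one_of_collapse_eq_nil h5, mul_one] at hγ ⊢
    -- The runs are known from `tauOne`; the counts force at least two letters `b` and exactly one
    -- `t`.
    have hb := count_of_gammaCon hγ b
    have ht := count_of_gammaCon hγ t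
    simp [toList_letter_pow, List.count_replicate, hab, hat, hbt, hab.symm, hat.symm, hbt.symm]
      at hb ht
    obtain rfl : k = 1 := by omega
    exact ⟨i, j, m, hi, by omega, hm, by simp only [pow_one, mul_assoc]⟩
  · rintro ⟨i, j, k, hi, hj, hk, rfl⟩
    refine ⟨?_, ?_⟩
    · refine tauOne.mul (tauOne.mul (tauOne.mul (tauOne_letter_pow_of_pos a hi) ?_)
        (tauOne.refl _)) (tauOne_letter_pow_of_pos a hk)
      exact tauOne.trans (tauOne_letter_pow_of_pos b (by omega))
        (tauOne.symm (tauOne_letter_pow_of_pos b (by omega)))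
    · apply gammaCon_of_count
      intro x
      simp [toList_letter_pow, List.count_replicate, List.count_cons]
      split_ifs <;> omega

/-! ### The monoids `A₀¹` and `A¹` -/

namespace SemigroupA0

instance : DecidableEq SemigroupA0 := fun x y => by
  cases x <;> cases y <;> first | exact isTrue rfl | exact isFalse nofun

instance : Fintype SemigroupA0 := ⟨{a, b, ba, zero}, by rintro ⟨⟩ <;> decide⟩

end SemigroupA0

namespace SemigroupA

instance : DecidableEq SemigroupA := fun x y => by
  cases x <;> cases y <;> first | exact isTrue rfl | exact isFalse nofun

instance : Fintype SemigroupA := ⟨{a, b, c, ba, bc, zero}, by rintro ⟨⟩ <;> decide⟩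

end SemigroupA

instance (S : Type) [DecidableEq S] : DecidableEq (WithOne S) :=
  inferInstanceAs (DecidableEq (Option S))

instance (S : Type) [Fintype S] : Fintype (WithOne S) := inferInstanceAs (Fintype (Option S))

/-- Contexts around the single element `ba` separate all points, so `A₀¹` is the syntactic monoid of
any language that is the inverse image of `ba` under a surjective homomorphism. -/
theorem disjunctive_A0 : ∀ m m' : WithOne SemigroupA0,
    (∀ p q : WithOne SemigroupA0, p * m * q = ↑SemigroupA0.ba ↔ p * m' * q = ↑SemigroupA0.ba) →
      m = m' := by
  decide

set_option maxRecDepth 10000 in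
theorem disjunctive_A : ∀ m m' : WithOne SemigroupA,
    (∀ p q : WithOne SemigroupA, p * m * q = ↑SemigroupA.bc ↔ p * m' * q = ↑SemigroupA.bc) →
      m = m' := by
  decide

/-- The homomorphism onto `A₀¹` that sends `a` and `b` to the generators `b` and `a`. -/
def evalA0 (a b : ℕ) : Word →* WithOne SemigroupA0 :=
  FreeMonoid.lift fun i =>
    if i = a then ↑SemigroupA0.b else if i = b then ↑SemigroupA0.a else ↑SemigroupA0.zero

/-- The homomorphism onto `A¹` that sends `a`, `b` and `t` to the generators `b`, `a` and `c`. -/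
def evalA (a b t : ℕ) : Word →* WithOne SemigroupA :=
  FreeMonoid.lift fun i =>
    if i = a then ↑SemigroupA.b else if i = b then ↑SemigroupA.a else
      if i = t then ↑SemigroupA.c else ↑SemigroupA.zero

theorem A0_absorb (m : WithOne SemigroupA0) :
    ↑SemigroupA0.zero * m = ↑SemigroupA0.zero ∧ m * ↑SemigroupA0.zero = ↑SemigroupA0.zero := by
  revert m; decide

theorem A_absorb (m : WithOne SemigroupA) :
    ↑SemigroupA.zero * m = ↑SemigroupA.zero ∧ m * ↑SemigroupA.zero = ↑SemigroupA.zero := by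
  revert m; decide

theorem A0_pow_succ (n : ℕ) :
    (SemigroupA0.a : WithOne SemigroupA0) ^ (n + 1) = ↑SemigroupA0.a ∧
      (SemigroupA0.b : WithOne SemigroupA0) ^ (n + 1) = ↑SemigroupA0.b :=
  ⟨IsIdempotentElem.pow_succ_eq n rfl, IsIdempotentElem.pow_succ_eq n rfl⟩

theorem A_pow_succ (n : ℕ) :
    (SemigroupA.a : WithOne SemigroupA) ^ (n + 1) = ↑SemigroupA.a ∧
      (SemigroupA.b : WithOne SemigroupA) ^ (n + 1) = ↑SemigroupA.b :=
  ⟨IsIdempotentElem.pow_succ_eq n rfl, IsIdempotentElem.pow_succ_eq n rfl⟩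

section EvalA0

variable {a b : ℕ}

theorem evalA0_a : evalA0 a b (letter a) = ↑SemigroupA0.b := by simp [evalA0]

theorem evalA0_b (hab : a ≠ b) : evalA0 a b (letter b) = ↑SemigroupA0.a := by
  simp [evalA0, hab.symm]

/-- A letter `b` directly before an `a` evaluates to the product `ab = 0` of the generators. -/
theorem eq_pow_mul_pow_of_evalA0 (hab : a ≠ b) (w : Word)
    (hw : evalA0 a b w ≠ ↑SemigroupA0.zero) : ∃ i j : ℕ, w = letter a ^ i * letter b ^ j := by
  induction w using FreeMonoid.inductionOn' with
  | one => exact ⟨0, 0, rfl⟩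
  | of_mul x w ih =>
    rw [map_mul] at hw
    obtain ⟨i, j, rfl⟩ := ih (fun h => hw (by rw [h, (A0_absorb _).2]))
    by_cases hxa : x = a
    · subst hxa
      exact ⟨i + 1, j, by rw [pow_succ', mul_assoc]⟩
    by_cases hxb : x = b
    · subst hxb
      cases i with
      | zero => exact ⟨0, j + 1, by simp [pow_succ']⟩
      | succ i =>
        refine (hw ?_).elim
        rw [map_mul, map_pow, evalA0_b hab, evalA0_a, (A0_pow_succ i).2, ← mul_assoc]
        exact (A0_absorb _).1
    · refine (hw ?_).elim
      have : evalA0 a b (letter x) = ↑SemigroupA0.zero := by simp [evalA0, hxa, hxb]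
      rw [this, (A0_absorb _).1]

theorem surjective_evalA0 (hab : a ≠ b) : Function.Surjective (evalA0 a b) := by
  intro m
  induction m using WithOne.recOneCoe with
  | one => exact ⟨1, map_one _⟩
  | coe m =>
    cases m with
    | a => exact ⟨_, evalA0_b hab⟩
    | b => exact ⟨_, evalA0_a⟩
    | ba => exact ⟨letter a * letter b, by rw [map_mul, evalA0_a, evalA0_b hab]; rfl⟩
    | zero =>
      exact ⟨letter b * letter a, by rw [map_mul, evalA0_a, evalA0_b hab]; rfl⟩

theorem evalA0_pow_mul_pow (hab : a ≠ b) (i j : ℕ) :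
    evalA0 a b (letter a ^ i * letter b ^ j) =
      (↑SemigroupA0.b) ^ i * (↑SemigroupA0.a) ^ j := by
  rw [map_mul, map_pow, map_pow, evalA0_a, evalA0_b hab]

/-- A factor of `a⁺b⁺` has nonzero value, so both sides are of the form `aⁱbʲ`. The value tells
which exponents vanish, and `tauOne` sees nothing else. -/
theorem tauOne_of_satisfies_A0 (hab : a ≠ b) {u v p s : Word}
    (h : Satisfies (WithOne SemigroupA0) (u, v)) (hu : p * u * s ∈ plus a * plus b) :
    tauOne u v := by
  obtain ⟨_, ⟨i, hi, rfl⟩, _, ⟨j, hj, rfl⟩, hpus⟩ := hu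
  have hu0 : evalA0 a b u ≠ ↑SemigroupA0.zero := by
    intro h0
    have h1 : evalA0 a b (p * u * s) = ↑SemigroupA0.zero := by
      rw [map_mul, map_mul, h0, (A0_absorb _).2, (A0_absorb _).1]
    obtain ⟨i, rfl⟩ := Nat.exists_eq_add_of_le' hi
    obtain ⟨j, rfl⟩ := Nat.exists_eq_add_of_le' hj
    simp only at hpus
    rw [← hpus, evalA0_pow_mul_pow hab, (A0_pow_succ i).2, (A0_pow_succ j).1] at h1
    exact absurd h1 (by decide)
  have he : evalA0 a b u = evalA0 a b v := h _
  obtain ⟨i, j, rfl⟩ := eq_pow_mul_pow_of_evalA0 hab u hu0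
  obtain ⟨i', j', rfl⟩ := eq_pow_mul_pow_of_evalA0 hab v (he ▸ hu0)
  rw [evalA0_pow_mul_pow hab, evalA0_pow_mul_pow hab] at he
  have key : ∀ (x k l : ℕ), (k = 0 ↔ l = 0) → tauOne (letter x ^ k) (letter x ^ l) := by
    intro x k l hkl
    rcases Nat.eq_zero_or_pos k with hk | hk
    · rw [hk, hkl.1 hk]; exact tauOne.refl _
    · exact tauOne.trans (tauOne_letter_pow_of_pos x hk)
        (tauOne.symm (tauOne_letter_pow_of_pos x (by omega)))
  rcases i with _ | i <;> rcases j with _ | j <;> rcases i' with _ | i' <;>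
    rcases j' with _ | j' <;>
    simp only [A0_pow_succ, pow_zero] at he <;>
    first
      | exact absurd he (by decide)
      | exact tauOne.mul (key _ _ _ (by simp)) (key _ _ _ (by simp))

end EvalA0

theorem satisfies_A0_iff (a b : ℕ) (hab : a ≠ b) (e : Word × Word) :
    (Satisfies (WithOne SemigroupA0) e ↔
      Satisfies (MTau tauOne (conClass tauOne (letter a * letter b))) e) ∧
    (Satisfies (MTau tauOne (conClass tauOne (letter a * letter b))) e ↔
      Satisfies (SyntacticMonoid (plus a * plus b)) e) := by
  have h1 : Satisfies (WithOne SemigroupA0) e →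
      Satisfies (MTau tauOne (conClass tauOne (letter a * letter b))) e := by
    intro h
    apply satisfies_MTau_of
    rw [conClass_tauOne_ab hab]
    rintro φ p s (h' | h')
    · exact tauOne_of_satisfies_A0 hab (h.subst φ) h'
    · exact tauOne.symm (tauOne_of_satisfies_A0 hab (fun χ => (h.subst φ χ).symm) h')
  have h2 : Satisfies (MTau tauOne (conClass tauOne (letter a * letter b))) e →
      Satisfies (SyntacticMonoid (plus a * plus b)) e := by
    intro h
    have := h.quotient_mono (reesCon_le_syntacticCon _ _)
    rwa [conClass_tauOne_ab hab] at this
  have h3 : Satisfies (SyntacticMonoid (plus a * plus b)) e →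
      Satisfies (WithOne SemigroupA0) e := by
    refine satisfies_of_syntactic (evalA0 a b) (surjective_evalA0 hab) (MonoidHom.id _)
      {↑SemigroupA0.ba} (fun w => ?_) disjunctive_A0
    rw [MonoidHom.id_apply, Set.mem_singleton_iff]
    constructor
    · rintro ⟨_, ⟨i, hi, rfl⟩, _, ⟨j, hj, rfl⟩, rfl⟩
      obtain ⟨i, rfl⟩ := Nat.exists_eq_add_of_le' hi
      obtain ⟨j, rfl⟩ := Nat.exists_eq_add_of_le' hj
      change evalA0 a b (letter a ^ (i + 1) * letter b ^ (j + 1)) = _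
      rw [evalA0_pow_mul_pow hab, (A0_pow_succ i).2, (A0_pow_succ j).1]
      rfl
    · intro h
      obtain ⟨i, j, rfl⟩ := eq_pow_mul_pow_of_evalA0 hab w (by rw [h]; decide)
      rw [evalA0_pow_mul_pow hab] at h
      rcases i with _ | i <;> rcases j with _ | j <;>
        simp only [A0_pow_succ, pow_zero] at h <;>
        first
          | exact absurd h (by decide)
          | exact Set.mul_mem_mul ⟨_, by omega, rfl⟩ ⟨_, by omega, rfl⟩
  exact ⟨⟨h1, fun h => h3 (h2 h)⟩, ⟨h2, fun h => h1 (h3 h)⟩⟩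

section EvalA

variable {a b t : ℕ}

theorem evalA_a : evalA a b t (letter a) = ↑SemigroupA.b := by simp [evalA]

theorem evalA_b (hab : a ≠ b) : evalA a b t (letter b) = ↑SemigroupA.a := by
  simp [evalA, hab.symm]

theorem evalA_t (hat : a ≠ t) (hbt : b ≠ t) : evalA a b t (letter t) = ↑SemigroupA.c := by
  simp [evalA, hat.symm, hbt.symm]

theorem A_c_mul_pow (i : ℕ) :
    (SemigroupA.c : WithOne SemigroupA) * ↑SemigroupA.b ^ i = ↑SemigroupA.c := by
  cases i with
  | zero => rfl
  | succ i => rw [(A_pow_succ i).2]; rfl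

theorem eq_of_evalA (hab : a ≠ b) (hat : a ≠ t) (hbt : b ≠ t) (w : Word)
    (hw : evalA a b t w ≠ ↑SemigroupA.zero) :
    (∃ i j : ℕ, w = letter a ^ i * letter b ^ j) ∨
      ∃ i j k : ℕ, w = letter a ^ i * letter b ^ j * letter t * letter a ^ k := by
  induction w using FreeMonoid.inductionOn' with
  | one => exact Or.inl ⟨0, 0, rfl⟩
  | of_mul x w ih =>
    rw [map_mul] at hw
    replace ih := ih (fun h => hw (by rw [h, (A_absorb _).2]))
    by_cases hxa : x = a
    · subst hxa
      rcases ih with ⟨i, j, rfl⟩ | ⟨i, j, k, rfl⟩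
      · exact Or.inl ⟨i + 1, j, by simp only [pow_succ', mul_assoc]⟩
      · exact Or.inr ⟨i + 1, j, k, by simp only [pow_succ', mul_assoc]⟩
    by_cases hxb : x = b
    · subst hxb
      have hmul : ∀ i : ℕ, (SemigroupA.a : WithOne SemigroupA) * ↑SemigroupA.b ^ (i + 1) =
          ↑SemigroupA.zero := fun i => by rw [(A_pow_succ i).2]; rfl
      rcases ih with ⟨i, j, rfl⟩ | ⟨i, j, k, rfl⟩
      · cases i with
        | zero => exact Or.inl ⟨0, j + 1, by simp only [pow_succ', pow_zero, one_mul]⟩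
        | succ i =>
          refine (hw ?_).elim
          simp only [map_mul, map_pow, evalA_b hab, evalA_a, ← mul_assoc, hmul, A_absorb]
      · cases i with
        | zero => exact Or.inr ⟨0, j + 1, k, by simp only [pow_succ', pow_zero, one_mul, mul_assoc]⟩
        | succ i =>
          refine (hw ?_).elim
          simp only [map_mul, map_pow, evalA_b hab, evalA_a, ← mul_assoc, hmul, A_absorb]
    by_cases hxt : x = t
    · subst hxt
      have hmul : ∀ j : ℕ, (SemigroupA.c : WithOne SemigroupA) * ↑SemigroupA.a ^ (j + 1) =
          ↑SemigroupA.zero := fun j => by rw [(A_pow_succ j).1]; rfl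
      rcases ih with ⟨i, _ | j, rfl⟩ | ⟨i, _ | j, k, rfl⟩
      · exact Or.inr ⟨0, 0, i, by simp⟩
      · refine (hw ?_).elim
        simp only [map_mul, map_pow, evalA_b hab, evalA_a, evalA_t hat hbt, ← mul_assoc,
          A_c_mul_pow, hmul]
      · refine (hw ?_).elim
        simp only [map_mul, map_pow, evalA_a, evalA_t hat hbt, ← mul_assoc,
          A_c_mul_pow, pow_zero, mul_one]
        exact (A_absorb _).1
      · refine (hw ?_).elim
        simp only [map_mul, map_pow, evalA_b hab, evalA_a, evalA_t hat hbt, ← mul_assoc,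
          A_c_mul_pow, hmul, A_absorb]
    · refine (hw ?_).elim
      have : evalA a b t (letter x) = ↑SemigroupA.zero := by simp [evalA, hxa, hxb, hxt]
      rw [this, (A_absorb _).1]

theorem surjective_evalA (hab : a ≠ b) (hat : a ≠ t) (hbt : b ≠ t) :
    Function.Surjective (evalA a b t) := by
  intro m
  induction m using WithOne.recOneCoe with
  | one => exact ⟨1, map_one _⟩
  | coe m =>
    cases m with
    | a => exact ⟨_, evalA_b hab⟩
    | b => exact ⟨_, evalA_a⟩
    | c => exact ⟨_, evalA_t hat hbt⟩
    | ba => exact ⟨letter a * letter b, by rw [map_mul, evalA_a, evalA_b hab]; rfl⟩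
    | bc => exact ⟨letter a * letter t, by rw [map_mul, evalA_a, evalA_t hat hbt]; rfl⟩
    | zero => exact ⟨letter b * letter a, by rw [map_mul, evalA_a, evalA_b hab]; rfl⟩

theorem evalA_pow (hab : a ≠ b) (i j : ℕ) :
    evalA a b t (letter a ^ i * letter b ^ j) = (↑SemigroupA.b) ^ i * (↑SemigroupA.a) ^ j := by
  rw [map_mul, map_pow, map_pow, evalA_a, evalA_b hab]

theorem A_pow_mul_c (j : ℕ) :
    (SemigroupA.a : WithOne SemigroupA) ^ j * ↑SemigroupA.c = ↑SemigroupA.c := by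
  cases j with
  | zero => rfl
  | succ i => rw [(A_pow_succ i).1]; rfl

theorem evalA_pow' (hab : a ≠ b) (hat : a ≠ t) (hbt : b ≠ t) (i j k : ℕ) :
    evalA a b t (letter a ^ i * letter b ^ j * letter t * letter a ^ k) =
      (↑SemigroupA.b) ^ i * ↑SemigroupA.c := by
  rw [map_mul, map_mul, evalA_pow hab, map_pow, evalA_a, evalA_t hat hbt, mul_assoc, mul_assoc,
    A_c_mul_pow, A_pow_mul_c]

/-- Since `c² = 0`, sending `x` to `c` and all other letters to `1` counts the occurrences of `x` up
to two. -/
theorem count_of_satisfies_A {u v : Word} (h : Satisfies (WithOne SemigroupA) (u, v)) (x : ℕ) :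
    min (u.toList.count x) 2 = min (v.toList.count x) 2 := by
  have hval : ∀ w : Word, FreeMonoid.lift (fun i => if i = x then
      (SemigroupA.c : WithOne SemigroupA) else 1) w = ↑SemigroupA.c ^ (min (w.toList.count x) 2) := by
    intro w
    induction w using FreeMonoid.inductionOn' with
    | one => rfl
    | of_mul y w ih =>
      rw [map_mul, ih, FreeMonoid.lift_eval_of, FreeMonoid.toList_of_mul, List.count_cons]
      by_cases hy : y = x
      · simp only [hy, if_true, beq_self_eq_true]
        rcases w.toList.count x with _ | _ | n
        · rfl
        · rfl
        · rw [min_eq_right (by omega), min_eq_right (by omega)]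
          rfl
      · simp [hy]
  have := h (FreeMonoid.lift (fun i => if i = x then (SemigroupA.c : WithOne SemigroupA) else 1))
  simp only [hval] at this
  have h1 : min (u.toList.count x) 2 ≤ 2 := min_le_right _ _
  have h2 : min (v.toList.count x) 2 ≤ 2 := min_le_right _ _
  revert this
  generalize min (u.toList.count x) 2 = m at *
  generalize min (v.toList.count x) 2 = n at *
  interval_cases m <;> interval_cases n <;> decide

theorem tauOne_inf_gammaCon_of_satisfies_A (hab : a ≠ b) (hat : a ≠ t) (hbt : b ≠ t)
    {u v p s : Word} (h : Satisfies (WithOne SemigroupA) (u, v))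
    (hu : p * u * s ∈ plus a * {letter b} * plus b * {letter t} * plus a) :
    (tauOne ⊓ gammaCon) u v := by
  refine ⟨?_, gammaCon_of_count (count_of_satisfies_A h)⟩
  have hcount := count_of_satisfies_A h
  rw [mem_languageA_iff] at hu
  obtain ⟨i, j, k, hi, hj, hk, hpus⟩ := hu
  have hu0 : evalA a b t u ≠ ↑SemigroupA.zero := by
    intro h0
    have h1 : evalA a b t (p * u * s) = ↑SemigroupA.zero := by
      rw [map_mul, map_mul, h0, (A_absorb _).2, (A_absorb _).1]
    obtain ⟨i, rfl⟩ := Nat.exists_eq_add_of_le' hi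
    rw [hpus, evalA_pow' hab hat hbt, (A_pow_succ i).2] at h1
    exact absurd h1 (by decide)
  have he : evalA a b t u = evalA a b t v := h _
  have key : ∀ (x k l : ℕ), (k = 0 ↔ l = 0) → tauOne (letter x ^ k) (letter x ^ l) := by
    intro x k l hkl
    rcases Nat.eq_zero_or_pos k with hk | hk
    · rw [hk, hkl.1 hk]; exact tauOne.refl _
    · exact tauOne.trans (tauOne_letter_pow_of_pos x hk)
        (tauOne.symm (tauOne_letter_pow_of_pos x (by omega)))
  have ha := hcount a
  have hb := hcount b
  have ht := hcount t
  rcases eq_of_evalA hab hat hbt u hu0 with ⟨i, j, rfl⟩ | ⟨i, j, k, rfl⟩ <;>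
  rcases eq_of_evalA hab hat hbt v (he ▸ hu0) with ⟨i', j', rfl⟩ | ⟨i', j', k', rfl⟩ <;>
  simp [toList_letter_pow, List.count_replicate, hab, hat, hbt, hab.symm,
    hat.symm, hbt.symm] at ha hb ht
  · exact tauOne.mul (key _ _ _ (by omega)) (key _ _ _ (by omega))
  -- The counts do not tell on which side of `t` the letters `a` stand; evaluations must decide
  -- this. The standard one detects an `a` before `t`.
  · have hi0 : i = 0 ↔ i' = 0 := by
      rw [evalA_pow' hab hat hbt, evalA_pow' hab hat hbt] at he
      rcases i with _ | i <;> rcases i' with _ | i' <;>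
        simp only [A_pow_succ, pow_zero] at he <;>
        first
          | exact absurd he (by decide)
          | simp
    have hk0 : k = 0 ↔ k' = 0 := by
      -- As `ac = c` and `ca = 0`, this substitution detects an `a` after `t` and ignores those
      -- before it.
      have := h (FreeMonoid.lift fun i => if i = a then (SemigroupA.a : WithOne SemigroupA) else
        if i = t then ↑SemigroupA.c else 1)
      simp only [map_mul, map_pow, FreeMonoid.lift_eval_of, if_true, hat.symm, hab.symm, hbt,
        if_false, one_pow, mul_one, A_pow_mul_c] at this
      rcases k with _ | k <;> rcases k' with _ | k' <;>
        simp only [A_pow_succ, pow_zero] at this <;>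
        first
          | exact absurd this (by decide)
          | simp
    exact tauOne.mul (tauOne.mul (tauOne.mul (key _ _ _ hi0) (key _ _ _ (by omega)))
      (tauOne.refl _)) (key _ _ _ hk0)

end EvalA

theorem satisfies_A_iff (a b t : ℕ) (hab : a ≠ b) (hat : a ≠ t) (hbt : b ≠ t) (e : Word × Word) :
    (Satisfies (WithOne SemigroupA) e ↔
      Satisfies (MTau (tauOne ⊓ gammaCon)
          (conClass (tauOne ⊓ gammaCon) (letter a * letter b ^ 2 * letter t * letter a))) e) ∧
    (Satisfies (MTau (tauOne ⊓ gammaCon)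
          (conClass (tauOne ⊓ gammaCon) (letter a * letter b ^ 2 * letter t * letter a))) e ↔
      Satisfies (SyntacticMonoid (plus a * {letter b} * plus b * {letter t} * plus a)) e) := by
  have h1 : Satisfies (WithOne SemigroupA) e →
      Satisfies (MTau (tauOne ⊓ gammaCon)
          (conClass (tauOne ⊓ gammaCon) (letter a * letter b ^ 2 * letter t * letter a))) e := by
    intro h
    apply satisfies_MTau_of
    rw [conClass_languageA hab hat hbt]
    rintro φ p s (h' | h')
    · exact tauOne_inf_gammaCon_of_satisfies_A hab hat hbt (h.subst φ) h'
    · exact (tauOne ⊓ gammaCon).symm (tauOne_inf_gammaCon_of_satisfies_A hab hat hbt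
        (fun χ => (h.subst φ χ).symm) h')
  have h2 : Satisfies (MTau (tauOne ⊓ gammaCon)
          (conClass (tauOne ⊓ gammaCon) (letter a * letter b ^ 2 * letter t * letter a))) e →
      Satisfies (SyntacticMonoid (plus a * {letter b} * plus b * {letter t} * plus a)) e := by
    intro h
    have := h.quotient_mono (reesCon_le_syntacticCon _ _)
    rwa [conClass_languageA hab hat hbt] at this
  have h3 : Satisfies (SyntacticMonoid (plus a * {letter b} * plus b * {letter t} * plus a)) e →
      Satisfies (WithOne SemigroupA) e := by
    -- The value `bc` is taken on `aⁱbʲtaᵏ` with `i ≥ 1` but arbitrary `j` and `k`. The factors `b²`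
    -- and `a` around `t` supply the letters that the language requires.
    set ψ : Word →* Word := FreeMonoid.lift fun i => if i = b then letter b ^ 2 else
      if i = t then letter b ^ 2 * letter t * letter a else letter i with hψ
    have ha : ψ (letter a) = letter a := by simp [hψ, hab, hat]
    have hb : ψ (letter b) = letter b ^ 2 := by simp [hψ]
    have ht : ψ (letter t) = letter b ^ 2 * letter t * letter a := by simp [hψ, hbt.symm]
    refine satisfies_of_syntactic (evalA a b t) (surjective_evalA hab hat hbt) ψ
      {↑SemigroupA.bc} (fun w => ?_) disjunctive_A
    rw [mem_languageA_iff, Set.mem_singleton_iff]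
    constructor
    · rintro ⟨i, j, k, hi, hj, hk, hw⟩
      -- The added letters are invisible in `A`, where `ac = cb = c` and `a² = a`.
      have hcomp : (evalA a b t).comp ψ = evalA a b t := by
        apply FreeMonoid.hom_eq
        intro x
        rw [MonoidHom.comp_apply]
        by_cases hxb : x = b
        · subst hxb
          rw [hb, map_pow, evalA_b hab]
          exact (A_pow_succ 1).1
        by_cases hxt : x = t
        · subst hxt
          rw [ht, map_mul, map_mul, map_pow, evalA_b hab, evalA_a, evalA_t hat hbt,
            A_pow_mul_c]
          rfl
        · simp [hψ, hxb, hxt]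
      rw [← hcomp, MonoidHom.comp_apply, hw, evalA_pow' hab hat hbt]
      obtain ⟨i, rfl⟩ := Nat.exists_eq_add_of_le' hi
      rw [(A_pow_succ i).2]
      rfl
    · intro h
      rcases eq_of_evalA hab hat hbt w (by rw [h]; decide) with ⟨i, j, rfl⟩ | ⟨i, j, k, rfl⟩
      · rw [evalA_pow hab] at h
        rcases i with _ | i <;> rcases j with _ | j <;>
          simp only [A_pow_succ, pow_zero] at h <;>
          exact absurd h (by decide)
      · rw [evalA_pow' hab hat hbt] at h
        rcases i with _ | i
        · exact absurd h (by decide)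
        · refine ⟨i + 1, 2 * j + 2, k + 1, by omega, by omega, by omega, ?_⟩
          rw [pow_add _ (2 * j) 2, pow_mul]
          simp only [map_mul, map_pow, ha, hb, ht, pow_succ', mul_assoc]
  exact ⟨⟨h1, fun h => h3 (h2 h)⟩, ⟨h2, fun h => h1 (h3 h)⟩⟩

/-! ### The languages `atba⁺sb⁺` and `atbb⁺a⁺` as classes of `τ₁ ∧ ζ` -/

theorem zetaCon_insert (X T Y : Word) : zetaCon (X * T * X * Y) (X * T * X * Y * X) := by
  intro N hN φ
  have := hN _ rfl (φ.comp (FreeMonoid.lift fun i => if i = 0 then X else if i = 1 then T else Y))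
  simpa only [map_mul, MonoidHom.comp_apply, FreeMonoid.lift_eval_of, if_true,
    OfNat.ofNat_ne_zero, if_false, one_ne_zero, OfNat.ofNat_ne_one] using this

theorem zetaCon_pow (X T : Word) (n : ℕ) : zetaCon (X * T * X ^ (n + 1)) (X * T * X) := by
  induction n with
  | zero => simpa using zetaCon.refl _
  | succ n ih =>
    refine zetaCon.trans ?_ ih
    have := zetaCon_insert X T (X ^ n)
    refine zetaCon.symm ?_
    convert this using 1
    · rw [pow_succ', mul_assoc (X * T)]
    · rw [pow_succ, pow_succ', mul_assoc (X * T), mul_assoc (X * T)]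

theorem mem_languageJ_iff {a b t s : ℕ} {w : Word} :
    w ∈ ({letter a} * {letter t} * {letter b} * plus a * {letter s} * plus b : Set Word) ↔
      ∃ i j : ℕ, w = letter a * letter t * letter b * letter a ^ (i + 1) * letter s *
        letter b ^ (j + 1) := by
  simp only [plus, Set.mem_mul, Set.mem_ofPred_eq, Set.mem_singleton_iff]
  constructor
  · rintro ⟨_, ⟨_, ⟨_, ⟨_, ⟨_, rfl, _, rfl, rfl⟩, _, rfl, rfl⟩, _, ⟨i, hi, rfl⟩, rfl⟩, _, rfl,
      rfl⟩, _, ⟨j, hj, rfl⟩, rfl⟩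
    obtain ⟨i, rfl⟩ := Nat.exists_eq_add_of_le' hi
    obtain ⟨j, rfl⟩ := Nat.exists_eq_add_of_le' hj
    exact ⟨i, j, rfl⟩
  · rintro ⟨i, j, rfl⟩
    exact ⟨_, ⟨_, ⟨_, ⟨_, ⟨_, rfl, _, rfl, rfl⟩, _, rfl, rfl⟩, _, ⟨i + 1, by omega, rfl⟩, rfl⟩, _,
      rfl, rfl⟩, _, ⟨j + 1, by omega, rfl⟩, rfl⟩

theorem mem_languageK_iff {a b t : ℕ} {w : Word} :
    w ∈ ({letter a} * {letter t} * {letter b} * plus b * plus a : Set Word) ↔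
      ∃ i j : ℕ, w = letter a * letter t * letter b ^ (i + 2) * letter a ^ (j + 1) := by
  simp only [plus, Set.mem_mul, Set.mem_ofPred_eq, Set.mem_singleton_iff]
  constructor
  · rintro ⟨_, ⟨_, ⟨_, ⟨_, rfl, _, rfl, rfl⟩, _, rfl, rfl⟩, _, ⟨i, hi, rfl⟩, rfl⟩, _,
      ⟨j, hj, rfl⟩, rfl⟩
    obtain ⟨i, rfl⟩ := Nat.exists_eq_add_of_le' hi
    obtain ⟨j, rfl⟩ := Nat.exists_eq_add_of_le' hj
    exact ⟨i, j, by simp only [pow_succ' _ (i + 1), mul_assoc]⟩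
  · rintro ⟨i, j, rfl⟩
    exact ⟨_, ⟨_, ⟨_, ⟨_, rfl, _, rfl, rfl⟩, _, rfl, rfl⟩, _, ⟨i + 1, by omega, rfl⟩, rfl⟩, _,
      ⟨j + 1, by omega, rfl⟩, by simp only [pow_succ' _ (i + 1), mul_assoc]⟩

theorem conClass_languageJ {a b t s : ℕ} (hd : [a, b, t, s].Nodup) :
    conClass (tauOne ⊓ zetaCon)
        (letter a * letter t * letter b * letter a * letter s * letter b) =
      {letter a} * {letter t} * {letter b} * plus a * {letter s} * plus b := by
  obtain ⟨⟨hab, hat, has⟩, ⟨hbt, hbs⟩, hts⟩ :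
      (a ≠ b ∧ a ≠ t ∧ a ≠ s) ∧ (b ≠ t ∧ b ≠ s) ∧ t ≠ s := by simpa using hd
  ext w
  rw [mem_languageJ_iff]
  constructor
  · rintro ⟨h, hζ⟩
    have h1 := collapse_eq_of_tauOne h
    rw [show collapse (letter a * letter t * letter b * letter a * letter s * letter b).toList =
      [a, t, b, a, s, b] by
        simp [collapse, hab, has.symm, hbt, hat.symm, hbs]] at h1
    obtain ⟨n₁, w, hn₁, rfl, h2⟩ := exists_pow_of_collapse_eq_cons h1
    obtain ⟨n₂, w, hn₂, rfl, h3⟩ := exists_pow_of_collapse_eq_cons h2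
    obtain ⟨n₃, w, hn₃, rfl, h4⟩ := exists_pow_of_collapse_eq_cons h3
    obtain ⟨n₄, w, hn₄, rfl, h5⟩ := exists_pow_of_collapse_eq_cons h4
    obtain ⟨n₅, w, hn₅, rfl, h6⟩ := exists_pow_of_collapse_eq_cons h5
    obtain ⟨n₆, w, hn₆, rfl, h7⟩ := exists_pow_of_collapse_eq_cons h6
    rw [eq_one_of_collapse_eq_nil h7, mul_one] at hζ ⊢
    -- The projections to `t` and to `s` show that these letters occur once. Those to `{a, t}` and
    -- `{b, s}` show that the first runs of `a` and of `b` have length one. Later runs are not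
    -- restricted.
    have e1 := take_two_filter_of_zetaCon (fun x => x == t) hζ
    have e2 := take_two_filter_of_zetaCon (fun x => x == s) hζ
    have e3 := take_two_filter_of_zetaCon (fun x => x == a || x == t) hζ
    have e4 := take_two_filter_of_zetaCon (fun x => x == b || x == s) hζ
    simp [toList_letter_pow, hab, hab.symm, hat, has, has.symm,
      hbt, hbt.symm, hbs, hts, hts.symm] at e1 e2 e3 e4
    have k2 : n₂ = 1 := by have := congrArg List.length e1; simp at this; omega
    have k5 : n₅ = 1 := by have := congrArg List.length e2; simp at this; omega
    have k1 : n₁ = 1 := by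
      rcases n₁ with _ | _ | n
      · omega
      · rfl
      · simp [List.replicate_succ, hat] at e3
    have k3 : n₃ = 1 := by
      rcases n₃ with _ | _ | n
      · omega
      · rfl
      · simp [List.replicate_succ, hbs] at e4
    obtain ⟨i, rfl⟩ := Nat.exists_eq_add_of_le' hn₄
    obtain ⟨j, rfl⟩ := Nat.exists_eq_add_of_le' hn₆
    exact ⟨i, j, by rw [k1, k2, k3, k5]; simp only [pow_one, mul_assoc]⟩
  · rintro ⟨i, j, rfl⟩
    refine ⟨?_, ?_⟩
    · exact tauOne.mul (tauOne.mul (tauOne.mul (tauOne.refl _) (tauOne_letter_pow a i))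
        (tauOne.refl _)) (tauOne_letter_pow b j)
    · have h1 := zetaCon_pow (letter a) (letter t * letter b) i
      have h2 := zetaCon_pow (letter b) (letter a ^ (i + 1) * letter s) j
      have h3 := zetaCon.mul (zetaCon.refl (letter a * letter t)) h2
      have h4 := zetaCon.mul h1 (zetaCon.refl (letter s * letter b))
      simp only [mul_assoc] at h3 h4 ⊢
      exact zetaCon.trans h3 h4

theorem conClass_languageK {a b t : ℕ} (hab : a ≠ b) (hat : a ≠ t) (hbt : b ≠ t) :
    conClass (tauOne ⊓ zetaCon) (letter a * letter t * letter b ^ 2 * letter a) =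
      {letter a} * {letter t} * {letter b} * plus b * plus a := by
  ext w
  rw [mem_languageK_iff]
  constructor
  · rintro ⟨h, hζ⟩
    have h1 := collapse_eq_of_tauOne h
    rw [show collapse (letter a * letter t * letter b ^ 2 * letter a).toList = [a, t, b, a] by
      simp [collapse, pow_two, hab, hbt, hat.symm]] at h1
    obtain ⟨n₁, w, hn₁, rfl, h2⟩ := exists_pow_of_collapse_eq_cons h1
    obtain ⟨n₂, w, hn₂, rfl, h3⟩ := exists_pow_of_collapse_eq_cons h2
    obtain ⟨n₃, w, hn₃, rfl, h4⟩ := exists_pow_of_collapse_eq_cons h3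
    obtain ⟨n₄, w, hn₄, rfl, h5⟩ := exists_pow_of_collapse_eq_cons h4
    rw [eq_one_of_collapse_eq_nil h5, mul_one] at hζ ⊢
    have e1 := take_two_filter_of_zetaCon (fun x => x == t) hζ
    have e2 := take_two_filter_of_zetaCon (fun x => x == b) hζ
    have e3 := take_two_filter_of_zetaCon (fun x => x == a || x == t) hζ
    simp [toList_letter_pow, hab, hab.symm, hat,
      hbt, hbt.symm, pow_two] at e1 e2 e3
    have k2 : n₂ = 1 := by have := congrArg List.length e1; simp at this; omega
    have k3 : 2 ≤ n₃ := by have := congrArg List.length e2; simp at this; omega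
    have k1 : n₁ = 1 := by
      rcases n₁ with _ | _ | n
      · omega
      · rfl
      · simp [List.replicate_succ, hat] at e3
    obtain ⟨i, rfl⟩ := Nat.exists_eq_add_of_le' k3
    obtain ⟨j, rfl⟩ := Nat.exists_eq_add_of_le' hn₄
    exact ⟨i, j, by rw [k1, k2]; simp only [pow_one, mul_assoc]⟩
  · rintro ⟨i, j, rfl⟩
    refine ⟨?_, ?_⟩
    · exact tauOne.mul (tauOne.mul (tauOne.refl _) (tauOne.trans (tauOne_letter_pow b (i + 1))
        (tauOne.symm (tauOne_letter_pow b 1)))) (tauOne_letter_pow a j)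
    -- With an empty middle word, a run of `b` can be shortened to `b²` but not to `b`, whence the
    -- square in the chosen representative.
    · have h1 := zetaCon_pow (letter b) 1 i
      have h2 := zetaCon_pow (letter a) (letter t * letter b ^ (i + 2)) j
      have h3 := zetaCon.mul (zetaCon.mul (zetaCon.refl (letter a * letter t)) h1)
        (zetaCon.refl (letter a))
      simp only [pow_succ' _ (i + 1), pow_two, mul_one, mul_assoc] at h2 h3 ⊢
      exact zetaCon.trans h2 h3

/-! ### Factors of the languages `atba⁺sb⁺` and `atbb⁺a⁺` -/

theorem exists_split_of_two_le_count' {k : ℕ} {l : List ℕ} (h : 2 ≤ l.count k) :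
    ∃ l₁ l₂ l₃, l = l₁ ++ k :: (l₂ ++ k :: l₃) ∧ k ∉ l₁ ∧ k ∉ l₂ := by
  obtain ⟨l₁, m, rfl, h1⟩ :=
    List.eq_append_cons_of_mem (List.count_pos_iff.1 (by omega : 0 < l.count k))
  have h2 : k ∈ m := by
    rw [List.count_append, List.count_cons_self, List.count_eq_zero_of_not_mem h1] at h
    exact List.count_pos_iff.1 (by omega)
  obtain ⟨l₂, l₃, rfl, h3⟩ := List.eq_append_cons_of_mem h2
  exact ⟨l₁, l₂, l₃, rfl, h1, h3⟩

theorem exists_split_of_two_le_count {k : ℕ} {l : List ℕ} (h : 2 ≤ l.count k) :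
    ∃ l₁ l₂ l₃, l = l₁ ++ k :: (l₂ ++ k :: l₃) := by
  obtain ⟨l₁, l₂, l₃, h, -, -⟩ := exists_split_of_two_le_count' h
  exact ⟨l₁, l₂, l₃, h⟩

theorem forall_eq_or_exists_change (l : List ℕ) (x : ℕ) :
    (∀ z ∈ l, z = x) ∨ ∃ l₁ y l₂, x :: l = l₁ ++ x :: y :: l₂ ∧ y ≠ x := by
  induction l with
  | nil => left; simp
  | cons y l ih =>
    by_cases hy : y = x
    · subst hy
      rcases ih with ih | ⟨l₁, z, l₂, h, hz⟩
      · left; simpa using ih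
      · exact Or.inr ⟨y :: l₁, z, l₂, by rw [h]; rfl, hz⟩
    · exact Or.inr ⟨[], y, l, rfl, hy⟩

theorem forall_eq_or_exists_change' (l : List ℕ) (x : ℕ) :
    (∀ z ∈ l, z = x) ∨ ∃ l₁ y l₂, l ++ [x] = l₁ ++ y :: x :: l₂ ∧ y ≠ x := by
  induction l with
  | nil => left; simp
  | cons y l ih =>
    rcases ih with ih | ⟨l₁, z, l₂, h, hz⟩
    · by_cases hy : y = x
      · left; simpa [hy] using ih
      · right
        rw [List.eq_replicate_of_mem ih]
        cases l with
        | nil => exact ⟨[], y, [], rfl, hy⟩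
        | cons w l =>
          exact ⟨[], y, List.replicate l.length x ++ [x], by simp [List.replicate_succ], hy⟩
    · exact Or.inr ⟨y :: l₁, z, l₂, by rw [List.cons_append, h]; rfl, hz⟩

/-- The word is a power of `a` or of `b`. -/
def IsPower (a b : ℕ) (l : List ℕ) : Prop :=
  ∃ x n, (x = a ∨ x = b) ∧ l = List.replicate n x

/-- The words `atbaⁱsbʲ` with `i, j ≥ 1`. -/
def LangJ (a b t s : ℕ) (w : List ℕ) : Prop :=
  ∃ i j, w = a :: t :: b :: (List.replicate (i + 1) a ++ s :: List.replicate (j + 1) b)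

/-- The words `atbⁱaʲ` with `i ≥ 2` and `j ≥ 1`. -/
def LangK (a b t : ℕ) (w : List ℕ) : Prop :=
  ∃ i j, w = a :: t :: (List.replicate (i + 2) b ++ List.replicate (j + 1) a)

theorem mem_languageJ_iff_langJ {a b t s : ℕ} {w : Word} :
    w ∈ ({letter a} * {letter t} * {letter b} * plus a * {letter s} * plus b : Set Word) ↔
      LangJ a b t s w.toList := by
  rw [mem_languageJ_iff]
  refine exists_congr fun i => exists_congr fun j => ?_
  rw [← FreeMonoid.toList.injective.eq_iff]
  simp only [FreeMonoid.toList_mul, toList_letter_pow, FreeMonoid.toList_of, List.append_assoc,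
    List.cons_append, List.nil_append]

theorem mem_languageK_iff_langK {a b t : ℕ} {w : Word} :
    w ∈ ({letter a} * {letter t} * {letter b} * plus b * plus a : Set Word) ↔
      LangK a b t w.toList := by
  rw [mem_languageK_iff]
  refine exists_congr fun i => exists_congr fun j => ?_
  rw [← FreeMonoid.toList.injective.eq_iff]
  simp only [FreeMonoid.toList_mul, toList_letter_pow, FreeMonoid.toList_of,
    List.cons_append, List.nil_append]

theorem isPower_of_no_change {a b : ℕ} {X : List ℕ} (h : ∀ z ∈ X, z = a ∨ z = b)
    (h' : ∀ l₁ x y l₂, X = l₁ ++ x :: y :: l₂ → x = y) : IsPower a b X := by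
  cases X with
  | nil => exact ⟨a, 0, Or.inl rfl, rfl⟩
  | cons x X =>
    refine ⟨x, X.length + 1, h x (by simp), ?_⟩
    rcases forall_eq_or_exists_change X x with hX | ⟨l₁, y, l₂, hX, hy⟩
    · rw [List.replicate_succ, ← List.eq_replicate_of_mem hX]
    · exact absurd (h' _ _ _ _ hX).symm hy

/-! ### Repeated factors of words in `atba⁺sb⁺` -/

section LangJ

variable {a b t s : ℕ}

/-- In `atba⁺sb⁺` the letters `t` and `s` keep `a` and `b` apart everywhere except at the factor
`ba` after `at`. -/
theorem LangJ.change (hd : [a, b, t, s].Nodup) {p q : List ℕ} {x y : ℕ}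
    (h : LangJ a b t s (p ++ x :: y :: q)) (hx : x = a ∨ x = b) (hy : y = a ∨ y = b)
    (hxy : x ≠ y) : x = b ∧ y = a ∧ p = [a, t] := by
  obtain ⟨⟨hab, hat, has⟩, ⟨hbt, hbs⟩, hts⟩ :
      (a ≠ b ∧ a ≠ t ∧ a ≠ s) ∧ (b ≠ t ∧ b ≠ s) ∧ t ≠ s := by simpa using hd
  obtain ⟨i, j, h⟩ := h
  rcases p with _ | ⟨p₁, _ | ⟨p₂, _ | ⟨p₃, p⟩⟩⟩
  · simp at h; omega
  · simp at h; omega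
  · simp [List.replicate_succ] at h
    simp [h]
  · simp only [List.cons_append, List.cons.injEq] at h
    have hc : List.IsChain (fun x y => x = y ∨ x = s ∨ y = s)
        (List.replicate (i + 1) a ++ s :: List.replicate (j + 1) b) := by
      rw [List.isChain_append, List.isChain_cons]
      refine ⟨?_, ⟨?_, ?_⟩, ?_⟩
      · exact List.isChain_replicate_of_rel _ (Or.inl rfl)
      · intro y _; simp
      · exact List.isChain_replicate_of_rel _ (Or.inl rfl)
      · intro x _ y hy; simp at hy; simp [hy]
    rw [← h.2.2.2, List.isChain_append_cons_cons] at hc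
    omega

/-- A repeated factor avoids `t` and `s`, which are linear. It contains no change of letter, because
the only change has a fixed position and cannot lie in both copies. -/
theorem LangJ.isPower (hd : [a, b, t, s].Nodup) {p X q r : List ℕ}
    (h : LangJ a b t s (p ++ X ++ q ++ X ++ r)) : IsPower a b X := by
  obtain ⟨⟨hab, hat, has⟩, ⟨hbt, hbs⟩, hts⟩ :
      (a ≠ b ∧ a ≠ t ∧ a ≠ s) ∧ (b ≠ t ∧ b ≠ s) ∧ t ≠ s := by simpa using hd
  have hX : ∀ z ∈ X, z = a ∨ z = b := by
    intro z hz
    by_contra hzab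
    obtain ⟨i, j, h⟩ := h
    have h1 : z ≠ a := by omega
    have h2 : z ≠ b := by omega
    have := congrArg (List.count z) h
    have hz' := List.count_pos_iff.2 hz
    simp [List.count_cons, List.count_replicate, h1.symm, h2.symm] at this
    split_ifs at this <;> omega
  refine isPower_of_no_change hX ?_
  rintro l₁ x y l₂ rfl
  by_contra hxy
  have hx := hX x (by simp)
  have hy := hX y (by simp)
  have h1 := LangJ.change hd (p := p ++ l₁) (x := x) (y := y)
    (q := l₂ ++ q ++ (l₁ ++ x :: y :: l₂) ++ r) (by simpa using h) hx hy hxy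
  have h2 := LangJ.change hd (p := p ++ (l₁ ++ x :: y :: l₂) ++ q ++ l₁) (x := x) (y := y)
    (q := l₂ ++ r) (by simpa using h) hx hy hxy
  have h3 := congrArg List.length h2.2.2
  have h4 := congrArg List.length h1.2.2
  simp at h3 h4
  omega

/-- The prefix `atb` contains each of `a` and `b` once, so the second and the third `x` lie in
`a⁺sb⁺`, where all `x` form a single run. -/
theorem LangJ.between (hd : [a, b, t, s].Nodup) {p q r u : List ℕ} {x : ℕ} (hx : x = a ∨ x = b)
    (h : LangJ a b t s (p ++ x :: (q ++ x :: (r ++ x :: u)))) : ∀ z ∈ r, z = x := by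
  obtain ⟨⟨hab, hat, has⟩, ⟨hbt, hbs⟩, hts⟩ :
      (a ≠ b ∧ a ≠ t ∧ a ≠ s) ∧ (b ≠ t ∧ b ≠ s) ∧ t ≠ s := by simpa using hd
  obtain ⟨i, j, h⟩ := h
  have hp : List.Pairwise (fun y z => (y = b → z = b) ∧ (z = a → y = a))
      (List.replicate (i + 1) a ++ s :: List.replicate (j + 1) b) := by
    simp [List.pairwise_append, List.pairwise_replicate, hab.symm, hbs.symm, has.symm]
    omega
  have key : ∀ q' : List ℕ, List.replicate (i + 1) a ++ s :: List.replicate (j + 1) b =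
      q' ++ x :: (r ++ x :: u) → ∀ z ∈ r, z = x := by
    intro q' hq' z hz
    rw [hq'] at hp
    simp only [List.pairwise_append, List.pairwise_cons, List.mem_append, List.mem_cons] at hp
    have h1 := hp.2.1.1 z (Or.inl hz)
    have h2 := hp.2.1.2.2.2 z hz x (Or.inl rfl)
    rcases hx with rfl | rfl
    · exact h2.2 rfl
    · exact h1.1 rfl
  rcases p with _ | ⟨p₁, _ | ⟨p₂, _ | ⟨p₃, p⟩⟩⟩
  · rcases q with _ | ⟨q₁, _ | ⟨q₂, q⟩⟩
    · simp at h; omega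
    · simp at h; omega
    · simp only [List.nil_append, List.cons_append, List.cons.injEq] at h
      exact key _ h.2.2.2.symm
  · simp at h; omega
  · simp only [List.nil_append, List.cons_append, List.cons.injEq] at h
    exact key _ h.2.2.2.symm
  · simp only [List.cons_append, List.cons.injEq] at h
    exact key (p ++ x :: q) (by rw [← h.2.2.2]; simp)

/-- If the blocks were powers of different letters, their border would be the factor `ba` after
`at`. The earlier copy of `X` would put a `b` into `at`. -/
theorem LangJ.comm (hd : [a, b, t, s].Nodup) {p₁ p₂ X Y q : List ℕ} (hX : IsPower a b X)
    (hY : IsPower a b Y) (h : LangJ a b t s (p₁ ++ X ++ p₂ ++ X ++ Y ++ q)) :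
    X ++ Y = Y ++ X := by
  obtain ⟨x, _ | m, hx, rfl⟩ := hX
  · simp
  obtain ⟨y, _ | n, hy, rfl⟩ := hY
  · simp
  by_cases hxy : x = y
  · rw [hxy, List.replicate_append_replicate, List.replicate_append_replicate, add_comm]
  have h1 := LangJ.change hd
    (p := p₁ ++ List.replicate (m + 1) x ++ p₂ ++ List.replicate m x)
    (x := x) (y := y) (q := List.replicate n y ++ q)
    (by rw [List.replicate_succ' (n := m), List.replicate_succ (n := n)] at h; simpa [List.replicate_succ'] using h) hx hy hxy
  have h2 : x ∈ [a, t] := by rw [← h1.2.2]; simp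
  have hxa : x ≠ a := fun e => hxy (e.trans h1.2.1.symm)
  obtain rfl : x = t := by simpa [hxa] using h2
  have := h1.1
  simp at hd
  omega

end LangJ

/-! ### Repeated factors of words in `atbb⁺a⁺` -/

section LangK

variable {a b t : ℕ}

theorem LangK.change (hab : a ≠ b) (hat : a ≠ t) (hbt : b ≠ t) {p q : List ℕ} {x y : ℕ}
    (h : LangK a b t (p ++ x :: y :: q)) (hx : x = a ∨ x = b) (hy : y = a ∨ y = b)
    (hxy : x ≠ y) : x = b ∧ y = a ∧ b ∉ q ∧ ∃ n, p = a :: t :: List.replicate n b := by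
  obtain ⟨i, j, h⟩ := h
  have key : ∀ (m n : ℕ) (p' : List ℕ), List.replicate m b ++ List.replicate n a =
      p' ++ x :: y :: q → x = b ∧ y = a ∧ b ∉ q ∧ ∃ n, p' = List.replicate n b := by
    intro m n
    induction m with
    | zero =>
      intro p' h
      have : ∀ z ∈ p' ++ x :: y :: q, z = a := by
        rw [← h]; simp
      have h1 := this x (by simp)
      have h2 := this y (by simp)
      omega
    | succ m ih =>
      intro p' h
      rw [List.replicate_succ, List.cons_append] at h
      rcases p' with _ | ⟨c, p'⟩
      · rw [List.nil_append, List.cons.injEq] at h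
        obtain ⟨hb, h⟩ := h
        rcases m with _ | m
        · rcases n with _ | n
          · simp at h
          · simp only [List.replicate_zero, List.nil_append, List.replicate_succ,
              List.cons.injEq] at h
            refine ⟨hb.symm, h.1.symm, ?_, 0, rfl⟩
            rw [← h.2]
            simp [hab.symm]
        · simp only [List.replicate_succ, List.cons_append, List.cons.injEq] at h
          exact absurd (hb.symm.trans h.1) hxy
      · simp only [List.cons_append, List.cons.injEq] at h
        obtain ⟨h1, h2, h3, k, rfl⟩ := ih _ h.2
        exact ⟨h1, h2, h3, k + 1, by rw [← h.1]; rfl⟩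
  rcases p with _ | ⟨p₁, _ | ⟨p₂, p⟩⟩
  · simp at h; omega
  · simp at h; omega
  · simp only [List.cons_append, List.cons.injEq] at h
    obtain ⟨h1, h2, h3, k, rfl⟩ := key _ _ _ h.2.2.symm
    exact ⟨h1, h2, h3, k, by rw [h.1, h.2.1]⟩

/-- The only change of letter is `ba`, and no `b` follows it; a second copy of a factor containing
the change would bring one. -/
theorem LangK.isPower (hab : a ≠ b) (hat : a ≠ t) (hbt : b ≠ t) {p X q r : List ℕ}
    (h : LangK a b t (p ++ X ++ q ++ X ++ r)) : IsPower a b X := by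
  have hX : ∀ z ∈ X, z = a ∨ z = b := by
    intro z hz
    by_contra hzab
    obtain ⟨i, j, h⟩ := h
    have h1 : z ≠ a := by omega
    have h2 : z ≠ b := by omega
    have := congrArg (List.count z) h
    have hz' := List.count_pos_iff.2 hz
    simp [List.count_cons, List.count_replicate, h1.symm, h2.symm] at this
    split_ifs at this <;> omega
  refine isPower_of_no_change hX ?_
  rintro l₁ x y l₂ rfl
  by_contra hxy
  have hx := hX x (by simp)
  have hy := hX y (by simp)
  obtain ⟨h1, h2, h3, -⟩ := LangK.change hab hat hbt (p := p ++ l₁) (x := x) (y := y)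
    (q := l₂ ++ q ++ (l₁ ++ x :: y :: l₂) ++ r) (by simpa using h) hx hy hxy
  exact h3 (by simp [h1])

theorem LangK.between (hab : a ≠ b) (hat : a ≠ t) (hbt : b ≠ t) {p q r u : List ℕ} {x : ℕ}
    (hx : x = a ∨ x = b)
    (h : LangK a b t (p ++ x :: (q ++ x :: (r ++ x :: u)))) : ∀ z ∈ r, z = x := by
  obtain ⟨i, j, h⟩ := h
  have hp : List.Pairwise (fun y z => (y = a → z = a) ∧ (z = b → y = b))
      (List.replicate (i + 2) b ++ List.replicate (j + 1) a) := by
    simp [List.pairwise_append, List.pairwise_replicate, hab, hab.symm]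
  have key : ∀ q' : List ℕ, List.replicate (i + 2) b ++ List.replicate (j + 1) a =
      q' ++ x :: (r ++ x :: u) → ∀ z ∈ r, z = x := by
    intro q' hq' z hz
    rw [hq'] at hp
    simp only [List.pairwise_append, List.pairwise_cons, List.mem_append, List.mem_cons] at hp
    have h1 := hp.2.1.1 z (Or.inl hz)
    have h2 := hp.2.1.2.2.2 z hz x (Or.inl rfl)
    rcases hx with rfl | rfl
    · exact h1.1 rfl
    · exact h2.2 rfl
  rcases p with _ | ⟨p₁, _ | ⟨p₂, p⟩⟩
  · rcases q with _ | ⟨q₁, q⟩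
    · simp at h; omega
    · simp only [List.nil_append, List.cons_append, List.cons.injEq] at h
      exact key _ h.2.2.symm
  · simp at h; omega
  · simp only [List.cons_append, List.cons.injEq] at h
    exact key (p ++ x :: q) (by rw [← h.2.2]; simp)

/-- If the blocks do not commute, `X` is a power of `b`, `Y` is a power of `a`, only letters `b`
stand between `at` and the border, and no `b` follows it. This excludes a later `X`. It excludes an
earlier `X` before a `Y`, since the only earlier `a` is the first letter. It also excludes an
earlier `Y` before an `X` without the letter `t` between them. -/
theorem LangK.comm (hab : a ≠ b) (hat : a ≠ t) (hbt : b ≠ t) {p X Y q : List ℕ}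
    (hX : IsPower a b X) (hY : IsPower a b Y) (h : LangK a b t (p ++ X ++ Y ++ q))
    (hpq : (∃ q₁ q₂, q = q₁ ++ X ++ q₂) ∨ (∃ p₁ p₂ p₃, p = p₁ ++ X ++ p₂ ++ Y ++ p₃) ∨
      ∃ p₁ p₂ p₃, (∀ z ∈ p₂, z = a ∨ z = b) ∧ p = p₁ ++ Y ++ p₂ ++ X ++ p₃) :
    X ++ Y = Y ++ X := by
  obtain ⟨x, _ | m, hx, rfl⟩ := hX
  · simp
  obtain ⟨y, _ | n, hy, rfl⟩ := hY
  · simp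
  by_cases hxy : x = y
  · rw [hxy, List.replicate_append_replicate, List.replicate_append_replicate, add_comm]
  obtain ⟨rfl, rfl, hbq, k, hk⟩ := LangK.change hab hat hbt
    (p := p ++ List.replicate m x) (x := x) (y := y) (q := List.replicate n y ++ q)
    (by rw [List.replicate_succ' (n := m), List.replicate_succ (n := n)] at h; simpa using h)
    hx hy hxy
  rcases hpq with ⟨q₁, q₂, rfl⟩ | ⟨p₁, p₂, p₃, rfl⟩ | ⟨p₁, p₂, p₃, hp₂, rfl⟩
  · simp at hbq
  · have hc := congrArg (List.drop 2) hk
    have hy' : y ∈ List.drop 2 (p₁ ++ List.replicate (m + 1) x ++ p₂ ++ List.replicate (n + 1) y ++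
        p₃ ++ List.replicate m x) := by
      rcases p₁ with _ | ⟨c, _ | ⟨d, p₁⟩⟩
      · obtain ⟨h1, -⟩ := List.cons.inj hk
        exact absurd h1 hxy
      · obtain ⟨-, h1⟩ := List.cons.inj hk
        obtain ⟨h1, -⟩ := List.cons.inj h1
        exact absurd h1 hbt
      · simp
    rw [hc] at hy'
    simp [hab] at hy'
  · rcases p₁ with _ | ⟨c, p₁⟩
    · have h1 : t ∈ List.replicate n y ++ p₂ ++ [x] := by
        rw [List.replicate_succ (n := m), List.replicate_succ (n := n)] at hk
        simp only [List.nil_append, List.cons_append, List.append_assoc, List.cons.injEq,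
          true_and] at hk
        rcases n with _ | n
        · rcases p₂ with _ | ⟨d, p₂⟩
          · simp at hk
            simp [hk.1]
          · simp at hk
            simp [hk.1]
        · simp [List.replicate_succ] at hk
          simp [hk.1]
      simp only [List.mem_append, List.mem_replicate, List.mem_singleton] at h1
      rcases h1 with (h1 | h1) | h1
      · exact absurd h1.2.symm hat
      · have := hp₂ _ h1; omega
      · exact absurd h1.symm hbt
    · have h1 : y ∈ p₁ ++ List.replicate (n + 1) y ++ p₂ ++ List.replicate (m + 1) x ++
          p₃ ++ List.replicate m x := by simp
      simp only [List.cons_append, List.cons.injEq] at hk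
      rw [hk.2] at h1
      simp [hab, hat] at h1

end LangK

/-! ### The monoids `M_τ(W)` satisfy the identities of `J` and `K` -/

theorem IsPower.eq_pow {a b : ℕ} {X : Word} (h : IsPower a b X.toList) :
    ∃ x n, (x = a ∨ x = b) ∧ X = letter x ^ n := by
  obtain ⟨x, n, hx, h⟩ := h
  exact ⟨x, n, hx, FreeMonoid.toList.injective (by rw [h, toList_letter_pow])⟩

theorem eq_letter_pow {x : ℕ} {Z : Word} (h : ∀ z ∈ Z.toList, z = x) :
    Z = letter x ^ Z.toList.length :=
  FreeMonoid.toList.injective (by rw [toList_letter_pow, ← List.eq_replicate_of_mem h])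

theorem tauOne_pow_sq (x n : ℕ) : tauOne (letter x ^ n) ((letter x ^ n) ^ 2) := by
  rcases Nat.eq_zero_or_pos n with rfl | hn
  · simpa using tauOne.refl _
  · rw [← pow_mul]
    exact tauOne.trans (tauOne_letter_pow_of_pos x hn)
      (tauOne.symm (tauOne_letter_pow_of_pos x (by omega)))

/-- Here and in `sound_xyxztx` the two values need not be equal as words. The `ζ` part always holds,
because `ζ` permits inserting `X` anywhere after its second occurrence; the `τ₁` part needs `X` to
be a power of a letter. -/
theorem sound_xyx {a b : ℕ} {L : List ℕ → Prop}
    (hpow : ∀ {p X q r : List ℕ}, L (p ++ X ++ q ++ X ++ r) → IsPower a b X) {X Y p s : Word}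
    (h : L (p * (X * Y * X) * s).toList ∨ L (p * (X * Y * X ^ 2) * s).toList) :
    (tauOne ⊓ zetaCon) (X * Y * X) (X * Y * X ^ 2) := by
  have hX : IsPower a b X.toList := by
    rcases h with h | h
    · exact hpow (p := p.toList) (q := Y.toList) (r := s.toList) (by simpa using h)
    · exact hpow (p := p.toList) (q := Y.toList) (r := X.toList ++ s.toList)
        (by simpa [pow_two] using h)
  obtain ⟨x, n, -, rfl⟩ := hX.eq_pow
  refine ⟨tauOne.mul (tauOne.refl _) (tauOne_pow_sq x n), ?_⟩
  simpa [pow_two, mul_assoc] using zetaCon_insert (letter x ^ n) Y 1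

theorem sound_xyxztx {a b : ℕ} {L : List ℕ → Prop}
    (hpow : ∀ {p X q r : List ℕ}, L (p ++ X ++ q ++ X ++ r) → IsPower a b X)
    (hbetween : ∀ {p q r u : List ℕ} {x : ℕ}, x = a ∨ x = b →
      L (p ++ x :: (q ++ x :: (r ++ x :: u))) → ∀ z ∈ r, z = x) {X Y Z T p s : Word}
    (h : L (p * (X * Y * X * Z * T * X) * s).toList ∨
      L (p * (X * Y * X * Z * X * T * X) * s).toList) :
    (tauOne ⊓ zetaCon) (X * Y * X * Z * T * X) (X * Y * X * Z * X * T * X) := by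
  refine ⟨?_, ?_⟩
  · have hX : IsPower a b X.toList := by
      rcases h with h | h
      · exact hpow (p := p.toList) (q := Y.toList) (r := (Z * T * X * s).toList)
          (by simpa using h)
      · exact hpow (p := p.toList) (q := Y.toList) (r := (Z * X * T * X * s).toList)
          (by simpa using h)
    obtain ⟨x, _ | n, hx, rfl⟩ := hX.eq_pow
    · simp
    have hZT : ∀ z, z ∈ Z.toList ∨ z ∈ T.toList → z = x := by
      have hx' : (letter x ^ (n + 1)).toList = x :: List.replicate n x := by
        rw [toList_letter_pow, List.replicate_succ]
      intro z hz
      rcases h with h | h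
      · refine hbetween hx (p := p.toList) (q := List.replicate n x ++ Y.toList)
          (r := List.replicate n x ++ Z.toList ++ T.toList) (u := List.replicate n x ++ s.toList)
          ?_ z (by simp; tauto)
        simp only [FreeMonoid.toList_mul, hx'] at h
        simpa using h
      · refine hbetween hx (p := p.toList) (q := List.replicate n x ++ Y.toList)
          (r := List.replicate n x ++ Z.toList ++ x :: List.replicate n x ++ T.toList)
          (u := List.replicate n x ++ s.toList) ?_ z (by simp; tauto)
        simp only [FreeMonoid.toList_mul, hx'] at h
        simpa using h
    rw [eq_letter_pow fun z hz => hZT z (Or.inl hz), eq_letter_pow fun z hz => hZT z (Or.inr hz)]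
    simp only [mul_assoc, ← pow_add]
    refine tauOne.mul (tauOne.refl _) (tauOne.mul (tauOne.refl _) ?_)
    exact tauOne.trans (tauOne_letter_pow_of_pos x (by omega))
      (tauOne.symm (tauOne_letter_pow_of_pos x (by omega)))
  · have h1 := zetaCon.mul (zetaCon_insert X Y (Z * T)) (zetaCon.refl 1)
    have h2 := zetaCon.mul (zetaCon_insert X Y Z) (zetaCon.refl (T * X))
    have h3 := zetaCon_insert X Y (Z * X * T)
    have h4 := zetaCon.mul (zetaCon_insert X Y Z) (zetaCon.refl T)
    simp only [mul_assoc, mul_one] at h1 h2 h3 h4 ⊢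
    exact h2

theorem mem_of_mem_list_prod {k : ℕ} {l : List Word} :
    k ∈ l.prod.toList ↔ ∃ w ∈ l, k ∈ w.toList := by
  induction l with
  | nil => simp
  | cons w l ih => simp

theorem toList_map_eq_flatMap (φ : Word →* Word) (w : Word) :
    (φ w).toList = w.toList.flatMap fun k => (φ (letter k)).toList := by
  induction w using FreeMonoid.inductionOn' with
  | one => simp
  | of_mul x w ih => rw [map_mul, FreeMonoid.toList_mul, ih, FreeMonoid.toList_of_mul]; rfl

/-- Two occurrences of a letter produce two disjoint copies of its value in a word of the language.
-/
theorem isPower_of_two_le_count {a b : ℕ} {L : List ℕ → Prop}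
    (hpow : ∀ {p X q r : List ℕ}, L (p ++ X ++ q ++ X ++ r) → IsPower a b X)
    {φ : Word →* Word} {w p s : Word} {k : ℕ} (hk : 2 ≤ w.toList.count k)
    (h : L (p * φ w * s).toList) : IsPower a b (φ (letter k)).toList := by
  obtain ⟨l₁, l₂, l₃, hl⟩ := exists_split_of_two_le_count hk
  rw [FreeMonoid.toList_mul, FreeMonoid.toList_mul, toList_map_eq_flatMap, hl] at h
  refine hpow (p := p.toList ++ l₁.flatMap fun k => (φ (letter k)).toList)
    (q := l₂.flatMap fun k => (φ (letter k)).toList)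
    (r := (l₃.flatMap fun k => (φ (letter k)).toList) ++ s.toList) ?_
  simpa using h

theorem mem_or_of_isPower_letters {a b : ℕ} {φ : Word →* Word} {w : Word}
    (h : ∀ k ∈ w.toList, IsPower a b (φ (letter k)).toList) :
    ∀ z ∈ (φ w).toList, z = a ∨ z = b := by
  intro z hz
  rw [toList_map_eq_flatMap, List.mem_flatMap] at hz
  obtain ⟨k, hk, hz⟩ := hz
  obtain ⟨x, n, hx, h⟩ := h k hk
  rw [h] at hz
  rwa [List.eq_of_mem_replicate hz]

/-- Unless `M` is a power of the letter `x` of `X`, the factor `XMX` contains a change from `x` and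
a change to `x`. Both must be the change `ba`, so `x` would equal `b` and `a`. In `XXM` the change
from `x` gives `x = b`, but `at` precedes this change and would have to contain another `x`. -/
theorem LangJ.comm_middle {a b t s : ℕ} (hd : [a, b, t, s].Nodup) {p X M q : List ℕ}
    (hX : IsPower a b X) (hM : ∀ z ∈ M, z = a ∨ z = b)
    (h : LangJ a b t s (p ++ X ++ M ++ X ++ q) ∨ LangJ a b t s (p ++ X ++ X ++ M ++ q)) :
    X ++ M = M ++ X := by
  obtain ⟨x, _ | n, hx, rfl⟩ := hX
  · simp
  have hM' : (∀ z ∈ M, z = x) → List.replicate (n + 1) x ++ M = M ++ List.replicate (n + 1) x := by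
    intro hM'
    rw [List.eq_replicate_of_mem hM', List.replicate_append_replicate,
      List.replicate_append_replicate, add_comm]
  rcases forall_eq_or_exists_change M x with h1 | ⟨l₁, y, l₂, h1, hy⟩
  · exact hM' h1
  have hyM : y = a ∨ y = b := by
    have : y ∈ x :: M := by rw [h1]; simp
    rcases List.mem_cons.1 this with rfl | h2
    · exact absurd rfl hy
    · exact hM y h2
  rcases h with h | h
  · rcases forall_eq_or_exists_change' M x with h2 | ⟨l₃, y', l₄, h2, hy'⟩
    · exact hM' h2
    have hyM' : y' = a ∨ y' = b := by
      have : y' ∈ M ++ [x] := by rw [h2]; simp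
      rcases List.mem_append.1 this with h2 | h2
      · exact hM y' h2
      · exact absurd (List.mem_singleton.1 h2) hy'
    have e1 := LangJ.change hd (p := p ++ List.replicate n x ++ l₁) (x := x) (y := y)
      (q := l₂ ++ List.replicate (n + 1) x ++ q) (by
        rw [show p ++ List.replicate n x ++ l₁ ++ x :: y :: (l₂ ++ List.replicate (n + 1) x ++ q) =
          p ++ List.replicate n x ++ (l₁ ++ x :: y :: l₂) ++ List.replicate (n + 1) x ++ q by simp,
          ← h1]
        rw [List.replicate_succ' (n := n)] at h
        simpa [List.replicate_succ'] using h) hx hyM hy.symm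
    have e2 := LangJ.change hd (p := p ++ List.replicate (n + 1) x ++ l₃) (x := y') (y := x)
      (q := l₄ ++ List.replicate n x ++ q) (by
        rw [show p ++ List.replicate (n + 1) x ++ l₃ ++ y' :: x :: (l₄ ++ List.replicate n x ++ q) =
          p ++ List.replicate (n + 1) x ++ (l₃ ++ y' :: x :: l₄) ++ List.replicate n x ++ q by simp,
          ← h2]
        rw [List.replicate_succ (n := n)] at h ⊢
        simpa using h) hyM' hx hy'
    have := e1.1.symm.trans e2.2.1
    simp [this] at hd
  · have e1 := LangJ.change hd (p := p ++ List.replicate (n + 1) x ++ List.replicate n x ++ l₁)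
      (x := x) (y := y) (q := l₂ ++ q) (by
        rw [show p ++ List.replicate (n + 1) x ++ List.replicate n x ++ l₁ ++ x :: y :: (l₂ ++ q) =
          p ++ List.replicate (n + 1) x ++ List.replicate n x ++ (l₁ ++ x :: y :: l₂) ++ q by simp,
          ← h1]
        rw [List.replicate_succ' (n := n)] at h ⊢
        simpa [List.replicate_succ'] using h) hx hyM hy.symm
    have h2 : x ∈ [a, t] := by rw [← e1.2.2]; simp
    simp at hd h2
    omega

theorem toList_injective_of_append {X Y : Word} (h : X.toList ++ Y.toList = Y.toList ++ X.toList) :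
    X * Y = Y * X := FreeMonoid.toList.injective (by simpa using h)

theorem identitiesJ_sound {a b t s : ℕ} (hd : [a, b, t, s].Nodup) {e : Word × Word}
    (he : e ∈ identitiesJ) :
    Satisfies (MTau (tauOne ⊓ zetaCon) (conClass (tauOne ⊓ zetaCon)
      (letter a * letter t * letter b * letter a * letter s * letter b))) e := by
  apply satisfies_MTau_of
  rw [conClass_languageJ hd]
  intro φ p r h
  rw [mem_languageJ_iff_langJ, mem_languageJ_iff_langJ] at h
  have hpow {k : ℕ} {w : Word} (hk : 2 ≤ w.toList.count k)
      (h : LangJ a b t s (p * φ w * r).toList) :=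
    isPower_of_two_le_count (LangJ.isPower hd) hk h
  have hcomm {P X Q Y R : Word} (hX : IsPower a b X.toList) (hY : IsPower a b Y.toList)
      (h : LangJ a b t s (P * X * Q * X * Y * R).toList) : X * Y = Y * X :=
    toList_injective_of_append (LangJ.comm hd (p₁ := P.toList) (p₂ := Q.toList) (q := R.toList)
      hX hY (by simpa using h))
  have hof : φ e.1 = φ e.2 → (tauOne ⊓ zetaCon) (φ e.1) (φ e.2) := by
    intro h; rw [h]; exact (tauOne ⊓ zetaCon).refl _
  rcases he with (rfl | rfl | rfl | rfl | rfl) | ⟨n, π, ρ, rfl⟩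
  · simp only [map_mul, map_pow] at h ⊢
    exact sound_xyx (LangJ.isPower hd) h
  · simp only [map_mul] at h ⊢
    exact sound_xyxztx (LangJ.isPower hd) (LangJ.between hd) h
  · apply hof
    have hX : IsPower a b (φ (letter 0)).toList := h.elim (hpow (by decide)) (hpow (by decide))
    have hY : IsPower a b (φ (letter 1)).toList := h.elim (hpow (by decide)) (hpow (by decide))
    have := h.elim
      (fun h => hcomm (P := p) (Q := φ (letter 2)) (R := φ (letter 0 * letter 3 * letter 1) * r)
        hX hY (by simpa using h))
      (fun h => hcomm (P := p) (Q := φ (letter 2 * letter 0)) (R := φ (letter 3 * letter 1) * r)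
        hX hY (by simpa [pow_two] using h))
    simp only [map_mul, pow_two, mul_assoc]
    rw [← mul_assoc _ (φ (letter 0)) (φ (letter 3) * _), ← this, mul_assoc]
  · apply hof
    have hX : IsPower a b (φ (letter 0)).toList := h.elim (hpow (by decide)) (hpow (by decide))
    have hY : IsPower a b (φ (letter 1)).toList := h.elim (hpow (by decide)) (hpow (by decide))
    have := h.elim
      (fun h => hcomm (P := p) (Q := φ (letter 1 * letter 2)) (R := r) hX hY (by simpa using h))
      (fun h => hcomm (P := p * φ (letter 1)) (Q := φ (letter 2)) (R := r) hX hY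
        (by simpa using h))
    simp only [map_mul, this]
  · apply hof
    have hX : IsPower a b (φ (letter 0)).toList := h.elim (hpow (by decide)) (hpow (by decide))
    have hY : IsPower a b (φ (letter 1)).toList := h.elim (hpow (by decide)) (hpow (by decide))
    have := h.elim
      (fun h => hcomm (P := p) (Q := φ (letter 2 * letter 1 * letter 3)) (R := r) hX hY
        (by simpa using h))
      (fun h => (hcomm (P := p * φ (letter 0 * letter 2)) (Q := φ (letter 3)) (R := r) hY hX
        (by simpa using h)).symm)
    simp only [map_mul, mul_assoc, this]
  · apply hof
    simp only [jLeft, jRight] at h ⊢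
    set A : Word := (List.ofFn fun i : Fin n => letter (2 * i + 1) * letter (2 * i + 2)).prod
    set M : Word := (List.ofFn fun i : Fin n => letter (2 * (π i) + 1) *
      letter (2 * (n + ρ i) + 1)).prod with hM
    set B : Word := (List.ofFn fun i : Fin n => letter (2 * (n + i) + 2) *
      letter (2 * (n + i) + 1)).prod with hB
    -- Every letter of the middle block has a second occurrence outside it, so its value is a power
    -- of `a` or of `b`.
    have hmem : ∀ k ∈ M.toList, k ∈ A.toList ∨ k ∈ B.toList := by
      intro k hk
      simp only [hM, mem_of_mem_list_prod, List.mem_ofFn] at hk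
      obtain ⟨_, ⟨i, rfl⟩, hk⟩ := hk
      simp only [FreeMonoid.toList_mul, FreeMonoid.toList_of, List.cons_append, List.nil_append,
        List.mem_cons, List.not_mem_nil, or_false] at hk
      rcases hk with rfl | rfl
      · left
        rw [mem_of_mem_list_prod]
        exact ⟨_, List.mem_ofFn.2 ⟨π i, rfl⟩, by simp⟩
      · right
        rw [mem_of_mem_list_prod]
        exact ⟨_, List.mem_ofFn.2 ⟨ρ i, rfl⟩, by simp⟩
    have hM2 : ∀ z ∈ (φ M).toList, z = a ∨ z = b := by
      apply mem_or_of_isPower_letters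
      intro k hk
      have h1 := List.count_pos_iff.2 hk
      have h2 : 0 < A.toList.count k ∨ 0 < B.toList.count k := by
        simpa only [List.count_pos_iff] using hmem k hk
      refine h.elim (hpow ?_) (hpow ?_) <;>
        · simp only [FreeMonoid.toList_mul, List.count_append]
          omega
    have hX : IsPower a b (φ (letter 0)).toList :=
      h.elim (hpow (by simp; omega))
        (hpow (by simp [pow_two]; omega))
    have := toList_injective_of_append (LangJ.comm_middle hd (p := (p * φ A).toList)
      (q := (φ B * r).toList) hX hM2 (h.imp (fun h => by simpa using h)
        (fun h => by simpa [pow_two] using h)))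
    simp only [map_mul, pow_two, mul_assoc]
    rw [← mul_assoc (φ M), ← this, mul_assoc]

theorem identitiesK_sound {a b t : ℕ} (hab : a ≠ b) (hat : a ≠ t) (hbt : b ≠ t)
    {e : Word × Word} (he : e ∈ identitiesK) :
    Satisfies (MTau (tauOne ⊓ zetaCon) (conClass (tauOne ⊓ zetaCon)
      (letter a * letter t * letter b ^ 2 * letter a))) e := by
  apply satisfies_MTau_of
  rw [conClass_languageK hab hat hbt]
  intro φ P' R' h
  rw [mem_languageK_iff_langK, mem_languageK_iff_langK] at h
  have hpow {k : ℕ} {w : Word} (hk : 2 ≤ w.toList.count k)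
      (h : LangK a b t (P' * φ w * R').toList) : IsPower a b (φ (letter k)).toList :=
    isPower_of_two_le_count (LangK.isPower hab hat hbt) hk h
  have hcomm {P X Y Q : Word} (hX : IsPower a b X.toList) (hY : IsPower a b Y.toList)
      (h : LangK a b t (P * X * Y * Q).toList) (hPQ : (∃ q₁ q₂, Q = q₁ * X * q₂) ∨
        (∃ p₁ p₂ p₃, P = p₁ * X * p₂ * Y * p₃) ∨
        ∃ p₁ p₂ p₃, (∀ z ∈ p₂.toList, z = a ∨ z = b) ∧ P = p₁ * Y * p₂ * X * p₃) :
      X * Y = Y * X := by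
    refine toList_injective_of_append (LangK.comm hab hat hbt (p := P.toList) (q := Q.toList)
      hX hY (by simpa using h) ?_)
    rcases hPQ with ⟨q₁, q₂, rfl⟩ | ⟨p₁, p₂, p₃, rfl⟩ | ⟨p₁, p₂, p₃, hp₂, rfl⟩
    · exact Or.inl ⟨q₁.toList, q₂.toList, by simp⟩
    · exact Or.inr (Or.inl ⟨p₁.toList, p₂.toList, p₃.toList, by simp⟩)
    · exact Or.inr (Or.inr ⟨p₁.toList, p₂.toList, p₃.toList, hp₂, by simp⟩)
  have hof : φ e.1 = φ e.2 → (tauOne ⊓ zetaCon) (φ e.1) (φ e.2) := by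
    intro h; rw [h]; exact (tauOne ⊓ zetaCon).refl _
  rcases he with (rfl | rfl | rfl | rfl) | ⟨p, q, r, s, i, j, hq, rfl⟩
  · simp only [map_mul, map_pow] at h ⊢
    exact sound_xyx (LangK.isPower hab hat hbt) h
  · simp only [map_mul] at h ⊢
    exact sound_xyxztx (LangK.isPower hab hat hbt) (LangK.between hab hat hbt) h
  · apply hof
    have hX : IsPower a b (φ (letter 0)).toList := h.elim (hpow (by decide)) (hpow (by decide))
    have hY : IsPower a b (φ (letter 1)).toList := h.elim (hpow (by decide)) (hpow (by decide))
    have := h.elim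
      (fun h => hcomm (P := P') (Q := φ (letter 2) * φ (letter 0) * (φ (letter 3 * letter 1) * R'))
        hX hY (by simpa using h) (Or.inl ⟨_, _, rfl⟩))
      (fun h => (hcomm (P := P')
        (Q := φ (letter 2 * letter 0 * letter 3) * φ (letter 1) * R') hY hX
        (by simpa using h) (Or.inl ⟨_, _, rfl⟩)).symm)
    simp only [map_mul, this]
  · apply hof
    have hX : IsPower a b (φ (letter 0)).toList := h.elim (hpow (by decide)) (hpow (by decide))
    have hY : IsPower a b (φ (letter 1)).toList := h.elim (hpow (by decide)) (hpow (by decide))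
    have := h.elim
      (fun h => hcomm (P := P' * φ (letter 0 * letter 2 * letter 1 * letter 3))
        (Q := 1 * φ (letter 1) * R')
        hY hX (by simpa using h) (Or.inl ⟨_, _, rfl⟩))
      (fun h => (hcomm (P := P' * φ (letter 0) * φ (letter 2) * φ (letter 1) * φ (letter 3))
        (Q := φ (letter 1) * R') hX hY
        (by simpa [pow_two] using h) (Or.inr (Or.inl ⟨_, _, _, rfl⟩))).symm)
    simp only [map_mul, pow_two, mul_assoc]
    rw [← mul_assoc (φ (letter 1)) (φ (letter 0)), this, mul_assoc]
  · apply hof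
    -- This is where the condition on `q` enters: as its letters occur at least twice, their values
    -- do not contain `t`.
    have hlin : ∀ z ∈ (φ q).toList, z = a ∨ z = b := by
      apply mem_or_of_isPower_letters
      intro k hk
      refine h.elim (hpow (hq k hk)) (hpow ?_)
      have := hq k hk
      simp only [FreeMonoid.toList_mul, List.count_append] at this ⊢
      omega
    have hX : IsPower a b (φ (letter i)).toList := by
      refine h.elim (hpow ?_) (hpow ?_) <;>
        · simp [List.count_cons]; omega
    have hY : IsPower a b (φ (letter j)).toList := by
      refine h.elim (hpow ?_) (hpow ?_) <;>
        · simp [List.count_cons]; omega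
    have := h.elim
      (fun h => hcomm (P := P' * φ p * φ (letter i) * φ q * φ (letter j) * φ r) (Q := φ s * R')
        hX hY (by simpa using h) (Or.inr (Or.inl ⟨_, _, _, rfl⟩)))
      (fun h => (hcomm (P := P' * φ p * φ (letter i) * φ q * φ (letter j) * φ r) (Q := φ s * R')
        hY hX (by simpa using h) (Or.inr (Or.inr ⟨_, _, _, hlin, rfl⟩))).symm)
    simp only [map_mul, mul_assoc]
    rw [← mul_assoc (φ (letter i)) (φ (letter j)) (φ s), this, mul_assoc]

/-! ### Derivations and indistinguishability of lists of letters -/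

/-- The identity between the two words is derivable from `S`. -/
def Deriv (S : Set (Word × Word)) (u v : List ℕ) : Prop :=
  derivCon S (FreeMonoid.ofList u) (FreeMonoid.ofList v)

/-- No substitution and no context separates the two words with respect to the language `L`. -/
def Indist (L : List ℕ → Prop) (u v : List ℕ) : Prop :=
  ∀ (g : ℕ → List ℕ) (p q : List ℕ), L (p ++ u.flatMap g ++ q) ↔ L (p ++ v.flatMap g ++ q)

theorem Indist.symm {L : List ℕ → Prop} {u v : List ℕ} (h : Indist L u v) : Indist L v u :=
  fun g p q => (h g p q).symm

theorem Indist.trans {L : List ℕ → Prop} {u v w : List ℕ} (h : Indist L u v)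
    (h' : Indist L v w) : Indist L u w := fun g p q => (h g p q).trans (h' g p q)

theorem indist_of_satisfies {W : Set Word} {L : List ℕ → Prop} (hL : ∀ w, w ∈ W ↔ L w.toList)
    {u v : Word} (h : Satisfies (SyntacticMonoid W) (u, v)) : Indist L u.toList v.toList := by
  intro g p q
  have h1 := (satisfies_quotient_iff _ _).1 h (FreeMonoid.lift fun k => FreeMonoid.ofList (g k))
    (FreeMonoid.ofList p) (FreeMonoid.ofList q)
  rw [hL, hL] at h1
  simpa only [FreeMonoid.toList_mul, FreeMonoid.toList_ofList, toList_map_eq_flatMap,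
    FreeMonoid.lift_eval_of] using h1

theorem Deriv.indist {S : Set (Word × Word)} {W : Set Word} {L : List ℕ → Prop}
    (hL : ∀ w, w ∈ W ↔ L w.toList) (hS : ∀ e ∈ S, Satisfies (SyntacticMonoid W) e)
    {u v : List ℕ} (h : Deriv S u v) : Indist L u v :=
  indist_of_satisfies hL (derivCon_sound hS h)

section Deriv

variable {S : Set (Word × Word)}

theorem Deriv.refl (u : List ℕ) : Deriv S u u := (derivCon S).refl _

theorem Deriv.symm {u v : List ℕ} (h : Deriv S u v) : Deriv S v u := (derivCon S).symm h

theorem Deriv.trans {u v w : List ℕ} (h : Deriv S u v) (h' : Deriv S v w) : Deriv S u w :=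
  (derivCon S).trans h h'

theorem deriv_of_mem {e : Word × Word} (h : e ∈ S) (g : ℕ → List ℕ) (p q : List ℕ) :
    Deriv S (p ++ e.1.toList.flatMap g ++ q) (p ++ e.2.toList.flatMap g ++ q) := by
  have h1 := derivCon_subst h (FreeMonoid.lift fun k => FreeMonoid.ofList (g k))
  have h2 : ∀ w : Word, FreeMonoid.lift (fun k => FreeMonoid.ofList (g k)) w =
      FreeMonoid.ofList (w.toList.flatMap g) := fun w => FreeMonoid.toList.injective (by
    simp only [toList_map_eq_flatMap, FreeMonoid.lift_eval_of, FreeMonoid.toList_ofList])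
  rw [h2, h2] at h1
  exact (derivCon S).mul ((derivCon S).mul ((derivCon S).refl (FreeMonoid.ofList p)) h1)
    ((derivCon S).refl (FreeMonoid.ofList q))

/-- The set contains the identities `xyx ≈ xyx²` and `xyxztx ≈ xyxzxtx`. -/
structure HasBasic (S : Set (Word × Word)) : Prop where
  dup : (letter 0 * letter 1 * letter 0, letter 0 * letter 1 * letter 0 ^ 2) ∈ S
  ins : (letter 0 * letter 1 * letter 0 * letter 2 * letter 3 * letter 0,
    letter 0 * letter 1 * letter 0 * letter 2 * letter 0 * letter 3 * letter 0) ∈ S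

/-- The substitution that sends the letters `0, 1, 2, 3` to the given words. -/
def subst4 (X Y Z T : List ℕ) : ℕ → List ℕ
  | 0 => X
  | 1 => Y
  | 2 => Z
  | 3 => T
  | _ => []

theorem HasBasic.deriv_dup (hS : HasBasic S) {x : ℕ} {A : List ℕ} (hx : x ∈ A) (B : List ℕ) :
    Deriv S (A ++ x :: B) (A ++ x :: x :: B) := by
  obtain ⟨A₁, A₂, rfl⟩ := List.append_of_mem hx
  have := deriv_of_mem hS.dup (subst4 [x] A₂ [] []) A₁ B
  simpa [subst4, pow_two] using this

theorem HasBasic.deriv_ins (hS : HasBasic S) {x : ℕ} {A B : List ℕ} (hA : 2 ≤ A.count x)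
    (hB : x ∈ B) : Deriv S (A ++ B) (A ++ x :: B) := by
  obtain ⟨A₁, A₂, A₃, rfl⟩ := exists_split_of_two_le_count hA
  obtain ⟨B₁, B₂, rfl⟩ := List.append_of_mem hB
  have := deriv_of_mem hS.ins (subst4 [x] A₂ A₃ B₁) A₁ B₂
  simpa [subst4] using this

/-- Each letter of the word occurs once or exactly three times. -/
def Reduced (u : List ℕ) : Prop := ∀ x ∈ u, u.count x = 1 ∨ u.count x = 3

/-- An occurrence that is neither one of the first two nor the last can be deleted. A letter with
two occurrences has its second one doubled, so that three is the only count left above one. -/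
theorem HasBasic.exists_reduce_letter (hS : HasBasic S) (x : ℕ) (n : ℕ) : ∀ u : List ℕ,
    u.count x = n → ∃ u', Deriv S u u' ∧ (u'.count x ≤ 1 ∨ u'.count x = 3) ∧
      ∀ y, y ≠ x → u'.count y = u.count y := by
  induction n using Nat.strong_induction_on with
  | _ n ih =>
    intro u hu
    by_cases h1 : n ≤ 1
    · exact ⟨u, Deriv.refl u, Or.inl (hu ▸ h1), fun _ _ => rfl⟩
    by_cases h3 : n = 3
    · exact ⟨u, Deriv.refl u, Or.inr (hu ▸ h3), fun _ _ => rfl⟩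
    obtain ⟨l₁, l₂, l₃, rfl, hl₁, hl₂⟩ :=
      exists_split_of_two_le_count' (k := x) (l := u) (by omega)
    by_cases h2 : n = 2
    · refine ⟨l₁ ++ x :: (l₂ ++ x :: x :: l₃), ?_, Or.inr ?_, fun y hy => ?_⟩
      · have := hS.deriv_dup (x := x) (A := l₁ ++ x :: l₂) (by simp) l₃
        simpa using this
      · simp at hu ⊢
        omega
      · simp [hy.symm]
    have h4 : 2 ≤ l₃.count x := by
      simp [List.count_eq_zero_of_not_mem hl₁, List.count_eq_zero_of_not_mem hl₂] at hu
      omega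
    obtain ⟨B₁, B₂, B₃, rfl⟩ := exists_split_of_two_le_count h4
    -- The third displayed occurrence is deleted: two precede it and one follows.
    have hd : Deriv S (l₁ ++ x :: (l₂ ++ x :: (B₁ ++ x :: (B₂ ++ x :: B₃))))
        (l₁ ++ x :: (l₂ ++ x :: (B₁ ++ (B₂ ++ x :: B₃)))) := by
      have := hS.deriv_ins (x := x) (A := l₁ ++ x :: (l₂ ++ x :: B₁)) (B := B₂ ++ x :: B₃)
        (by simp; omega) (by simp)
      simpa using this.symm
    obtain ⟨u', hu', h5, h6⟩ := ih (n - 1) (by omega)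
      (l₁ ++ x :: (l₂ ++ x :: (B₁ ++ (B₂ ++ x :: B₃)))) (by simp at hu ⊢; omega)
    refine ⟨u', hd.trans hu', h5, fun y hy => ?_⟩
    rw [h6 y hy]
    simp [hy.symm]

theorem HasBasic.exists_reduced (hS : HasBasic S) (u : List ℕ) :
    ∃ u', Deriv S u u' ∧ Reduced u' := by
  have key : ∀ T : List ℕ, ∃ u', Deriv S u u' ∧ (∀ x ∈ T, u'.count x ≤ 1 ∨ u'.count x = 3) ∧
      ∀ x, x ∉ T → u'.count x = u.count x := by
    intro T
    induction T with
    | nil => exact ⟨u, Deriv.refl u, by simp, fun _ _ => rfl⟩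
    | cons x T ih =>
      obtain ⟨u', h1, h2, h3⟩ := ih
      obtain ⟨u'', h4, h5, h6⟩ := hS.exists_reduce_letter x _ u' rfl
      refine ⟨u'', h1.trans h4, fun y hy => ?_, fun y hy => ?_⟩
      · by_cases hyx : y = x
        · rwa [hyx]
        · rw [h6 y hyx]
          exact h2 y ((List.mem_cons.1 hy).resolve_left hyx)
      · rw [List.mem_cons, not_or] at hy
        rw [h6 y hy.1, h3 y hy.2]
  obtain ⟨u', h1, h2, h3⟩ := key u
  refine ⟨u', h1, fun x hx => ?_⟩
  have hx' := List.count_pos_iff.2 hx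
  have hxu : x ∈ u := by
    by_contra h
    rw [h3 x h, List.count_eq_zero_of_not_mem h] at hx'
    omega
  have := h2 x hxu
  omega

end Deriv

/-! ### Sorting one word into another -/

/-- The language `L` detects linear letters, and, for each linear letter `t` and each letter `y`,
whether all, none, or exactly one of the occurrences of `y` precede `t`. -/
structure Separates (L : List ℕ → Prop) : Prop where
  count_eq_one : ∀ {u v : List ℕ} {x : ℕ}, Indist L u v → u.count x = 1 → v.count x = 1
  mem : ∀ {u v : List ℕ} {x : ℕ}, Indist L u v → x ∈ u → x ∈ v
  after : ∀ {u₁ u₂ v₁ v₂ : List ℕ} {t y : ℕ}, Indist L (u₁ ++ t :: u₂) (v₁ ++ t :: v₂) →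
    y ≠ t → t ∉ u₁ → t ∉ u₂ → t ∉ v₁ → t ∉ v₂ → y ∉ u₂ → y ∉ v₂
  before : ∀ {u₁ u₂ v₁ v₂ : List ℕ} {t y : ℕ}, Indist L (u₁ ++ t :: u₂) (v₁ ++ t :: v₂) →
    y ≠ t → t ∉ u₁ → t ∉ u₂ → t ∉ v₁ → t ∉ v₂ → y ∉ u₁ → y ∉ v₁
  once : ∀ {u₁ u₂ v₁ v₂ : List ℕ} {t y : ℕ}, Indist L (u₁ ++ t :: u₂) (v₁ ++ t :: v₂) →
    y ≠ t → t ∉ u₁ → t ∉ u₂ → t ∉ v₁ → t ∉ v₂ → u₁.count y = 1 → y ∈ u₂ → v₁.count y = 1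

namespace Separates

variable {L : List ℕ → Prop}

theorem count_eq (hL : Separates L) {u v : List ℕ} (h : Indist L u v) (hu : Reduced u)
    (hv : Reduced v) (x : ℕ) : u.count x = v.count x := by
  by_cases hx : x ∈ u
  · have hxv := hL.mem h hx
    rcases hu x hx with h1 | h1
    · rw [h1, hL.count_eq_one h h1]
    · rcases hv x hxv with h2 | h2
      · rw [h2, hL.count_eq_one h.symm h2]
      · rw [h1, h2]
  · rw [List.count_eq_zero_of_not_mem hx, List.count_eq_zero_of_not_mem fun hxv =>
      hx (hL.mem h.symm hxv)]

/-- With one or three occurrences in all, the cases "none", "all" and "exactly one" before `t` are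
detected directly. What remains is two out of three. -/
theorem count_prefix_eq (hL : Separates L) {u₁ u₂ v₁ v₂ : List ℕ} {t : ℕ}
    (h : Indist L (u₁ ++ t :: u₂) (v₁ ++ t :: v₂)) (hu : Reduced (u₁ ++ t :: u₂))
    (hv : Reduced (v₁ ++ t :: v₂)) (ht : (u₁ ++ t :: u₂).count t = 1) (y : ℕ) :
    u₁.count y = v₁.count y := by
  have ht' := hL.count_eq_one h ht
  simp only [List.count_append, List.count_cons_self] at ht ht'
  have h1 : t ∉ u₁ := List.count_eq_zero.1 (by omega)
  have h2 : t ∉ u₂ := List.count_eq_zero.1 (by omega)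
  have h3 : t ∉ v₁ := List.count_eq_zero.1 (by omega)
  have h4 : t ∉ v₂ := List.count_eq_zero.1 (by omega)
  by_cases hyt : y = t
  · rw [hyt, List.count_eq_zero_of_not_mem h1, List.count_eq_zero_of_not_mem h3]
  have hc := hL.count_eq h hu hv y
  have ha := hL.after h hyt h1 h2 h3 h4
  have ha' := hL.after h.symm hyt h3 h4 h1 h2
  have hb := hL.before h hyt h1 h2 h3 h4
  have hb' := hL.before h.symm hyt h3 h4 h1 h2
  have ho := hL.once h hyt h1 h2 h3 h4
  have ho' := hL.once h.symm hyt h3 h4 h1 h2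
  simp only [← List.count_pos_iff, not_lt, Nat.le_zero] at ha ha' hb hb' ho ho'
  have hcases : (u₁ ++ t :: u₂).count y = 0 ∨ (u₁ ++ t :: u₂).count y = 1 ∨
      (u₁ ++ t :: u₂).count y = 3 := by
    by_cases hy : y ∈ u₁ ++ t :: u₂
    · exact Or.inr (hu y hy)
    · exact Or.inl (List.count_eq_zero_of_not_mem hy)
  simp only [List.count_append, List.count_cons_of_ne (Ne.symm hyt)] at hc hcases
  omega

/-- Adjacent letters whose order differs in an indistinguishable word both occur three times. -/
theorem count_eq_three (hL : Separates L) {p r B V : List ℕ} {y c : ℕ} (hyc : y ≠ c) (hc : c ∉ r)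
    (h : Indist L (p ++ r ++ y :: c :: B) (p ++ c :: V)) (hu : Reduced (p ++ r ++ y :: c :: B))
    (hv : Reduced (p ++ c :: V)) :
    (p ++ r ++ y :: c :: B).count y = 3 ∧ (p ++ r ++ y :: c :: B).count c = 3 := by
  constructor
  -- If `y` were linear, then in the second word more letters `c` would precede it, namely the one
  -- after `p`.
  · refine (hu y (by simp)).resolve_left fun h1 => ?_
    have h2 := hL.count_eq_one h h1
    have h1' := h1
    simp only [List.count_append, List.count_cons_self, List.count_cons_of_ne hyc.symm] at h1 h2
    obtain ⟨V₁, V₂, rfl⟩ := List.append_of_mem (List.count_pos_iff.1 (by omega : 0 < V.count y))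
    have h3 : Indist L (p ++ r ++ y :: (c :: B)) ((p ++ c :: V₁) ++ y :: V₂) := by
      simpa using h
    have h4 := hL.count_prefix_eq h3 hu (by simpa using hv) h1' c
    simp [List.count_eq_zero_of_not_mem hc] at h4
  -- If `c` were linear, the displayed `y` would precede it in the first word only, so the numbers
  -- of `y` before `c` would differ.
  · refine (hu c (by simp)).resolve_left fun h1 => ?_
    have h3 : Indist L ((p ++ r ++ [y]) ++ c :: B) (p ++ c :: V) := by simpa using h
    have h4 := hL.count_prefix_eq h3 (by simpa using hu) hv (by simpa using h1) y
    simp only [List.count_append, List.count_singleton_self] at h4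
    omega

end Separates

theorem Reduced.of_perm {u v : List ℕ} (h : u.Perm v) (hu : Reduced u) : Reduced v := by
  intro x hx
  rw [← h.count_eq]
  exact hu x (h.mem_iff.2 hx)

/-- Derivable swaps keep the word reduced and indistinguishable from the target, so the hypotheses
of `hstep` persist until `c` reaches the prefix `p`. -/
theorem deriv_move_left {S : Set (Word × Word)} {L : List ℕ → Prop}
    (hSL : ∀ {u v}, Deriv S u v → Indist L u v) {p V : List ℕ} {c : ℕ}
    (hstep : ∀ r y B, c ∉ r → y ≠ c → Reduced (p ++ r ++ y :: c :: B) →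
      Indist L (p ++ r ++ y :: c :: B) (p ++ c :: V) →
      Deriv S (p ++ r ++ y :: c :: B) (p ++ r ++ c :: y :: B)) (r : List ℕ) :
    ∀ B, c ∉ r → Reduced (p ++ (r ++ c :: B)) → Indist L (p ++ (r ++ c :: B)) (p ++ c :: V) →
      Deriv S (p ++ (r ++ c :: B)) (p ++ c :: (r ++ B)) := by
  induction r using List.reverseRecOn with
  | nil => intro B _ _ _; exact Deriv.refl _
  | append_singleton r y ih =>
    intro B hc hu hI
    simp only [List.mem_append, List.mem_singleton, not_or] at hc
    have hu' : Reduced (p ++ r ++ y :: c :: B) := by simpa using hu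
    have hI' : Indist L (p ++ r ++ y :: c :: B) (p ++ c :: V) := by simpa using hI
    have h1 := hstep r y B hc.1 (Ne.symm hc.2) hu' hI'
    have h2 := ih (y :: B) hc.1
      (by
        have : (p ++ r ++ y :: c :: B).Perm (p ++ (r ++ c :: y :: B)) := by
          rw [List.append_assoc]
          exact (List.Perm.append_left _ (List.Perm.append_left _ (List.Perm.swap _ _ _)))
        exact hu'.of_perm this)
      (by simpa using (hSL h1).symm.trans hI')
    simpa using h1.trans (by simpa using h2)

/-! ### Completeness of the identities of `K` -/

theorem hasBasic_identitiesK : HasBasic identitiesK :=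
  ⟨by simp [identitiesK], by simp [identitiesK]⟩

/-- The identity `xyzxty ≈ yxzxty` covers both orders of the later occurrences, by renaming. -/
theorem deriv_swap_of_mem_of_mem {x y : ℕ} {B : List ℕ} (hx : x ∈ B) (hy : y ∈ B) (hxy : x ≠ y)
    (A : List ℕ) : Deriv identitiesK (A ++ x :: y :: B) (A ++ y :: x :: B) := by
  have key : ∀ (x y : ℕ) (B₁ B₂ B₃ : List ℕ),
      Deriv identitiesK (A ++ x :: y :: (B₁ ++ x :: (B₂ ++ y :: B₃)))
        (A ++ y :: x :: (B₁ ++ x :: (B₂ ++ y :: B₃))) := by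
    intro x y B₁ B₂ B₃
    have h : (letter 0 * letter 1 * letter 2 * letter 0 * letter 3 * letter 1,
        letter 1 * letter 0 * letter 2 * letter 0 * letter 3 * letter 1) ∈ identitiesK := by
      simp [identitiesK]
    have := deriv_of_mem h (subst4 [x] [y] B₁ B₂) A B₃
    simpa [subst4] using this
  obtain ⟨B₁, B₂, rfl⟩ := List.append_of_mem hx
  rcases List.mem_append.1 hy with hy | hy
  · obtain ⟨B₃, B₄, rfl⟩ := List.append_of_mem hy
    simpa using (key y x B₃ B₄ B₂).symm
  · obtain ⟨B₃, B₄, rfl⟩ := List.append_of_mem ((List.mem_cons.1 hy).resolve_left hxy.symm)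
    simpa using key x y B₁ B₃ B₄

theorem deriv_swap_of_nonlinear {p q r s : List ℕ} {x y : ℕ}
    (hq : ∀ k ∈ q, 2 ≤ (p ++ x :: (q ++ y :: (r ++ x :: y :: s))).count k) :
    Deriv identitiesK (p ++ x :: (q ++ y :: (r ++ x :: y :: s)))
      (p ++ x :: (q ++ y :: (r ++ y :: x :: s))) := by
  have h : ((FreeMonoid.ofList p * letter x * FreeMonoid.ofList q * letter y *
      FreeMonoid.ofList r * letter x * letter y * FreeMonoid.ofList s,
      FreeMonoid.ofList p * letter x * FreeMonoid.ofList q * letter y *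
      FreeMonoid.ofList r * letter y * letter x * FreeMonoid.ofList s) : Word × Word) ∈
      identitiesK := by
    refine Or.inr ⟨FreeMonoid.ofList p, FreeMonoid.ofList q, FreeMonoid.ofList r,
      FreeMonoid.ofList s, x, y, ?_, rfl⟩
    intro k hk
    simpa using hq k hk
  have := deriv_of_mem h (fun k => [k]) [] []
  simpa using this

/-- With `P` the prefix, the chain is `Pxy ≈ Pxxyy ≈ Pxyxy ≈ Pxyyx ≈ Pxyx ≈ Pyx`. The second link is
`xzytyxy ≈ xzytxy²`, the third is the last family with empty `q`, and the others duplicate or insert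
letters. The final one needs two letters `x` in `P`. -/
theorem deriv_swap_of_two_le_count {P₁ P₂ P₃ s : List ℕ} {x y : ℕ}
    (hx : 2 ≤ (P₁ ++ x :: (P₂ ++ y :: P₃)).count x) :
    Deriv identitiesK (P₁ ++ x :: (P₂ ++ y :: P₃) ++ x :: y :: s)
      (P₁ ++ x :: (P₂ ++ y :: P₃) ++ y :: x :: s) := by
  have h4 : (letter 0 * letter 2 * letter 1 * letter 3 * letter 1 * letter 0 * letter 1,
      letter 0 * letter 2 * letter 1 * letter 3 * letter 0 * letter 1 ^ 2) ∈ identitiesK := by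
    simp [identitiesK]
  set P := P₁ ++ x :: (P₂ ++ y :: P₃) with hP
  have e1 : Deriv identitiesK (P ++ y :: x :: s) (P ++ x :: y :: x :: s) :=
    hasBasic_identitiesK.deriv_ins hx (by simp)
  have e2 : Deriv identitiesK (P ++ x :: y :: x :: s) (P ++ x :: y :: y :: x :: s) := by
    have := hasBasic_identitiesK.deriv_dup (x := y) (A := P ++ [x]) (by simp [hP]) (x :: s)
    simpa using this
  have e3 : Deriv identitiesK (P ++ x :: y :: x :: y :: s) (P ++ x :: y :: y :: x :: s) := by
    have := deriv_swap_of_nonlinear (p := P) (q := []) (r := []) (s := s) (x := x) (y := y)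
      (by simp)
    simpa using this
  have e4 : Deriv identitiesK (P ++ x :: y :: x :: y :: s) (P ++ x :: x :: y :: y :: s) := by
    have := deriv_of_mem h4 (subst4 [x] [y] P₂ (P₃ ++ [x])) P₁ s
    simpa [subst4, hP, pow_two] using this
  have e5 : Deriv identitiesK (P ++ x :: y :: s) (P ++ x :: x :: y :: s) :=
    hasBasic_identitiesK.deriv_dup (by simp [hP]) _
  have e6 : Deriv identitiesK (P ++ x :: x :: y :: s) (P ++ x :: x :: y :: y :: s) := by
    have := hasBasic_identitiesK.deriv_dup (x := y) (A := P ++ [x, x]) (by simp [hP]) s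
    simpa using this
  exact (e5.trans (e6.trans (e4.symm.trans (e3.trans (e2.symm.trans e1.symm)))))

/-! ### What the language `atbb⁺a⁺` distinguishes -/

theorem flatMap_eq_replicate {g : ℕ → List ℕ} {y b : ℕ} {A : List ℕ} (hy : g y = [b])
    (h : ∀ x ∈ A, x ≠ y → g x = []) : A.flatMap g = List.replicate (A.count y) b := by
  induction A with
  | nil => rfl
  | cons x A ih =>
    rw [List.flatMap_cons, ih fun z hz => h z (List.mem_cons_of_mem _ hz)]
    by_cases hx : x = y
    · rw [hx, hy, List.count_cons_self, List.replicate_succ, List.singleton_append]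
    · rw [h x (by simp) hx, List.nil_append, List.count_cons_of_ne hx]

theorem langK_iff {a b t : ℕ} (hab : a ≠ b) {w : List ℕ} :
    LangK a b t (a :: t :: w) ↔ (∀ x ∈ w, x = a ∨ x = b) ∧
      w.Pairwise (fun x y => x = a → y = a) ∧ 2 ≤ w.count b ∧ 1 ≤ w.count a := by
  constructor
  · rintro ⟨i, j, h⟩
    obtain rfl : w = List.replicate (i + 2) b ++ List.replicate (j + 1) a := by simpa using h
    simp [List.pairwise_append, List.pairwise_replicate, List.count_replicate, hab, hab.symm]
  · rintro ⟨h1, h2, h3, h4⟩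
    have key : ∀ w : List ℕ, (∀ x ∈ w, x = a ∨ x = b) → w.Pairwise (fun x y => x = a → y = a) →
        w = List.replicate (w.count b) b ++ List.replicate (w.count a) a := by
      intro w
      induction w with
      | nil => simp
      | cons x w ih =>
        intro h1 h2
        rw [List.pairwise_cons] at h2
        rcases h1 x (by simp) with rfl | rfl
        · have h3 := List.eq_replicate_of_mem fun z hz => h2.1 z hz rfl
          rw [h3]
          simp [List.count_replicate, hab, List.replicate_succ]
        · conv_lhs => rw [ih (fun z hz => h1 z (List.mem_cons_of_mem _ hz)) h2.2]
          simp [hab.symm, List.replicate_succ]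
    obtain ⟨i, hi⟩ := Nat.exists_eq_add_of_le' h3
    obtain ⟨j, hj⟩ := Nat.exists_eq_add_of_le' h4
    exact ⟨i, j, by rw [← hi, ← hj, ← key w h1 h2]⟩

section LangK

variable {a b t : ℕ}

theorem LangK.prefix_eq {w : List ℕ} (h : LangK a b t w) : ∃ w', w = a :: t :: w' := by
  obtain ⟨i, j, rfl⟩ := h
  exact ⟨_, rfl⟩

/-- The substitution that sends `x` to `X`, `y` to `Y` and erases the other letters. -/
def subst2 (x : ℕ) (X : List ℕ) (y : ℕ) (Y : List ℕ) (k : ℕ) : List ℕ :=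
  if k = x then X else if k = y then Y else []

theorem flatMap_subst2_linear {u₁ u₂ : List ℕ} {l y : ℕ} (h₁ : l ∉ u₁) (h₂ : l ∉ u₂) (hyl : y ≠ l)
    (T : List ℕ) (c : ℕ) : (u₁ ++ l :: u₂).flatMap (subst2 l T y [c]) =
      List.replicate (u₁.count y) c ++ T ++ List.replicate (u₂.count y) c := by
  have h0 : subst2 l T y [c] y = [c] := by simp [subst2, hyl]
  have h : ∀ A : List ℕ, l ∉ A → ∀ x ∈ A, x ≠ y → subst2 l T y [c] x = [] := by
    intro A hA x hx hxy
    have : x ≠ l := fun e => hA (e ▸ hx)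
    simp [subst2, this, hxy]
  rw [List.flatMap_append, List.flatMap_cons, flatMap_eq_replicate h0 (h _ h₁),
    flatMap_eq_replicate h0 (h _ h₂), List.append_assoc]
  simp [subst2]

/-- Each property is tested by one substitution. With `l` the linear letter, the last three yield
`atbⁿbbabᵐ`, `ataⁿbbaaᵐ` and `aⁿtbbaaᵐ`, which lie in the language exactly if `m = 0`, `n = 0` and
`n = 1`. -/
theorem separates_langK (hab : a ≠ b) (hat : a ≠ t) (hbt : b ≠ t) : Separates (LangK a b t) := by
  refine ⟨?_, ?_, ?_, ?_, ?_⟩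
  · intro u v x h hx
    have h1 := h (fun k => if k = x then [t] else []) [a] [b, b, a]
    rw [flatMap_eq_replicate (y := x) (b := t) (by simp) (fun z _ hz => by simp [hz]),
      flatMap_eq_replicate (y := x) (b := t) (by simp) (fun z _ hz => by simp [hz]), hx] at h1
    have h2 := h1.1 ⟨0, 0, rfl⟩
    rcases h3 : v.count x with _ | _ | n
    · rw [h3] at h2
      obtain ⟨w', h2⟩ := h2.prefix_eq
      simp at h2
      omega
    · rfl
    · rw [h3] at h2
      have : [a] ++ List.replicate (n + 1 + 1) t ++ [b, b, a] =
        a :: t :: (t :: List.replicate n t ++ [b, b, a]) := by simp [List.replicate_succ]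
      rw [this, langK_iff hab] at h2
      have := h2.1 t (by simp)
      omega
  · intro u v x h hx
    have h1 := h (fun k => if k = x then [b] else []) [a, t, b] [a]
    rw [flatMap_eq_replicate (y := x) (b := b) (by simp) (fun z _ hz => by simp [hz]),
      flatMap_eq_replicate (y := x) (b := b) (by simp) (fun z _ hz => by simp [hz])] at h1
    simp only [List.cons_append, List.nil_append, langK_iff hab] at h1
    have h3 := (h1.1 (by
      simp [List.pairwise_append, List.pairwise_replicate, hab.symm, hab, List.count_replicate]
      exact ⟨by tauto, hx⟩)).2.2.1
    simp [hab] at h3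
    exact h3
  · intro u₁ u₂ v₁ v₂ l y h hyl h1 h2 h3 h4 hy
    have h5 := h (subst2 l [b, b, a] y [b]) [a, t] []
    rw [flatMap_subst2_linear h1 h2 hyl, flatMap_subst2_linear h3 h4 hyl,
      List.count_eq_zero_of_not_mem hy] at h5
    simp only [List.cons_append, List.nil_append, langK_iff hab] at h5
    have h6 := (h5.1 (by
      simp [List.pairwise_append, List.pairwise_replicate, hab.symm, hab, List.count_replicate]
      tauto)).2.1
    simp [List.pairwise_append, List.pairwise_replicate, hab.symm] at h6
    exact List.count_eq_zero.1 h6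
  · intro u₁ u₂ v₁ v₂ l y h hyl h1 h2 h3 h4 hy
    have h5 := h (subst2 l [b, b, a] y [a]) [a, t] []
    rw [flatMap_subst2_linear h1 h2 hyl, flatMap_subst2_linear h3 h4 hyl,
      List.count_eq_zero_of_not_mem hy] at h5
    simp only [List.cons_append, List.nil_append, langK_iff hab] at h5
    have h6 := (h5.1 (by
      simp [List.pairwise_replicate, hab.symm, hab, List.count_replicate])).2.1
    simp [List.pairwise_append, List.pairwise_replicate, hab.symm] at h6
    exact List.count_eq_zero.1 (by omega)
  · intro u₁ u₂ v₁ v₂ l y h hyl h1 h2 h3 h4 hy hy2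
    have h5 := h (subst2 l [t, b, b, a] y [a]) [] []
    rw [flatMap_subst2_linear h1 h2 hyl, flatMap_subst2_linear h3 h4 hyl, hy] at h5
    have h6 := h5.1 (by
      refine ⟨0, u₂.count y, ?_⟩
      simp [List.replicate_succ])
    obtain ⟨w', h7⟩ := h6.prefix_eq
    rcases h8 : v₁.count y with _ | _ | n
    · rw [h8] at h7
      simp at h7
      omega
    · rfl
    · rw [h8] at h7
      simp [List.replicate_succ] at h7
      omega

/-- Sending `y` to `b` and `c` to `a` after `atbb` turns the first word into a member of the
language, while in the second an `a` is followed by a `b`. -/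
theorem LangK.not_blocks (hab : a ≠ b) {U₁ U₂ V₁ V₂ : List ℕ} {y c : ℕ} (hyc : y ≠ c)
    (h : Indist (LangK a b t) (U₁ ++ U₂) (V₁ ++ c :: V₂)) (h1 : c ∉ U₁) (h2 : y ∉ U₂)
    (hc : c ∈ U₂) (hy : y ∈ V₂) : False := by
  have h5 := h (subst2 y [b] c [a]) [a, t, b, b] []
  have gy : subst2 y [b] c [a] y = [b] := by simp [subst2]
  have gc : subst2 y [b] c [a] c = [a] := by simp [subst2, hyc.symm]
  have e1 : U₁.flatMap (subst2 y [b] c [a]) = List.replicate (U₁.count y) b :=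
    flatMap_eq_replicate gy fun x hx hxy => by
      have : x ≠ c := fun e => h1 (e ▸ hx)
      simp [subst2, hxy, this]
  have e2 : U₂.flatMap (subst2 y [b] c [a]) = List.replicate (U₂.count c) a :=
    flatMap_eq_replicate gc fun x hx hxc => by
      have : x ≠ y := fun e => h2 (e ▸ hx)
      simp [subst2, hxc, this]
  rw [List.flatMap_append, e1, e2, List.flatMap_append, List.flatMap_cons, gc] at h5
  simp only [List.cons_append, List.nil_append, langK_iff hab] at h5
  have h6 := (h5.1 (by
    simp [List.pairwise_append, List.pairwise_replicate, hab.symm, hab, List.count_replicate]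
    exact ⟨by tauto, hc⟩)).2.1
  have h7 : b ∈ V₂.flatMap (subst2 y [b] c [a]) := List.mem_flatMap.2 ⟨y, hy, by simp [gy]⟩
  simp only [List.pairwise_append, List.pairwise_cons, List.append_nil, List.mem_cons] at h6
  exact hab (h6.2.2.2.1.1 b h7 trivial).symm

/-- As `LangK.not_blocks`, with the first `c` moved in front of the `y`s and a linear letter. -/
theorem LangK.not_blocks' (hab : a ≠ b) (hat : a ≠ t) {U₁ U₂ U₃ U₄ V₁ V₂ : List ℕ}
    {y c l : ℕ} (hyc : y ≠ c) (hly : l ≠ y) (hlc : l ≠ c)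
    (h : Indist (LangK a b t) (U₁ ++ c :: (U₂ ++ l :: (U₃ ++ U₄))) (V₁ ++ c :: V₂))
    (hl : l ∉ U₁ ++ U₂ ++ U₃ ++ U₄) (hy1 : y ∉ U₁ ++ U₂) (hc1 : c ∉ U₁ ++ U₂ ++ U₃) (h2 : y ∉ U₄)
    (hc : c ∈ U₄) (hyU : y ∈ U₃) (hcV : c ∈ V₁) (hy : y ∈ V₂) : False := by
  -- The first `c` becomes the initial `a` and `l` becomes `tb`, so that the first word maps to
  -- `atb⋯ba⋯a`.
  set g : ℕ → List ℕ := fun k => if k = y then [b] else if k = c then [a] else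
    if k = l then [t, b] else [] with hg
  have gy : g y = [b] := by simp [hg]
  have gc : g c = [a] := by simp [hg, hyc.symm]
  have gl : g l = [t, b] := by simp [hg, hly, hlc]
  simp only [List.mem_append, not_or] at hl hy1 hc1
  have e0 : ∀ U : List ℕ, y ∉ U → c ∉ U → l ∉ U → U.flatMap g = [] := by
    intro U h1 h2 h3
    rw [List.flatMap_eq_nil_iff]
    intro x hx
    have h1 : x ≠ y := fun e => h1 (e ▸ hx)
    have h2 : x ≠ c := fun e => h2 (e ▸ hx)
    have h3 : x ≠ l := fun e => h3 (e ▸ hx)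
    simp [hg, h1, h2, h3]
  have e1 : U₃.flatMap g = List.replicate (U₃.count y) b :=
    flatMap_eq_replicate gy fun x hx hxy => by
      have h1 : x ≠ c := fun e => hc1.2 (e ▸ hx)
      have h2 : x ≠ l := fun e => hl.1.2 (e ▸ hx)
      simp [hg, hxy, h1, h2]
  have e2 : U₄.flatMap g = List.replicate (U₄.count c) a :=
    flatMap_eq_replicate gc fun x hx hxc => by
      have h1 : x ≠ y := fun e => h2 (e ▸ hx)
      have h2 : x ≠ l := fun e => hl.2 (e ▸ hx)
      simp [hg, hxc, h1, h2]
  have h5 := h g [] []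
  simp only [List.flatMap_append, List.flatMap_cons, gc, gl, e1, e2,
    e0 U₁ hy1.1 hc1.1.1 hl.1.1.1, e0 U₂ hy1.2 hc1.1.2 hl.1.1.2, List.nil_append,
    List.cons_append, List.append_nil, langK_iff hab] at h5
  have h6 := h5.1 (by
    simp [List.pairwise_append, List.pairwise_replicate, hab.symm, hab, List.count_replicate]
    exact ⟨by tauto, hyU, hc⟩)
  obtain ⟨w, hw⟩ := h6.prefix_eq
  have h7 : a ∈ V₁.flatMap g := List.mem_flatMap.2 ⟨c, hcV, by simp [gc]⟩
  have h8 : b ∈ V₂.flatMap g := List.mem_flatMap.2 ⟨y, hy, by simp [gy]⟩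
  -- The image of `V₁` contains an `a`, so it is nonempty; it is not `a` alone, since the next
  -- letter would be `a` instead of `t`. Hence it absorbs `at`, and the displayed `a` is followed by
  -- a forbidden `b`.
  rcases h9 : V₁.flatMap g with _ | ⟨d, _ | ⟨e, V⟩⟩
  · simp [h9] at h7
  · simp [h9, hat] at hw
  · rw [h9] at h6 hw
    simp only [List.cons_append, List.cons.injEq] at hw
    rw [hw.1, hw.2.1, List.cons_append, List.cons_append, langK_iff hab] at h6
    have := h6.2.1
    simp only [List.pairwise_append, List.pairwise_cons] at this
    exact hab (this.2.1.1 b h8 trivial).symm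

end LangK

/-! ### Sorting words by means of the identities of `K` -/

section Complete

variable {a b t : ℕ}

/-- Both letters occur three times, and the cases follow the position of the other occurrences. If
both recur later, or if the letter whose first occurrence is earlier has already occurred twice and
the other once, the swap is derivable. It is also derivable when one letter has its last two
occurrences around those of the other, provided that no linear letter separates their first
occurrences. Every remaining configuration is distinguished from the target by `LangK.not_blocks` or
`LangK.not_blocks'`. -/
theorem deriv_step_K (hab : a ≠ b) (hat : a ≠ t) (hbt : b ≠ t) {p V : List ℕ} {c : ℕ}
    (hv : Reduced (p ++ c :: V)) {r : List ℕ} {y : ℕ} {B : List ℕ} (hc : c ∉ r) (hyc : y ≠ c)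
    (hu : Reduced (p ++ r ++ y :: c :: B))
    (h : Indist (LangK a b t) (p ++ r ++ y :: c :: B) (p ++ c :: V)) :
    Deriv identitiesK (p ++ r ++ y :: c :: B) (p ++ r ++ c :: y :: B) := by
  have hsep := separates_langK hab hat hbt
  obtain ⟨hy3, hc3⟩ := hsep.count_eq_three hyc hc h hu hv
  have hyv := hsep.count_eq h hu hv y
  have hcv := hsep.count_eq h hu hv c
  rw [hy3] at hyv
  rw [hc3] at hcv
  have hcr := List.count_eq_zero_of_not_mem hc
  have hy3' := hy3
  have hc3' := hc3
  have hlin : ∀ k ∈ p ++ r ++ y :: c :: B, ¬ 2 ≤ (p ++ r ++ y :: c :: B).count k →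
      (p ++ r ++ y :: c :: B).count k = 1 := fun k hk h2 => by
    rcases hu k hk with h3 | h3 <;> omega
  simp only [List.count_append, List.count_cons_self, List.count_cons_of_ne hyc,
    List.count_cons_of_ne hyc.symm, hcr] at hy3 hc3 hyv hcv
  by_cases hyB : y ∈ B
  · by_cases hcB : c ∈ B
    · exact deriv_swap_of_mem_of_mem hyB hcB hyc _
    have hcB' := List.count_eq_zero_of_not_mem hcB
    have hyB' := List.count_pos_iff.2 hyB
    have hcV : c ∉ V := List.count_eq_zero.1 (by omega)
    by_cases hyp : y ∈ p
    · obtain ⟨p₁, p₂, rfl, hyp₁⟩ := List.eq_append_cons_of_mem hyp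
      have hyp' := List.count_eq_zero_of_not_mem hyp₁
      simp only [List.count_append, List.count_cons_self, List.count_cons_of_ne hyc] at hy3 hc3 hyv hcv
      by_cases hcp₁ : c ∈ p₁
      · obtain ⟨p₃, p₄, rfl⟩ := List.append_of_mem hcp₁
        have := deriv_swap_of_two_le_count (P₁ := p₃) (P₂ := p₄) (P₃ := p₂ ++ r) (x := c) (y := y)
          (s := B) (by simp [hyc] at hc3 ⊢; omega)
        simpa using this.symm
      have hcp₁' := List.count_eq_zero_of_not_mem hcp₁
      obtain ⟨p₃, p₄, rfl, hcp₃⟩ := List.eq_append_cons_of_mem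
        (List.count_pos_iff.1 (by omega : 0 < p₂.count c))
      by_cases hq : ∀ k ∈ p₃, 2 ≤ (p₁ ++ y :: (p₃ ++ c :: p₄) ++ r ++ y :: c :: B).count k
      · have := deriv_swap_of_nonlinear (p := p₁) (q := p₃) (r := p₄ ++ r) (s := B) (x := y)
          (y := c) (fun k hk => by simpa using hq k hk)
        simpa using this
      · push Not at hq
        obtain ⟨l, hl, hl2⟩ := hq
        obtain ⟨p₅, p₆, rfl⟩ := List.append_of_mem hl
        have hl3 := hlin l (by simp) (by omega)
        have hly : l ≠ y := by rintro rfl; omega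
        have hlc : l ≠ c := by rintro rfl; omega
        rw [hsep.count_eq h hu hv l] at hl3
        simp only [List.count_append, List.count_cons_self,
          List.count_cons_of_ne hyc.symm, List.count_cons_of_ne hly,
          List.count_cons_of_ne hly.symm, List.count_cons_of_ne hlc.symm] at hl3 hy3 hyv
        simp only [List.mem_append, List.mem_cons, not_or] at hcp₃
        -- The letters exchange roles here: in the target word the first `y` is followed by `l`,
        -- then by all `c`, then by the remaining `y`.
        refine (LangK.not_blocks' hab hat (U₁ := p₁) (U₂ := p₅) (U₃ := p₆ ++ c :: (p₄ ++ [c]))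
          (U₄ := V) (V₁ := p₁ ++ y :: (p₅ ++ l :: p₆ ++ c :: p₄) ++ r) (V₂ := c :: B) (l := l)
          hyc.symm hlc hly (by simpa using h.symm) ?_ ?_ ?_ hcV ?_ (by simp) (by simp)
          (by simp)).elim
        · rw [← List.count_eq_zero]
          simp [hlc.symm]
          omega
        · simp [hcp₁, hcp₃.1]
        · rw [← List.count_eq_zero]
          simp [hyc.symm]
          omega
        · exact List.count_pos_iff.1 (by omega)
    · have h1 : Indist (LangK a b t) ((p ++ [c]) ++ V) ((p ++ r) ++ y :: (c :: B)) := by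
        simpa using h.symm
      refine (LangK.not_blocks hab hyc.symm h1 (by simp [hyp, hyc]) hcV ?_ (by simp)).elim
      exact List.count_pos_iff.1 (by have := List.count_eq_zero_of_not_mem hyp; omega)
  · have hyB' := List.count_eq_zero_of_not_mem hyB
    have hyV : y ∈ V := List.count_pos_iff.1 (by omega)
    by_cases hcB : c ∈ B
    · have hcB' := List.count_pos_iff.2 hcB
      by_cases hcp : c ∈ p
      · obtain ⟨p₁, p₂, rfl, hcp₁⟩ := List.eq_append_cons_of_mem hcp
        have hcp₁' := List.count_eq_zero_of_not_mem hcp₁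
        simp only [List.count_append, List.count_cons_self,
          List.count_cons_of_ne hyc.symm] at hy3 hc3 hyv hcv
        by_cases hyp₁ : y ∈ p₁
        · obtain ⟨p₃, p₄, rfl⟩ := List.append_of_mem hyp₁
          have := deriv_swap_of_two_le_count (P₁ := p₃) (P₂ := p₄) (P₃ := p₂ ++ r) (x := y)
            (y := c) (s := B) (by simp [hyc.symm] at hy3 ⊢; omega)
          simpa using this
        have hyp₁' := List.count_eq_zero_of_not_mem hyp₁
        obtain ⟨p₃, p₄, hp, hyp₃⟩ := List.eq_append_cons_of_mem
          (List.count_pos_iff.1 (by rw [List.count_append]; omega : 0 < (p₂ ++ r).count y))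
        have hAp : p₁ ++ c :: p₂ ++ r = p₁ ++ c :: (p₃ ++ y :: p₄) := by rw [← hp]; simp
        rw [hAp] at h hu hlin hy3' hc3' ⊢
        have hcp := congrArg (List.count c) hp
        simp only [List.count_append, List.count_cons_of_ne hyc] at hcp
        by_cases hq : ∀ k ∈ p₃, 2 ≤ (p₁ ++ c :: (p₃ ++ y :: p₄) ++ y :: c :: B).count k
        · have := deriv_swap_of_nonlinear (p := p₁) (q := p₃) (r := p₄) (s := B) (x := c)
            (y := y) (fun k hk => by
              have := hq k hk
              simp only [List.count_append, List.count_cons] at this ⊢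
              omega)
          simpa using this.symm
        · push Not at hq
          obtain ⟨l, hl, hl2⟩ := hq
          obtain ⟨p₅, p₆, rfl⟩ := List.append_of_mem hl
          have hl3 := hlin l (by simp) (by omega)
          have hly : l ≠ y := by rintro rfl; omega
          have hlc : l ≠ c := by rintro rfl; omega
          simp only [List.count_append, List.count_cons_self,
            List.count_cons_of_ne hlc,
            List.count_cons_of_ne hly.symm, List.count_cons_of_ne hlc.symm] at hl3 hcp
          simp only [List.mem_append, List.mem_cons, not_or] at hyp₃
          -- Now the word being sorted has the block form: the first `c`, then `l`, then all `y`,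
          -- then the remaining `c`.
          refine (LangK.not_blocks' hab hat (U₁ := p₁) (U₂ := p₅) (U₃ := p₆ ++ y :: (p₄ ++ [y]))
            (U₄ := c :: B) (V₁ := p₁ ++ c :: p₂) (V₂ := V) (l := l)
            hyc hly hlc (by simpa using h) ?_ ?_ ?_ (by simp [hyc, hyB]) (by simp) (by simp)
            (by simp) hyV).elim
          · rw [← List.count_eq_zero]
            simp [hly.symm, hlc.symm]
            omega
          · simp [hyp₁, hyp₃.1]
          · rw [← List.count_eq_zero]
            simp [hyc]
            omega
      · have h1 : Indist (LangK a b t) ((p ++ r ++ [y]) ++ (c :: B)) (p ++ c :: V) := by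
          simpa using h
        exact (LangK.not_blocks hab hyc h1 (by simp [hcp, hc, hyc.symm]) (by simp [hyc, hyB])
          (by simp) hyV).elim
    · have hcB' := List.count_eq_zero_of_not_mem hcB
      obtain ⟨A₁, A₂, hA, hyA⟩ := List.eq_append_cons_of_mem
        (List.count_pos_iff.1 (by rw [List.count_append]; omega : 0 < (p ++ r).count y))
      have hcA : c ∈ p ++ r := List.count_pos_iff.1 (by rw [List.count_append]; omega)
      have hy2 : 2 ≤ (p ++ r).count y := by rw [List.count_append]; omega
      have hc2 : 2 ≤ (p ++ r).count c := by rw [List.count_append]; omega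
      rw [hA] at hcA hy2 hc2 ⊢
      rcases List.mem_append.1 hcA with hcA | hcA
      · obtain ⟨A₃, A₄, rfl⟩ := List.append_of_mem hcA
        rw [List.append_assoc, List.cons_append] at hc2
        simpa using (deriv_swap_of_two_le_count (s := B) hc2).symm
      · obtain ⟨A₃, A₄, rfl⟩ := List.append_of_mem ((List.mem_cons.1 hcA).resolve_left hyc.symm)
        exact deriv_swap_of_two_le_count hy2

theorem deriv_of_indist_K (hab : a ≠ b) (hat : a ≠ t) (hbt : b ≠ t)
    (hSL : ∀ {u v}, Deriv identitiesK u v → Indist (LangK a b t) u v) (v : List ℕ) :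
    ∀ p u : List ℕ, Reduced (p ++ u) → Reduced (p ++ v) →
      Indist (LangK a b t) (p ++ u) (p ++ v) → Deriv identitiesK (p ++ u) (p ++ v) := by
  have hsep := separates_langK hab hat hbt
  induction v with
  | nil =>
    intro p u hu hv h
    have hperm : (p ++ u).Perm (p ++ []) := List.perm_iff_count.2 (hsep.count_eq h hu hv)
    have : u = [] := List.perm_nil.1 ((List.perm_append_left_iff p).1 hperm)
    rw [this]
    exact Deriv.refl _
  | cons c V ih =>
    intro p u hu hv h
    have hperm : (p ++ u).Perm (p ++ c :: V) := List.perm_iff_count.2 (hsep.count_eq h hu hv)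
    have hcu : c ∈ u := ((List.perm_append_left_iff p).1 hperm).mem_iff.2 (by simp)
    obtain ⟨r, B, rfl, hcr⟩ := List.eq_append_cons_of_mem hcu
    have h1 := deriv_move_left hSL (fun r y B h1 h2 h3 h4 =>
      deriv_step_K hab hat hbt hv h1 h2 h3 h4) r B hcr hu h
    have h2 := ih (p ++ [c]) (r ++ B)
      (by simpa using hu.of_perm (List.Perm.append_left p List.perm_middle)) (by simpa using hv)
      (by simpa using (hSL h1).symm.trans h)
    exact h1.trans (by simpa using h2)

theorem varietyK_eq (hab : a ≠ b) (hat : a ≠ t) (hbt : b ≠ t) :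
    varietyK.{w} = generatedVariety.{w} (MTau (tauOne ⊓ zetaCon)
        (conClass (tauOne ⊓ zetaCon) (letter a * letter t * letter b ^ 2 * letter a))) ∧
      generatedVariety.{w} (MTau (tauOne ⊓ zetaCon)
        (conClass (tauOne ⊓ zetaCon) (letter a * letter t * letter b ^ 2 * letter a))) =
      generatedVariety.{w}
        (SyntacticMonoid ({letter a} * {letter t} * {letter b} * plus b * plus a)) := by
  have h1 : ∀ e, Satisfies (MTau (tauOne ⊓ zetaCon) (conClass (tauOne ⊓ zetaCon)
      (letter a * letter t * letter b ^ 2 * letter a))) e →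
      Satisfies (SyntacticMonoid ({letter a} * {letter t} * {letter b} * plus b * plus a)) e := by
    intro e h
    have := h.quotient_mono (reesCon_le_syntacticCon _ _)
    rwa [conClass_languageK hab hat hbt] at this
  have hsound := fun e he => h1 e (identitiesK_sound hab hat hbt he)
  have hSL : ∀ {u v}, Deriv identitiesK u v → Indist (LangK a b t) u v :=
    fun h => h.indist (fun _ => mem_languageK_iff_langK) hsound
  have hcomplete : ∀ u v, Satisfies
      (SyntacticMonoid ({letter a} * {letter t} * {letter b} * plus b * plus a)) (u, v) →
      derivCon identitiesK u v := by
    intro u v h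
    have hI : Indist (LangK a b t) u.toList v.toList :=
      indist_of_satisfies (fun _ => mem_languageK_iff_langK) h
    obtain ⟨u', hu, hu'⟩ := hasBasic_identitiesK.exists_reduced u.toList
    obtain ⟨v', hv, hv'⟩ := hasBasic_identitiesK.exists_reduced v.toList
    have := deriv_of_indist_K hab hat hbt hSL v' [] u' hu' hv'
      ((hSL hu).symm.trans (hI.trans (hSL hv)))
    exact hu.trans (this.trans hv.symm)
  have h2 := varOf_eq_generatedVariety.{w}
    (fun e he => identitiesK_sound hab hat hbt he) (fun u v h => hcomplete u v (h1 _ h))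
  have h3 := varOf_eq_generatedVariety.{w} hsound hcomplete
  exact ⟨h2, h2.symm.trans h3⟩

end Complete

/-! ### Completeness of the identities of `J` -/

theorem hasBasic_identitiesJ : HasBasic identitiesJ :=
  ⟨by simp [identitiesJ], by simp [identitiesJ]⟩

theorem deriv_swap_of_mem {x y : ℕ} {A : List ℕ} (hx : x ∈ A) (hy : y ∈ A) (hxy : x ≠ y)
    (B : List ℕ) : Deriv identitiesJ (A ++ x :: y :: B) (A ++ y :: x :: B) := by
  have key : ∀ (x y : ℕ) (A₁ A₂ A₃ : List ℕ),
      Deriv identitiesJ (A₁ ++ x :: (A₂ ++ y :: A₃) ++ x :: y :: B)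
        (A₁ ++ x :: (A₂ ++ y :: A₃) ++ y :: x :: B) := by
    intro x y A₁ A₂ A₃
    have h : (letter 0 * letter 2 * letter 1 * letter 3 * letter 0 * letter 1,
        letter 0 * letter 2 * letter 1 * letter 3 * letter 1 * letter 0) ∈ identitiesJ := by
      simp [identitiesJ]
    have := deriv_of_mem h (subst4 [x] [y] A₂ A₃) A₁ B
    simpa [subst4] using this
  obtain ⟨A₁, A₂, rfl⟩ := List.append_of_mem hx
  rcases List.mem_append.1 hy with hy | hy
  · obtain ⟨A₃, A₄, rfl⟩ := List.append_of_mem hy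
    simpa using (key y x A₃ A₄ A₂).symm
  · obtain ⟨A₃, A₄, rfl⟩ := List.append_of_mem ((List.mem_cons.1 hy).resolve_left hxy.symm)
    exact key x y A₁ A₃ A₄

/-- The chain is `Axy ≈ Axxy ≈ Axyx ≈ Ayx`, with `xzxyxty ≈ xzx²yty` in the middle. -/
theorem deriv_swap_third {x y : ℕ} {A B : List ℕ} (hx : 2 ≤ A.count x) (hy : y ∈ B) :
    Deriv identitiesJ (A ++ x :: y :: B) (A ++ y :: x :: B) := by
  have h : (letter 0 * letter 2 * letter 0 * letter 1 * letter 0 * letter 3 * letter 1,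
      letter 0 * letter 2 * letter 0 ^ 2 * letter 1 * letter 3 * letter 1) ∈ identitiesJ := by
    simp [identitiesJ]
  have e1 : Deriv identitiesJ (A ++ x :: y :: B) (A ++ x :: x :: y :: B) :=
    hasBasic_identitiesJ.deriv_dup (List.count_pos_iff.1 (by omega)) _
  have e2 : Deriv identitiesJ (A ++ x :: y :: x :: B) (A ++ x :: x :: y :: B) := by
    obtain ⟨A₁, A₂, A₃, rfl⟩ := exists_split_of_two_le_count hx
    obtain ⟨B₁, B₂, rfl⟩ := List.append_of_mem hy
    have := deriv_of_mem h (subst4 [x] [y] (A₂ ++ x :: A₃) B₁) A₁ B₂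
    simpa [subst4, pow_two] using this
  have e3 : Deriv identitiesJ (A ++ y :: x :: B) (A ++ x :: y :: x :: B) :=
    hasBasic_identitiesJ.deriv_ins hx (by simp)
  exact e1.trans (e2.symm.trans e3.symm)

theorem deriv_swap_of_later (A B₁ B₂ : List ℕ) (x y : ℕ) :
    Deriv identitiesJ (A ++ x :: y :: (B₁ ++ x :: y :: B₂))
      (A ++ y :: x :: (B₁ ++ x :: y :: B₂)) := by
  have h : (letter 0 * letter 1 * letter 2 * letter 0 * letter 1,
      letter 1 * letter 0 * letter 2 * letter 0 * letter 1) ∈ identitiesJ := by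
    simp [identitiesJ]
  have := deriv_of_mem h (subst4 [x] [y] B₁ []) A B₂
  simpa [subst4] using this

/-- A nonlinear letter `z` to be crossed either has occurred before, so that `deriv_swap_of_mem`
applies, or occurs again later, so that `deriv_swap_third` applies. -/
theorem deriv_move_right {x : ℕ} {B : List ℕ} (R : List ℕ) : ∀ A : List ℕ, 2 ≤ A.count x →
    (∀ z ∈ R, 2 ≤ (A ++ (R ++ B)).count z) →
    Deriv identitiesJ (A ++ x :: (R ++ B)) (A ++ (R ++ x :: B)) := by
  induction R with
  | nil => intro A _ _; exact Deriv.refl _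
  | cons z R ih =>
    intro A hx hR
    have h1 : Deriv identitiesJ (A ++ x :: z :: (R ++ B)) (A ++ z :: x :: (R ++ B)) := by
      by_cases hzx : z = x
      · rw [hzx]; exact Deriv.refl _
      by_cases hzA : z ∈ A
      · exact deriv_swap_of_mem (List.count_pos_iff.1 (by omega)) hzA (Ne.symm hzx) _
      · have h2 := hR z (by simp)
        rw [List.count_append, List.count_eq_zero_of_not_mem hzA, List.cons_append,
          List.count_cons_self] at h2
        exact deriv_swap_third hx (List.count_pos_iff.1 (by omega))
    have h2 := ih (A ++ [z]) (by rw [List.count_append]; omega)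
      (fun w hw => by simpa using hR w (List.mem_cons_of_mem _ hw))
    exact Deriv.trans (by simpa using h1) (by simpa using h2)

/-- The letter `z` may be inserted between `Q` and `S`. -/
def Insertable (Q S : List ℕ) (z : ℕ) : Prop :=
  (2 ≤ Q.count z ∧ z ∈ S) ∨
    ∃ Q₁ R, Q = Q₁ ++ z :: R ∧ z ∈ Q₁ ∧ ∀ k ∈ R, 2 ≤ (Q ++ S).count k

/-- In the second case a non-first occurrence of `z` is doubled and the copy travels right across
nonlinear letters. -/
theorem Insertable.deriv {Q S : List ℕ} {z : ℕ} (h : Insertable Q S z) :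
    Deriv identitiesJ (Q ++ S) (Q ++ z :: S) := by
  rcases h with ⟨h1, h2⟩ | ⟨Q₁, R, rfl, h1, h2⟩
  · exact hasBasic_identitiesJ.deriv_ins h1 h2
  · have e1 := hasBasic_identitiesJ.deriv_dup h1 (R ++ S)
    have e2 := deriv_move_right (x := z) (B := S) R (Q₁ ++ [z])
      (by
        have := List.count_pos_iff.2 h1
        simp
        omega)
      (fun k hk => by simpa using h2 k hk)
    exact Deriv.trans (by simpa using e1) (by simpa using e2)

theorem deriv_insert_list {Q S : List ℕ} (E : List ℕ) (h : ∀ z ∈ E, Insertable Q S z) :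
    Deriv identitiesJ (Q ++ S) (Q ++ (E ++ S)) := by
  induction E with
  | nil => exact Deriv.refl _
  | cons z E ih =>
    refine (ih fun w hw => h w (List.mem_cons_of_mem _ hw)).trans ?_
    apply Insertable.deriv
    rcases h z (by simp) with ⟨h1, h2⟩ | ⟨Q₁, R, h1, h2, h3⟩
    · exact Or.inl ⟨h1, List.mem_append_right _ h2⟩
    · refine Or.inr ⟨Q₁, R, h1, h2, fun k hk => (h3 k hk).trans ?_⟩
      simp only [List.count_append]
      omega

/-- The gaps `B i` between the letters of the sublist will be the values of the letters `t_{n+i}` in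
the infinite family. -/
theorem exists_ofFn_of_sublist {l S : List ℕ} (h : l.Sublist S) :
    ∃ (B : ℕ → List ℕ) (R : List ℕ),
      S = (List.ofFn fun i : Fin l.length => B i ++ [l.get i]).flatten ++ R := by
  induction h with
  | slnil => exact ⟨fun _ => [], [], rfl⟩
  | @cons l S x h ih =>
    obtain ⟨B, R, rfl⟩ := ih
    cases l with
    | nil => exact ⟨fun _ => [], x :: R, by simp⟩
    | cons y l =>
      refine ⟨fun i => if i = 0 then x :: B 0 else B i, R, ?_⟩
      simp [List.ofFn_succ]
  | @cons_cons l S x h ih =>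
    obtain ⟨B, R, rfl⟩ := ih
    refine ⟨fun i => if i = 0 then [] else B (i - 1), R, ?_⟩
    simp [List.ofFn_succ]

/-- Both functions are sorted, and the two sorting permutations are composed. -/
theorem exists_perm_ofFn {n : ℕ} {f g : Fin n → ℕ} (h : (List.ofFn f).Perm (List.ofFn g)) :
    ∃ ρ : Equiv.Perm (Fin n), f = g ∘ ρ := by
  have hs : ∀ f : Fin n → ℕ, (List.ofFn (f ∘ Tuple.sort f)).Pairwise (· ≤ ·) := fun f => by
    rw [List.pairwise_ofFn]
    exact fun i j hij => Tuple.monotone_sort f hij.le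
  have h1 : List.ofFn (f ∘ Tuple.sort f) = List.ofFn (g ∘ Tuple.sort g) := by
    refine List.Perm.eq_of_pairwise (fun _ _ _ _ => le_antisymm) (hs f) (hs g) ?_
    exact ((Tuple.sort f).ofFn_comp_perm f).trans (h.trans ((Tuple.sort g).ofFn_comp_perm g).symm)
  refine ⟨Tuple.sort g * (Tuple.sort f)⁻¹, ?_⟩
  funext i
  simpa using congrFun (List.ofFn_injective h1) ((Tuple.sort f)⁻¹ i)

theorem prod_map_letter (l : List ℕ) : (l.map letter).prod = FreeMonoid.ofList l := by
  induction l with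
  | nil => rfl
  | cons x l ih => rw [List.map_cons, List.prod_cons, ih]; rfl

theorem deriv_pull_of_subperm {r S : List ℕ} (h : r.Subperm S) (P : List ℕ) (c : ℕ) :
    Deriv identitiesJ (P ++ c :: (r ++ c :: S)) (P ++ c :: c :: (r ++ S)) := by
  obtain ⟨l, hlr, hlS⟩ := h
  obtain ⟨B, R, rfl⟩ := exists_ofFn_of_sublist hlS
  obtain ⟨ρ, hρ⟩ : ∃ ρ : Equiv.Perm (Fin l.length), r = List.ofFn fun i => l.get (ρ i) := by
    have h1 : r = List.ofFn fun i : Fin l.length => r.get (i.cast hlr.length_eq) := by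
      rw [← List.ofFn_congr hlr.length_eq.symm, List.ofFn_get]
    obtain ⟨ρ, hρ⟩ := exists_perm_ofFn (h1 ▸ (List.ofFn_get l).symm ▸ hlr.symm)
    exact ⟨ρ, h1.trans (congrArg List.ofFn hρ)⟩
  -- The first half of the letters, with codes `1` to `2n`, is erased by `φ`, so `π` plays no role.
  -- In the second half odd codes become the letters of `l` and even codes the gaps.
  have hmem : (jLeft l.length 1 ρ, jRight l.length 1 ρ) ∈ identitiesJ := Or.inr ⟨_, _, _, rfl⟩
  set φ : Word →* Word := FreeMonoid.lift fun k => if k = 0 then letter c else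
    if k ≤ 2 * l.length then 1 else
      if k % 2 = 0 then FreeMonoid.ofList (B ((k - 2) / 2 - l.length)) else
        letter (l.getD ((k - 1) / 2 - l.length) 0) with hφ
  have h0 : φ (letter 0) = letter c := by simp [hφ]
  have hz : ∀ i : Fin l.length, φ (letter (2 * i + 1)) = 1 := fun i => by
    rw [hφ, FreeMonoid.lift_eval_of, if_neg (by omega), if_pos (by omega)]
  have ht : ∀ i : Fin l.length, φ (letter (2 * i + 2)) = 1 := fun i => by
    rw [hφ, FreeMonoid.lift_eval_of, if_neg (by omega), if_pos (by omega)]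
  have hz' : ∀ i : Fin l.length, φ (letter (2 * (l.length + i) + 1)) = letter (l.get i) := by
    intro i
    have h1 : (2 * (l.length + (i : ℕ)) + 1 - 1) / 2 - l.length = i := by omega
    rw [hφ, FreeMonoid.lift_eval_of, if_neg (by omega), if_neg (by omega), if_neg (by omega), h1]
    simp
  have ht' : ∀ i : Fin l.length, φ (letter (2 * (l.length + i) + 2)) = FreeMonoid.ofList (B i) := by
    intro i
    have h1 : (2 * (l.length + (i : ℕ)) + 2 - 2) / 2 - l.length = i := by omega
    rw [hφ, FreeMonoid.lift_eval_of, if_neg (by omega), if_neg (by omega), if_pos (by omega), h1]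
  have e1 : φ (List.ofFn fun i : Fin l.length => letter (2 * i + 1) * letter (2 * i + 2)).prod
      = 1 := by
    rw [map_list_prod, List.map_ofFn]
    apply List.prod_eq_one
    intro x hx
    rw [List.mem_ofFn] at hx
    obtain ⟨i, rfl⟩ := hx
    simp only [Function.comp, map_mul, hz, ht, mul_one]
  have e2 : φ (List.ofFn fun i : Fin l.length => letter (2 * ((1 : Equiv.Perm (Fin l.length)) i) + 1)
      * letter (2 * (l.length + ρ i) + 1)).prod = FreeMonoid.ofList r := by
    rw [map_list_prod, List.map_ofFn, hρ, ← prod_map_letter, List.map_ofFn]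
    congr 2
    funext i
    simp only [Function.comp, map_mul, hz, hz', one_mul]
  have e3 : φ (List.ofFn fun i : Fin l.length => letter (2 * (l.length + i) + 2) *
      letter (2 * (l.length + i) + 1)).prod =
      FreeMonoid.ofList (List.ofFn fun i : Fin l.length => B i ++ [l.get i]).flatten := by
    rw [map_list_prod, List.map_ofFn, FreeMonoid.ofList_flatten, List.map_ofFn]
    congr 2
    funext i
    simp only [Function.comp, map_mul, hz', ht']
    rfl
  have hd := derivCon_subst hmem φ
  simp only [jLeft, jRight, map_mul, h0, e1, e2, e3, one_mul, pow_two] at hd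
  have := (derivCon identitiesJ).mul ((derivCon identitiesJ).mul
    ((derivCon identitiesJ).refl (FreeMonoid.ofList P)) hd)
    ((derivCon identitiesJ).refl (FreeMonoid.ofList R))
  simp only [mul_assoc] at this
  exact this

theorem insertable_of_mem {X r Y S : List ℕ} {z : ℕ} (hz : z ∈ r) (h2 : 2 ≤ (X ++ r).count z)
    (h : ∀ k ∈ r ++ Y, 2 ≤ (X ++ (r ++ Y) ++ S).count k) : Insertable (X ++ (r ++ Y)) S z := by
  right
  by_cases hX : z ∈ X
  · obtain ⟨r₁, r₂, rfl⟩ := List.append_of_mem hz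
    refine ⟨X ++ r₁, r₂ ++ Y, by simp, by simp [hX], fun k hk => h k ?_⟩
    simp only [List.mem_append, List.mem_cons] at hk ⊢
    tauto
  · rw [List.count_append, List.count_eq_zero_of_not_mem hX, Nat.zero_add] at h2
    obtain ⟨r₁, r₂, r₃, rfl⟩ := exists_split_of_two_le_count h2
    refine ⟨X ++ r₁ ++ z :: r₂, r₃ ++ Y, by simp, by simp, fun k hk => h k ?_⟩
    simp only [List.mem_append, List.mem_cons] at hk ⊢
    tauto

/-- The case in which `S` contains all of `r` is `deriv_pull_of_subperm`. The general case reduces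
to it: letters of `r` that occur twice in `P ++ r` may be inserted in front of `S` in both words,
and each other letter of `r` occurs once there and already recurs in `S`. -/
theorem deriv_pull {P r S : List ℕ} {c : ℕ} (hc : c ∉ r)
    (h : ∀ k ∈ r, 2 ≤ (P ++ c :: (r ++ c :: S)).count k) :
    Deriv identitiesJ (P ++ c :: (r ++ c :: S)) (P ++ c :: c :: (r ++ S)) := by
  set E := r.filter (fun z => 2 ≤ (P ++ r).count z) with hE
  have hEr : ∀ z ∈ E, z ∈ r ∧ 2 ≤ (P ++ r).count z := fun z hz => by simpa [hE] using hz
  have e1 : Deriv identitiesJ (P ++ c :: (r ++ c :: S)) (P ++ c :: (r ++ c :: (E ++ S))) := by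
    have := deriv_insert_list (Q := (P ++ [c]) ++ (r ++ [c])) (S := S) E fun z hz => by
      refine insertable_of_mem (hEr z hz).1 ?_ ?_
      · have := (hEr z hz).2
        simp only [List.count_append] at this ⊢
        omega
      · intro k hk
        rcases List.mem_append.1 hk with hk | hk
        · simpa using h k hk
        · rw [List.mem_singleton.1 hk]
          simp
          omega
    simpa using this
  have e2 : Deriv identitiesJ (P ++ c :: c :: (r ++ S)) (P ++ c :: c :: (r ++ (E ++ S))) := by
    have := deriv_insert_list (Q := (P ++ [c, c]) ++ (r ++ [])) (S := S) E fun z hz => by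
      refine insertable_of_mem (hEr z hz).1 ?_ ?_
      · have := (hEr z hz).2
        simp only [List.count_append] at this ⊢
        omega
      · intro k hk
        have := h k (by simpa using hk)
        simp only [List.count_append, List.count_cons, List.count_nil] at this ⊢
        omega
    simpa using this
  refine e1.trans ((deriv_pull_of_subperm ?_ P c).trans e2.symm)
  rw [List.subperm_ext_iff]
  intro y hy
  by_cases hyE : 2 ≤ (P ++ r).count y
  · rw [List.count_append, hE, List.count_filter (by simpa using hyE)]
    omega
  · have h1 := h y hy
    have h2 : c ≠ y := fun e => hc (e ▸ hy)
    have h3 := List.count_pos_iff.2 hy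
    simp only [List.count_append, List.count_cons_of_ne h2] at h1 hyE ⊢
    omega

/-! ### What the language `atba⁺sb⁺` distinguishes -/

section LangJ

variable {a b t s : ℕ}

theorem langJ_iff (hab : a ≠ b) (has : a ≠ s) (hbs : b ≠ s) {w : List ℕ} :
    LangJ a b t s (a :: t :: b :: w) ↔ (∀ x ∈ w, x = a ∨ x = b ∨ x = s) ∧
      w.Pairwise (fun x y => (x = b → y = b) ∧ (y = a → x = a)) ∧
      w.count s = 1 ∧ 1 ≤ w.count a ∧ 1 ≤ w.count b := by
  constructor
  · rintro ⟨i, j, h⟩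
    obtain rfl : w = List.replicate (i + 1) a ++ s :: List.replicate (j + 1) b := by simpa using h
    simp [List.pairwise_append, List.pairwise_replicate, List.count_replicate,
      hab, hab.symm, has, has.symm, hbs, hbs.symm]
  · rintro ⟨h1, h2, h3, h4, h5⟩
    have key : ∀ w : List ℕ, (∀ x ∈ w, x = a ∨ x = b ∨ x = s) →
        w.Pairwise (fun x y => (x = b → y = b) ∧ (y = a → x = a)) →
        w = List.replicate (w.count a) a ++ (List.replicate (w.count s) s ++
          List.replicate (w.count b) b) := by
      intro w
      induction w with
      | nil => simp
      | cons x w ih =>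
        intro h1 h2
        rw [List.pairwise_cons] at h2
        have h3 := ih (fun z hz => h1 z (List.mem_cons_of_mem _ hz)) h2.2
        rcases h1 x (by simp) with rfl | rfl | rfl
        · conv_lhs => rw [h3]
          simp [hab, has, List.replicate_succ]
        · rw [List.eq_replicate_of_mem fun z hz => (h2.1 z hz).1 rfl]
          simp [List.count_replicate, hab.symm, hbs, List.replicate_succ]
        · have h4 : a ∉ w := fun h => has ((h2.1 a h).2 rfl).symm
          conv_lhs => rw [h3]
          simp [List.count_eq_zero_of_not_mem h4, has.symm, hbs.symm, List.replicate_succ]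
    obtain ⟨i, hi⟩ := Nat.exists_eq_add_of_le' h4
    obtain ⟨j, hj⟩ := Nat.exists_eq_add_of_le' h5
    have h6 := key w h1 h2
    rw [h3, hi, hj] at h6
    exact ⟨i, j, by rw [h6]; rfl⟩

theorem LangJ.prefix_eq {w : List ℕ} (h : LangJ a b t s w) : ∃ w', w = a :: t :: b :: w' := by
  obtain ⟨i, j, rfl⟩ := h
  exact ⟨_, rfl⟩

/-- The first `b` stands between the first and the second `a`. -/
theorem LangJ.mem_prefix (hab : a ≠ b) (hat : a ≠ t) {X Y : List ℕ}
    (h : LangJ a b t s (X ++ a :: Y)) (hX : a ∈ X) : b ∈ X := by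
  obtain ⟨w, hw⟩ := h.prefix_eq
  rcases X with _ | ⟨x₁, _ | ⟨x₂, _ | ⟨x₃, X⟩⟩⟩
  · simp at hX
  · simp [hat] at hw
  · simp [hab] at hw
  · simp only [List.cons_append, List.cons.injEq] at hw
    simp [hw]

/-- The last three tests yield `atbaaⁿsbaᵐ`, `atbabⁿsbᵐb` and `aⁿtbaaᵐsb`, which lie in the language
exactly if `m = 0`, `n = 0` and `n = 1`. -/
theorem separates_langJ (hab : a ≠ b) (hat : a ≠ t) (has : a ≠ s) (hbt : b ≠ t) (hbs : b ≠ s) :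
    Separates (LangJ a b t s) := by
  refine ⟨?_, ?_, ?_, ?_, ?_⟩
  · intro u v x h hx
    have h1 := h (fun k => if k = x then [t] else []) [a] [b, a, s, b]
    rw [flatMap_eq_replicate (y := x) (b := t) (by simp) (fun z _ hz => by simp [hz]),
      flatMap_eq_replicate (y := x) (b := t) (by simp) (fun z _ hz => by simp [hz]), hx] at h1
    obtain ⟨w', h2⟩ := (h1.1 ⟨0, 0, rfl⟩).prefix_eq
    rcases h3 : v.count x with _ | _ | n
    · simp [h3, hbt] at h2
    · rfl
    · simp [h3, hbt.symm, List.replicate_succ] at h2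
  · intro u v x h hx
    have h1 := h (fun k => if k = x then [a] else []) [a, t, b] [s, b]
    rw [flatMap_eq_replicate (y := x) (b := a) (by simp) (fun z _ hz => by simp [hz]),
      flatMap_eq_replicate (y := x) (b := a) (by simp) (fun z _ hz => by simp [hz])] at h1
    simp only [List.cons_append, List.nil_append, langJ_iff hab has hbs] at h1
    have h3 := (h1.1 (by
      simp [List.pairwise_append, List.pairwise_replicate, List.count_replicate,
        hab, hab.symm, has, has.symm, hbs, hbs.symm]
      exact ⟨by rintro x (h | h | h) <;> simp [h], hx⟩)).2.2.2.1
    simpa [hab.symm, has.symm] using h3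
  · intro u₁ u₂ v₁ v₂ l y h hyl h1 h2 h3 h4 hy
    have h5 := h (subst2 l [s, b] y [a]) [a, t, b, a] []
    rw [flatMap_subst2_linear h1 h2 hyl, flatMap_subst2_linear h3 h4 hyl,
      List.count_eq_zero_of_not_mem hy] at h5
    simp only [List.cons_append, List.nil_append, langJ_iff hab has hbs] at h5
    have h6 := (h5.1 (by
      simp [List.pairwise_append, List.pairwise_replicate, List.count_replicate,
        hab, hab.symm, has, has.symm, hbs, hbs.symm]
      rintro x (h | h | h) <;> simp [h])).2.1
    simp [List.pairwise_append, has.symm] at h6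
    exact List.count_eq_zero.1 (by tauto)
  · intro u₁ u₂ v₁ v₂ l y h hyl h1 h2 h3 h4 hy
    have h5 := h (subst2 l [s] y [b]) [a, t, b, a] [b]
    rw [flatMap_subst2_linear h1 h2 hyl, flatMap_subst2_linear h3 h4 hyl,
      List.count_eq_zero_of_not_mem hy] at h5
    simp only [List.cons_append, List.nil_append, langJ_iff hab has hbs] at h5
    have h6 := (h5.1 (by
      simp [List.pairwise_append, List.pairwise_replicate, List.count_replicate,
        hab, hab.symm, has, has.symm, hbs, hbs.symm]
      exact ⟨by rintro x (h | h) <;> simp [h], by rintro x (h | h) <;> simp [h, hab.symm]⟩)).2.1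
    simp [List.pairwise_append, hbs.symm] at h6
    exact List.count_eq_zero.1 (by tauto)
  · intro u₁ u₂ v₁ v₂ l y h hyl h1 h2 h3 h4 hy hy2
    have h5 := h (subst2 l [t, b, a] y [a]) [] [s, b]
    rw [flatMap_subst2_linear h1 h2 hyl, flatMap_subst2_linear h3 h4 hyl, hy] at h5
    have h6 := h5.1 (by
      refine ⟨u₂.count y, 0, ?_⟩
      simp [List.replicate_succ])
    obtain ⟨w', h7⟩ := h6.prefix_eq
    rcases h8 : v₁.count y with _ | _ | n
    · simp [h8, hat.symm] at h7
    · rfl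
    · simp [h8, List.replicate_succ, hat] at h7

/-- After `at`, sending `α`, `β`, `l` to `a`, `b`, `s` maps the first word into `atba⁺sb⁺`. In the
second word an `a` comes before any `b`, which contradicts `LangJ.mem_prefix`. -/
theorem LangJ.not_blocks (hab : a ≠ b) (hat : a ≠ t) (has : a ≠ s) (hbt : b ≠ t) (hbs : b ≠ s)
    {W₀ W₁ W₂ V₁ V₂ : List ℕ} {α β l : ℕ} (hαβ : α ≠ β)
    (h : Indist (LangJ a b t s) (W₀ ++ β :: (W₁ ++ l :: W₂)) (V₁ ++ α :: V₂))
    (hl : l ∉ W₀ ++ β :: (W₁ ++ W₂)) (hlα : l ≠ α) (hβ : β ∉ W₀ ++ W₁) (hα : α ∉ W₀ ++ W₂)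
    (hα₁ : α ∈ W₁) (hβ₂ : β ∈ W₂) (hβV : β ∉ V₁) : False := by
  simp only [List.mem_append, List.mem_cons, not_or] at hl hβ hα
  set g : ℕ → List ℕ := fun k => if k = α then [a] else if k = β then [b] else
    if k = l then [s] else [] with hg
  have gα : g α = [a] := by simp [hg]
  have gβ : g β = [b] := by simp [hg, hαβ.symm]
  have gl : g l = [s] := by simp [hg, hlα, hl.2.1]
  have e0 : W₀.flatMap g = [] := by
    rw [List.flatMap_eq_nil_iff]
    intro x hx
    simp [hg, ne_of_mem_of_not_mem hx hα.1, ne_of_mem_of_not_mem hx hβ.1,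
      ne_of_mem_of_not_mem hx hl.1]
  have e1 : W₁.flatMap g = List.replicate (W₁.count α) a :=
    flatMap_eq_replicate gα fun x hx hxα => by
      simp [hg, hxα, ne_of_mem_of_not_mem hx hβ.2, ne_of_mem_of_not_mem hx hl.2.2.1]
  have e2 : W₂.flatMap g = List.replicate (W₂.count β) b :=
    flatMap_eq_replicate gβ fun x hx hxβ => by
      simp [hg, hxβ, ne_of_mem_of_not_mem hx hα.2, ne_of_mem_of_not_mem hx hl.2.2.2]
  have h5 := (h g [a, t] []).1 (by
    simp only [List.flatMap_append, List.flatMap_cons, gβ, gl, e0, e1, e2, List.nil_append,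
      List.cons_append, List.append_nil, langJ_iff hab has hbs]
    simp [List.pairwise_append, List.pairwise_replicate, List.count_replicate,
      hab, hab.symm, has, has.symm, hbs, hbs.symm]
    exact ⟨by rintro x (h | h | h) <;> simp [h], hα₁, hβ₂⟩)
  rw [List.flatMap_append, List.flatMap_cons, gα, List.append_nil, ← List.append_assoc] at h5
  have h6 := LangJ.mem_prefix hab hat (X := [a, t] ++ V₁.flatMap g) h5 (by simp)
  simp only [List.mem_append, List.mem_cons, hab.symm, hbt, List.mem_flatMap, List.not_mem_nil,
    or_false, false_or] at h6
  obtain ⟨x, hx, hbx⟩ := h6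
  have hxβ := ne_of_mem_of_not_mem hx hβV
  simp only [hg, hxβ] at hbx
  split_ifs at hbx <;> simp_all

/-- As in `LangJ.not_blocks`, except that the initial `a` and `t` come from the first `α` and from
the linear letter `k` of the word itself. -/
theorem LangJ.not_blocks' (hab : a ≠ b) (hat : a ≠ t) (has : a ≠ s) (hbt : b ≠ t) (hbs : b ≠ s)
    {W₀ W₁ W₂ W₃ W₄ V₁ V₂ : List ℕ} {α β l k : ℕ} (hαβ : α ≠ β) (hkl : k ≠ l)
    (h : Indist (LangJ a b t s) (W₀ ++ α :: (W₁ ++ k :: (W₂ ++ β :: (W₃ ++ l :: W₄))))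
      (V₁ ++ α :: V₂))
    (hk : k ∉ α :: β :: (W₀ ++ W₁ ++ W₂ ++ W₃ ++ W₄))
    (hl : l ∉ α :: β :: (W₀ ++ W₁ ++ W₂ ++ W₃ ++ W₄))
    (hα : α ∉ W₀ ++ W₁ ++ W₂ ++ W₄) (hβ : β ∉ W₀ ++ W₁ ++ W₂ ++ W₃)
    (hα₁ : α ∈ W₃) (hβ₂ : β ∈ W₄) (hαV : α ∈ V₁) (hβV : β ∉ V₁) : False := by
  simp only [List.mem_append, List.mem_cons, not_or] at hl hβ hα hk
  set g : ℕ → List ℕ := fun x => if x = α then [a] else if x = β then [b] else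
    if x = l then [s] else if x = k then [t] else [] with hg
  have gα : g α = [a] := by simp [hg]
  have gβ : g β = [b] := by simp [hg, hαβ.symm]
  have gl : g l = [s] := by simp [hg, hl.1, hl.2.1]
  have gk : g k = [t] := by simp [hg, hk.1, hk.2.1, hkl]
  have e0 : ∀ W : List ℕ, α ∉ W → β ∉ W → l ∉ W → k ∉ W → W.flatMap g = [] := by
    intro W h1 h2 h3 h4
    rw [List.flatMap_eq_nil_iff]
    intro x hx
    simp [hg, ne_of_mem_of_not_mem hx h1, ne_of_mem_of_not_mem hx h2,
      ne_of_mem_of_not_mem hx h3, ne_of_mem_of_not_mem hx h4]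
  have e1 : W₃.flatMap g = List.replicate (W₃.count α) a :=
    flatMap_eq_replicate gα fun x hx hxα => by
      simp [hg, hxα, ne_of_mem_of_not_mem hx hβ.2, ne_of_mem_of_not_mem hx hl.2.2.1.2,
        ne_of_mem_of_not_mem hx hk.2.2.1.2]
  have e2 : W₄.flatMap g = List.replicate (W₄.count β) b :=
    flatMap_eq_replicate gβ fun x hx hxβ => by
      simp [hg, hxβ, ne_of_mem_of_not_mem hx hα.2, ne_of_mem_of_not_mem hx hl.2.2.2,
        ne_of_mem_of_not_mem hx hk.2.2.2]
  have h5 := (h g [] []).1 (by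
    simp only [List.flatMap_append, List.flatMap_cons, gα, gβ, gl, gk, e1, e2,
      e0 W₀ (by tauto) (by tauto) (by tauto) (by tauto),
      e0 W₁ (by tauto) (by tauto) (by tauto) (by tauto),
      e0 W₂ (by tauto) (by tauto) (by tauto) (by tauto), List.nil_append,
      List.cons_append, List.append_nil, langJ_iff hab has hbs]
    simp [List.pairwise_append, List.pairwise_replicate, List.count_replicate,
      hab, hab.symm, has, has.symm, hbs, hbs.symm]
    exact ⟨by rintro x (h | h | h) <;> simp [h], hα₁, hβ₂⟩)
  rw [List.flatMap_append, List.flatMap_cons, gα, List.append_nil, List.nil_append] at h5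
  have h6 := LangJ.mem_prefix hab hat h5 (List.mem_flatMap.2 ⟨α, hαV, by simp [gα]⟩)
  obtain ⟨x, hx, hbx⟩ := List.mem_flatMap.1 h6
  have hxβ := ne_of_mem_of_not_mem hx hβV
  simp only [hg, hxβ] at hbx
  split_ifs at hbx <;> simp_all

end LangJ

/-! ### Swaps in `J` and the invariant of the sorting procedure -/

theorem exists_last_split {x : ℕ} {l : List ℕ} (h : x ∈ l) :
    ∃ l₁ l₂, l = l₁ ++ x :: l₂ ∧ x ∉ l₂ := by
  obtain ⟨l₁, l₂, h1, h2⟩ := List.eq_append_cons_of_mem (List.mem_reverse.2 h)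
  exact ⟨l₂.reverse, l₁.reverse, by simpa using congrArg List.reverse h1, by simpa using h2⟩

theorem append_singleton_eq_split {p p₁ p₂ : List ℕ} {c y : ℕ} (h : p ++ [c] = p₁ ++ y :: p₂) :
    (p₂ = [] ∧ c = y ∧ p = p₁) ∨ ∃ p₃, p₂ = p₃ ++ [c] ∧ p = p₁ ++ y :: p₃ := by
  rcases List.eq_nil_or_concat p₂ with rfl | ⟨p₃, d, rfl⟩
  · obtain ⟨h1, h2⟩ := List.append_inj' h rfl
    exact Or.inl ⟨rfl, by simpa using h2, h1⟩
  · rw [List.concat_eq_append] at h ⊢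
    rw [← List.cons_append, ← List.append_assoc] at h
    obtain ⟨h1, h2⟩ := List.append_inj' h rfl
    obtain rfl : c = d := by simpa using h2
    exact Or.inr ⟨p₃, rfl, h1⟩

/-- A copy of `x` is placed in front of a later `y`, the swap is made with `xyzxy ≈ yxzxy`, and the
copy is removed. -/
theorem deriv_swap_of_insertable {A B₁ B₂ : List ℕ} {x y : ℕ}
    (h₁ : Insertable (A ++ x :: y :: B₁) (y :: B₂) x)
    (h₂ : Insertable (A ++ y :: x :: B₁) (y :: B₂) x) :
    Deriv identitiesJ (A ++ x :: y :: (B₁ ++ y :: B₂)) (A ++ y :: x :: (B₁ ++ y :: B₂)) := by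
  have e1 := h₁.deriv
  have e2 := h₂.deriv
  have e3 := deriv_swap_of_later A B₁ B₂ x y
  simp only [List.append_assoc, List.cons_append] at e1 e2
  exact e1.trans (e3.trans e2.symm)

/-- Two adjacent letters may be swapped unless a linear letter separates the remaining
occurrences of the two letters. -/
theorem deriv_swap_or_separated {A B B₁ B₂ : List ℕ} {x y : ℕ} (hB : B = B₁ ++ y :: B₂)
    (hy : y ∉ B₁) (hxy : x ≠ y) (hx : (A ++ B).count x = 2) (hA : A.count x ≤ 1)
    (hAB : 1 ≤ A.count x + B₁.count x) :
    Deriv identitiesJ (A ++ x :: y :: B) (A ++ y :: x :: B) ∨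
      ∃ l D₁ D₂, B = D₁ ++ l :: D₂ ∧ (A ++ x :: y :: B).count l ≤ 1 ∧ x ∉ D₂ ∧ y ∉ D₁ := by
  subst hB
  by_cases hx₂ : x ∈ B₂
  · left
    refine deriv_swap_of_insertable (Or.inl ⟨?_, by simp [hx₂]⟩) (Or.inl ⟨?_, by simp [hx₂]⟩)
    all_goals
      simp only [List.count_append, List.count_cons_self, List.count_cons_of_ne hxy.symm]
      omega
  · have hx₂' := List.count_eq_zero_of_not_mem hx₂
    simp only [List.count_append, List.count_cons_of_ne hxy.symm] at hx
    obtain ⟨D₁, D₂, rfl, hD⟩ :=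
      exists_last_split (List.count_pos_iff.1 (by omega : 0 < B₁.count x))
    -- The last `x` can be doubled and moved up to the next `y` unless a linear letter blocks the
    -- way; that letter is then the separating one.
    by_cases hR : ∀ k ∈ D₂, 2 ≤ (A ++ x :: y :: (D₁ ++ x :: D₂ ++ y :: B₂)).count k
    · left
      refine deriv_swap_of_insertable (Or.inr ⟨A ++ x :: y :: D₁, D₂, by simp, by simp, ?_⟩)
        (Or.inr ⟨A ++ y :: x :: D₁, D₂, by simp, by simp, ?_⟩)
      all_goals
        intro k hk
        have := hR k hk
        simp only [List.count_append, List.count_cons] at this ⊢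
        omega
    · right
      push Not at hR
      obtain ⟨l, hl, hl2⟩ := hR
      obtain ⟨D₃, D₄, rfl⟩ := List.append_of_mem hl
      refine ⟨l, D₁ ++ x :: D₃, D₄ ++ y :: B₂, by simp, by omega, ?_, ?_⟩
      · simp only [List.mem_append, List.mem_cons, not_or] at hD ⊢
        exact ⟨hD.2.2, hxy, hx₂⟩
      · simp only [List.mem_append, List.mem_cons, not_or] at hy ⊢
        exact ⟨hy.1, hy.2.1, hy.2.2.1⟩

/-- Each letter that occurs exactly once in `p` is separated by a linear letter from its first
occurrence in `q`. -/
def Spread (p q : List ℕ) : Prop :=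
  ∀ y p₁ p₂ q₁ q₂, p = p₁ ++ y :: p₂ → q = q₁ ++ y :: q₂ → y ∉ p₁ → y ∉ p₂ → y ∉ q₁ →
    ∃ k ∈ p₂ ++ q₁, (p ++ q).count k = 1

/-! ### Separated pairs contradict indistinguishability -/

section Complete

variable {a b t s : ℕ}

/-- Counting before `l` shows that in the target all `y` and just one `c` precede `l`. If `y ∉ p`,
the target has the form in `LangJ.not_blocks`. If `y ∈ p`, the invariant `Spread` gives a linear `k`
between the first two `y`: inside `p` it leads to `LangJ.not_blocks'`, and after `c` it contradicts
the counts before `k`. -/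
theorem not_separated_left (hab : a ≠ b) (hat : a ≠ t) (has : a ≠ s) (hbt : b ≠ t) (hbs : b ≠ s)
    {p V A D₁ D₂ r : List ℕ} {y c l : ℕ} (hpV : Spread p (c :: V)) (hv : Reduced (p ++ c :: V))
    (hA : A = p ++ r) (hyc : y ≠ c) (hu : Reduced (A ++ y :: c :: (D₁ ++ l :: D₂)))
    (h : Indist (LangJ a b t s) (A ++ y :: c :: (D₁ ++ l :: D₂)) (p ++ c :: V))
    (hy3 : (A ++ y :: c :: (D₁ ++ l :: D₂)).count y = 3)
    (hc3 : (A ++ y :: c :: (D₁ ++ l :: D₂)).count c = 3)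
    (hl : (A ++ y :: c :: (D₁ ++ l :: D₂)).count l ≤ 1) (hyD : y ∉ D₂) (hcD : c ∉ D₁)
    (hcA : c ∉ A) (hyA : A.count y ≤ 1) : False := by
  have hsep := separates_langJ hab hat has hbt hbs
  have hyv := hsep.count_eq h hu hv y
  have hcv := hsep.count_eq h hu hv c
  have hy3' := hy3
  have hc3' := hc3
  have hl1 : (A ++ y :: c :: (D₁ ++ l :: D₂)).count l = 1 := by
    have : 0 < (A ++ y :: c :: (D₁ ++ l :: D₂)).count l := List.count_pos_iff.2 (by simp)
    omega
  have hly : l ≠ y := by rintro rfl; omega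
  have hlc : l ≠ c := by rintro rfl; omega
  have hlv := hsep.count_eq h hu hv l
  rw [hy3] at hyv
  rw [hc3] at hcv
  rw [hl1] at hlv
  have hl1' := hl1
  simp only [hA, List.count_append, List.count_cons_self, List.count_cons_of_ne hlc.symm,
    List.count_cons_of_ne hly.symm] at hl1' hlv
  obtain ⟨W₁, W₂, rfl⟩ := List.append_of_mem (List.count_pos_iff.1 (by omega : 0 < V.count l))
  have h1 : Indist (LangJ a b t s) ((A ++ y :: c :: D₁) ++ l :: D₂)
      ((p ++ c :: W₁) ++ l :: W₂) := by simpa using h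
  have hpre := hsep.count_prefix_eq h1 (by simpa using hu) (by simpa using hv) (by simpa using hl1)
  have hprey := hpre y
  have hprec := hpre c
  have hyD' := List.count_eq_zero_of_not_mem hyD
  have hcD' := List.count_eq_zero_of_not_mem hcD
  have hcA' := List.count_eq_zero_of_not_mem hcA
  simp only [List.count_append, List.count_cons_self, List.count_cons_of_ne hyc,
    List.count_cons_of_ne hyc.symm, List.count_cons_of_ne hly, List.count_cons_of_ne hlc]
    at hprey hprec hy3 hc3 hyv hcv hlv
  have hcp : c ∉ p := List.count_eq_zero.1 (by omega)
  have hcW₁ : c ∉ W₁ := List.count_eq_zero.1 (by omega)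
  have hyW₂ : y ∉ W₂ := List.count_eq_zero.1 (by omega)
  have hcW₂ : c ∈ W₂ := List.count_pos_iff.1 (by omega)
  have hlp : l ∉ p := List.count_eq_zero.1 (by omega)
  have hlW₁ : l ∉ W₁ := List.count_eq_zero.1 (by omega)
  have hlW₂ : l ∉ W₂ := List.count_eq_zero.1 (by omega)
  have hpA : p.count y ≤ A.count y := by rw [hA, List.count_append]; omega
  have hyW₁ : y ∈ W₁ := List.count_pos_iff.1 (by omega)
  by_cases hyp : y ∈ p
  · obtain ⟨p₁, p₂, rfl⟩ := List.append_of_mem hyp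
    simp only [List.count_append, List.count_cons_self] at hpA
    simp only [List.mem_append, List.mem_cons, not_or] at hcp hlp
    have hyp₁ : y ∉ p₁ := List.count_eq_zero.1 (by omega)
    have hyp₂ : y ∉ p₂ := List.count_eq_zero.1 (by omega)
    obtain ⟨X, Y, rfl, hyX⟩ := List.eq_append_cons_of_mem hyW₁
    simp only [List.mem_append, List.mem_cons, not_or] at hcW₁ hlW₁
    obtain ⟨k, hk, hk1⟩ := hpV y p₁ p₂ (c :: X) (Y ++ l :: W₂) rfl (by simp) hyp₁ hyp₂
      (by simp [hyc, hyX])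
    have hku := (hsep.count_eq h hu hv k).trans hk1
    have hky : k ≠ y := by rintro rfl; omega
    have hkc : k ≠ c := by rintro rfl; omega
    rcases List.mem_append.1 hk with hk | hk
    · obtain ⟨p₃, p₄, rfl⟩ := List.append_of_mem hk
      have hkl : k ≠ l := by rintro rfl; simp at hlp
      simp only [List.mem_append, List.mem_cons, not_or] at hcp hlp hyp₂
      simp only [List.count_append, List.count_cons_self, List.count_cons_of_ne hky.symm,
        List.count_cons_of_ne hkc.symm, List.count_cons_of_ne hkl.symm] at hk1
      refine LangJ.not_blocks' hab hat has hbt hbs (W₀ := p₁) (W₁ := p₃) (W₂ := p₄)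
        (W₃ := X ++ y :: Y) (W₄ := W₂) (V₁ := A) (V₂ := c :: (D₁ ++ l :: D₂)) (α := y) (β := c)
        (l := l) (k := k) hyc hkl (by simpa using h.symm) ?_ ?_ ?_ ?_ (by simp) hcW₂ ?_ hcA
      · rw [← List.count_eq_zero]
        simp only [List.count_append, List.count_cons_of_ne hky.symm,
          List.count_cons_of_ne hkc.symm]
        omega
      · simp only [List.mem_append, List.mem_cons, not_or]
        tauto
      · simp only [List.mem_append, not_or]
        tauto
      · simp only [List.mem_append, List.mem_cons, not_or]
        tauto
      · simp [hA]
    · obtain ⟨X₁, X₂, rfl⟩ := List.append_of_mem ((List.mem_cons.1 hk).resolve_left hkc)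
      have hkA : k ∉ p₁ ++ y :: p₂ := by
        rw [← List.count_eq_zero]
        simp only [List.count_append, List.count_cons_self, List.count_cons_of_ne hky.symm,
          List.count_cons_of_ne hkc.symm] at hk1 ⊢
        omega
      have hkmem : k ∈ A ++ y :: c :: (D₁ ++ l :: D₂) := List.count_pos_iff.1 (by omega)
      simp only [List.mem_append, not_or] at hyX hcW₁
      have hyX₁ := List.count_eq_zero_of_not_mem hyX.1
      have hcX₁ := List.count_eq_zero_of_not_mem hcW₁.1.1
      -- In the target exactly one `c` and one `y` precede `k`. In the other word there is no `c`
      -- before `k` if `k` lies in `A`, and there are at least two `y` before it otherwise.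
      rcases List.mem_append.1 hkmem with hkA | hkB
      · obtain ⟨A₁, A₂, hA'⟩ := List.append_of_mem hkA
        rw [hA'] at h hu hku hcA
        have h2 : Indist (LangJ a b t s) (A₁ ++ k :: (A₂ ++ y :: c :: (D₁ ++ l :: D₂)))
            ((p₁ ++ y :: p₂ ++ c :: X₁) ++ k :: (X₂ ++ y :: Y ++ l :: W₂)) := by simpa using h
        have h3 := hsep.count_prefix_eq h2 (by simpa using hu) (by simpa using hv)
          (by simpa using hku) c
        simp only [List.mem_append, not_or] at hcA
        rw [List.count_eq_zero_of_not_mem hcA.1, List.count_append, List.count_cons_self] at h3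
        omega
      · simp only [List.mem_cons, hky, hkc, false_or] at hkB
        obtain ⟨B₁, B₂, hB⟩ := List.append_of_mem hkB
        rw [hB] at h hu hku
        have h2 : Indist (LangJ a b t s) ((A ++ y :: c :: B₁) ++ k :: B₂)
            ((p₁ ++ y :: p₂ ++ c :: X₁) ++ k :: (X₂ ++ y :: Y ++ l :: W₂)) := by simpa using h
        have h3 := hsep.count_prefix_eq h2 (by simpa using hu) (by simpa using hv)
          (by simpa using hku) y
        simp only [List.count_append, List.count_cons_self, List.count_cons_of_ne hyc.symm] at h3
        omega
  · refine LangJ.not_blocks hab hat has hbt hbs (W₀ := p) (W₁ := W₁) (W₂ := W₂) (V₁ := A)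
      (V₂ := c :: (D₁ ++ l :: D₂)) (α := y) (β := c) (l := l) hyc h.symm ?_ hly ?_ ?_ hyW₁ hcW₂ hcA
    · simp [hlp, hlc, hlW₁, hlW₂]
    · simp [hcp, hcW₁]
    · simp [hyp, hyW₂]

/-- Here the word being sorted has the block form, with `c` mapped to `a` and `y` to `b`. If `c`
occurs in `p`, the invariant `Spread`, applied to the next letter `c` of the target, supplies the
linear letter that becomes `t`. -/
theorem not_separated_right (hab : a ≠ b) (hat : a ≠ t) (has : a ≠ s) (hbt : b ≠ t) (hbs : b ≠ s)
    {p V D₁ D₂ r : List ℕ} {y c l : ℕ} (hpV : Spread p (c :: V)) (hv : Reduced (p ++ c :: V))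
    (hyc : y ≠ c) (hcr : c ∉ r) (hu : Reduced (p ++ r ++ y :: c :: (D₁ ++ l :: D₂)))
    (h : Indist (LangJ a b t s) (p ++ r ++ y :: c :: (D₁ ++ l :: D₂)) (p ++ c :: V))
    (hy3 : (p ++ r ++ y :: c :: (D₁ ++ l :: D₂)).count y = 3)
    (hc3 : (p ++ r ++ y :: c :: (D₁ ++ l :: D₂)).count c = 3)
    (hl : (p ++ r ++ y :: c :: (D₁ ++ l :: D₂)).count l ≤ 1) (hcD : c ∉ D₂) (hyD : y ∉ D₁)
    (hyA : y ∉ p ++ r) (hcA : (p ++ r).count c ≤ 1) : False := by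
  have hsep := separates_langJ hab hat has hbt hbs
  have hly : l ≠ y := by rintro rfl; omega
  have hlc : l ≠ c := by rintro rfl; omega
  have hyA' := List.count_eq_zero_of_not_mem hyA
  have hyD' := List.count_eq_zero_of_not_mem hyD
  have hl1 := hl
  simp only [List.count_append, List.count_cons_self, List.count_cons_of_ne hlc.symm,
    List.count_cons_of_ne hly.symm] at hl1
  have hlp : l ∉ p := List.count_eq_zero.1 (by omega)
  have hlr : l ∉ r := List.count_eq_zero.1 (by omega)
  have hlD₁ : l ∉ D₁ := List.count_eq_zero.1 (by omega)
  have hlD₂ : l ∉ D₂ := List.count_eq_zero.1 (by omega)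
  have hyD₂ : y ∈ D₂ := by
    rw [List.count_append, hyA', List.count_cons_self, List.count_cons_of_ne hyc.symm,
      List.count_append, hyD', List.count_cons_of_ne hly] at hy3
    exact List.count_pos_iff.1 (by omega)
  simp only [List.mem_append, not_or] at hyA
  by_cases hcp : c ∈ p
  · obtain ⟨p₁, p₂, rfl⟩ := List.append_of_mem hcp
    simp only [List.count_append, List.count_cons_self] at hcA
    have hcp₁ : c ∉ p₁ := List.count_eq_zero.1 (by omega)
    have hcp₂ : c ∉ p₂ := List.count_eq_zero.1 (by omega)
    obtain ⟨k, hk, hk1⟩ := hpV c p₁ p₂ [] V rfl rfl hcp₁ hcp₂ (by simp)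
    rw [List.append_nil] at hk
    have hku := (hsep.count_eq h hu hv k).trans hk1
    have hkc : k ≠ c := ne_of_mem_of_not_mem hk hcp₂
    have hky : k ≠ y := by rintro rfl; omega
    have hkl : k ≠ l := by
      rintro rfl
      simp [hk] at hlp
    obtain ⟨p₃, p₄, rfl⟩ := List.append_of_mem hk
    simp only [List.mem_append, List.mem_cons, not_or] at hcp₂ hlp hyA
    simp only [List.count_append, List.count_cons_self, List.count_cons_of_ne hky.symm,
      List.count_cons_of_ne hkc.symm, List.count_cons_of_ne hkl.symm] at hku
    refine LangJ.not_blocks' hab hat has hbt hbs (W₀ := p₁) (W₁ := p₃) (W₂ := p₄ ++ r)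
      (W₃ := c :: D₁) (W₄ := D₂) (V₁ := p₁ ++ c :: (p₃ ++ k :: p₄)) (V₂ := V) (α := c) (β := y)
      (l := l) (k := k) hyc.symm hkl (by simpa using h) ?_ ?_ ?_ ?_ (by simp) hyD₂ (by simp) ?_
    · rw [← List.count_eq_zero]
      simp only [List.count_append, List.count_cons_of_ne hky.symm,
        List.count_cons_of_ne hkc.symm]
      omega
    · simp only [List.mem_append, List.mem_cons, not_or]
      tauto
    · simp only [List.mem_append, not_or]
      tauto
    · simp only [List.mem_append, List.mem_cons, not_or]
      tauto
    · simp only [List.mem_append, List.mem_cons, not_or]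
      tauto
  · refine LangJ.not_blocks hab hat has hbt hbs (W₀ := p ++ r) (W₁ := c :: D₁) (W₂ := D₂)
      (V₁ := p) (V₂ := V) (α := c) (β := y) (l := l) hyc.symm (by simpa using h) ?_ hlc ?_ ?_
      (by simp) hyD₂ hyA.1
    · simp [hlp, hlr, hly, hlc, hlD₁, hlD₂]
    · simp [hyA, hyc, hyD]
    · simp [hcp, hcr, hcD]

end Complete

/-! ### Sorting words by means of the identities of `J` -/

section Complete

variable {a b t s : ℕ}

/-- Both letters occur three times. The swap is immediate if both occur earlier, or if one has
occurred twice and the other occurs later. Otherwise `deriv_swap_or_separated` applies, and its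
second alternative is impossible. -/
theorem deriv_step_J (hab : a ≠ b) (hat : a ≠ t) (has : a ≠ s) (hbt : b ≠ t) (hbs : b ≠ s)
    {p V : List ℕ} {c : ℕ} (hpV : Spread p (c :: V)) (hv : Reduced (p ++ c :: V))
    {r : List ℕ} {y : ℕ} {B : List ℕ} (hc : c ∉ r) (hyc : y ≠ c)
    (hu : Reduced (p ++ r ++ y :: c :: B))
    (h : Indist (LangJ a b t s) (p ++ r ++ y :: c :: B) (p ++ c :: V)) :
    Deriv identitiesJ (p ++ r ++ y :: c :: B) (p ++ r ++ c :: y :: B) := by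
  have hsep := separates_langJ hab hat has hbt hbs
  obtain ⟨hy3, hc3⟩ := hsep.count_eq_three hyc hc h hu hv
  have hyAB : (p ++ r ++ B).count y = 2 := by
    simp only [List.count_append, List.count_cons_self, List.count_cons_of_ne hyc.symm] at hy3 ⊢
    omega
  have hcAB : (p ++ r ++ B).count c = 2 := by
    simp only [List.count_append, List.count_cons_self, List.count_cons_of_ne hyc] at hc3 ⊢
    omega
  have hyAB' := hyAB
  have hcAB' := hcAB
  rw [List.count_append] at hyAB' hcAB'
  have left : ∀ B₁ B₂, B = B₁ ++ c :: B₂ → c ∉ B₁ → c ∉ p ++ r → (p ++ r).count y ≤ 1 →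
      1 ≤ (p ++ r).count y + B₁.count y →
      Deriv identitiesJ (p ++ r ++ y :: c :: B) (p ++ r ++ c :: y :: B) := by
    intro B₁ B₂ hB hcB₁ hcA hyA hyAB₁
    refine (deriv_swap_or_separated hB hcB₁ hyc hyAB hyA hyAB₁).resolve_right ?_
    rintro ⟨l, D₁, D₂, rfl, hl, hyD, hcD⟩
    exact not_separated_left hab hat has hbt hbs hpV hv rfl hyc hu h hy3 hc3 hl hyD hcD hcA hyA
  have right : ∀ B₁ B₂, B = B₁ ++ y :: B₂ → y ∉ B₁ → y ∉ p ++ r → (p ++ r).count c ≤ 1 →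
      1 ≤ (p ++ r).count c + B₁.count c →
      Deriv identitiesJ (p ++ r ++ y :: c :: B) (p ++ r ++ c :: y :: B) := by
    intro B₁ B₂ hB hyB₁ hyA hcA hcAB₁
    refine ((deriv_swap_or_separated hB hyB₁ hyc.symm hcAB hcA hcAB₁).resolve_right ?_).symm
    rintro ⟨l, D₁, D₂, rfl, hl, hcD, hyD⟩
    refine not_separated_right hab hat has hbt hbs hpV hv hyc hc hu h hy3 hc3 ?_ hcD hyD hyA hcA
    rwa [((List.Perm.swap y c (D₁ ++ l :: D₂)).append_left (p ++ r)).count_eq] at hl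
  by_cases hyA : y ∈ p ++ r
  · have hyA' := List.count_pos_iff.2 hyA
    by_cases hcA : c ∈ p ++ r
    · exact deriv_swap_of_mem hyA hcA hyc B
    · have hcA' := List.count_eq_zero_of_not_mem hcA
      have hcB : c ∈ B := List.count_pos_iff.1 (by omega)
      by_cases hy2 : 2 ≤ (p ++ r).count y
      · exact deriv_swap_third hy2 hcB
      · obtain ⟨B₁, B₂, hB, hcB₁⟩ := List.eq_append_cons_of_mem hcB
        exact left B₁ B₂ hB hcB₁ hcA (by omega) (by omega)
  · have hyA' := List.count_eq_zero_of_not_mem hyA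
    have hyB : y ∈ B := List.count_pos_iff.1 (by omega)
    by_cases hcA : c ∈ p ++ r
    · have hcA' := List.count_pos_iff.2 hcA
      by_cases hc2 : 2 ≤ (p ++ r).count c
      · exact (deriv_swap_third hc2 hyB).symm
      · obtain ⟨B₁, B₂, hB, hyB₁⟩ := List.eq_append_cons_of_mem hyB
        exact right B₁ B₂ hB hyB₁ hyA (by omega) (by omega)
    · have hcA' := List.count_eq_zero_of_not_mem hcA
      have hcB : c ∈ B := List.count_pos_iff.1 (by omega)
      obtain ⟨B₁, B₂, hB, hcB₁⟩ := List.eq_append_cons_of_mem hcB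
      -- Neither letter has occurred before; whichever recurs first is the one to be copied in front
      -- of the other.
      by_cases hyB₁ : y ∈ B₁
      · have := List.count_pos_iff.2 hyB₁
        exact left B₁ B₂ hB hcB₁ hcA (by omega) (by omega)
      · obtain ⟨B₃, B₄, rfl, hyB₃⟩ := List.eq_append_cons_of_mem
          (show y ∈ B₂ by simpa [hB, hyB₁, hyc] using hyB)
        exact right (B₁ ++ c :: B₃) B₄ (by simp [hB]) (by simp [hyB₁, hyB₃, hyc]) hyA (by omega)
          (by simp; omega)

theorem prefix_eq_of_append_cons_eq {y : ℕ} {X₁ X₂ Y₁ Y₂ : List ℕ} (h₁ : y ∉ X₁) (h₂ : y ∉ X₂)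
    (h : X₁ ++ y :: Y₁ = X₂ ++ y :: Y₂) : X₁ = X₂ := by
  induction X₁ generalizing X₂ with
  | nil =>
    rcases X₂ with _ | ⟨x, X₂⟩
    · rfl
    · simp_all
  | cons x X₁ ih =>
    rcases X₂ with _ | ⟨z, X₂⟩
    · simp_all
    · simp only [List.mem_cons, not_or, List.cons_append, List.cons.injEq] at h₁ h₂ h
      rw [h.1, ih h₁.2 h₂.2 h.2]

/-- After the pull `c` occurs at least twice in the prefix and is exempt. For any other letter, only
nonlinear letters `c` were moved, so its separating linear letter is still in place. -/
theorem Spread.pull {p q₁ q₂ : List ℕ} {c : ℕ} (h : Spread p (c :: (q₁ ++ c :: q₂))) :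
    Spread (p ++ [c, c]) (q₁ ++ q₂) := by
  have hcount : ∀ k, (p ++ [c, c] ++ (q₁ ++ q₂)).count k =
      (p ++ c :: (q₁ ++ c :: q₂)).count k := by
    intro k
    simp only [List.count_append, List.count_cons, List.count_nil]
    omega
  intro y p₁ p₂ s₁ s₂ hp hs hp₁ hp₂ hs₁
  rw [← List.singleton_append, ← List.append_assoc] at hp
  rcases append_singleton_eq_split hp with ⟨-, rfl, rfl⟩ | ⟨p₃, rfl, hp'⟩
  · simp at hp₁
  rcases append_singleton_eq_split hp' with ⟨rfl, rfl, rfl⟩ | ⟨p₄, rfl, rfl⟩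
  · simp at hp₂
  simp only [List.mem_append, List.mem_singleton, not_or] at hp₂
  by_cases hy : y ∈ q₁
  · obtain ⟨X, Y, rfl, hyX⟩ := List.eq_append_cons_of_mem hy
    obtain ⟨k, hk, hk1⟩ := h y p₁ p₄ (c :: X) (Y ++ c :: q₂) rfl (by simp) hp₁ hp₂.1.1
      (by simp [hyX, hp₂])
    have hX : X = s₁ := by
      rw [List.append_assoc, List.cons_append] at hs
      exact prefix_eq_of_append_cons_eq hyX hs₁ hs
    refine ⟨k, ?_, (hcount k).trans hk1⟩
    rw [← hX]
    simp only [List.mem_append, List.mem_cons] at hk ⊢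
    tauto
  · have hy₂ : y ∈ q₂ := by
      have : y ∈ q₁ ++ q₂ := by simp [hs]
      exact (List.mem_append.1 this).resolve_left hy
    obtain ⟨X, Y, rfl, hyX⟩ := List.eq_append_cons_of_mem hy₂
    obtain ⟨k, hk, hk1⟩ := h y p₁ p₄ (c :: (q₁ ++ c :: X)) Y rfl (by simp) hp₁ hp₂.1.1
      (by simp [hyX, hp₂, hy])
    have hX : q₁ ++ X = s₁ := by
      rw [← List.append_assoc] at hs
      exact prefix_eq_of_append_cons_eq (by simp [hy, hyX]) hs₁ hs
    refine ⟨k, ?_, (hcount k).trans hk1⟩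
    rw [← hX]
    simp only [List.mem_append, List.mem_cons] at hk ⊢
    tauto

/-- If the first letter `c` of `c :: V` cannot be appended to `p`, then it is new and no linear
letter precedes its next occurrence. -/
theorem Spread.snoc_or {p V : List ℕ} {c : ℕ} (h : Spread p (c :: V)) :
    Spread (p ++ [c]) V ∨ c ∉ p ∧ ∃ q₁ q₂, V = q₁ ++ c :: q₂ ∧ c ∉ q₁ ∧
      ∀ k ∈ q₁, (p ++ c :: V).count k ≠ 1 := by
  by_cases hS : Spread (p ++ [c]) V
  · exact Or.inl hS
  right
  unfold Spread at hS
  push Not at hS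
  obtain ⟨y, p₁, p₂, q₁, q₂, hp, rfl, hp₁, hp₂, hq₁, hk⟩ := hS
  rcases append_singleton_eq_split hp with ⟨rfl, rfl, rfl⟩ | ⟨p₃, rfl, rfl⟩
  · exact ⟨hp₁, q₁, q₂, rfl, hq₁, fun k hkq => by simpa using hk k (by simpa using hkq)⟩
  · simp only [List.mem_append, List.mem_singleton, not_or] at hp₂
    obtain ⟨k, hk1, hk2⟩ := h y p₁ p₃ (c :: q₁) q₂ rfl rfl hp₁ hp₂.1 (by simp [hp₂, hq₁])
    refine absurd (by simpa using hk2) (hk k ?_)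
    simp only [List.mem_append, List.mem_cons] at hk1 ⊢
    tauto

theorem Reduced.two_le_count {u : List ℕ} (hu : Reduced u) {k : ℕ} (hk : k ∈ u)
    (h : u.count k ≠ 1) : 2 ≤ u.count k := by
  have := hu k hk
  omega

/-- Induction on the unsorted rest of the target. Once `c` has been moved into place, either it
extends the prefix and `Spread` persists, or its second occurrence is pulled next to it in both
words and the prefix grows by two letters; hence the strong induction. -/
theorem deriv_of_indist_J (hab : a ≠ b) (hat : a ≠ t) (has : a ≠ s) (hbt : b ≠ t) (hbs : b ≠ s)
    (hSL : ∀ {u v}, Deriv identitiesJ u v → Indist (LangJ a b t s) u v) (n : ℕ) :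
    ∀ v p u : List ℕ, v.length = n → Spread p v → Reduced (p ++ u) → Reduced (p ++ v) →
      Indist (LangJ a b t s) (p ++ u) (p ++ v) → Deriv identitiesJ (p ++ u) (p ++ v) := by
  have hsep := separates_langJ hab hat has hbt hbs
  induction n using Nat.strong_induction_on with
  | _ n ih =>
    intro v p u hn hS hu hv h
    have hperm : (p ++ u).Perm (p ++ v) := List.perm_iff_count.2 (hsep.count_eq h hu hv)
    rcases v with _ | ⟨c, V⟩
    · have : u = [] := List.perm_nil.1 ((List.perm_append_left_iff p).1 hperm)
      rw [this]
      exact Deriv.refl _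
    have hcu : c ∈ u := ((List.perm_append_left_iff p).1 hperm).mem_iff.2 (by simp)
    obtain ⟨r, B, rfl, hcr⟩ := List.eq_append_cons_of_mem hcu
    have h1 := deriv_move_left hSL (fun r y B h1 h2 h3 h4 =>
      deriv_step_J hab hat has hbt hbs hS hv h1 h2 h3 h4) r B hcr hu h
    have hu₁ : Reduced (p ++ c :: (r ++ B)) :=
      hu.of_perm (List.Perm.append_left p List.perm_middle)
    have hI₁ := (hSL h1).symm.trans h
    refine h1.trans ?_
    rcases hS.snoc_or with hS' | ⟨hcp, q₁, q₂, rfl, hcq₁, hq₁⟩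
    · simpa using ih V.length (by simp at hn; omega) V (p ++ [c]) (r ++ B) rfl hS'
        (by simpa using hu₁) (by simpa using hv) (by simpa using hI₁)
    have hcount := hsep.count_eq hI₁ hu₁ hv
    have hcB : c ∈ r ++ B := by
      have := hcount c
      simp only [List.count_append, List.count_cons_self] at this
      exact List.count_pos_iff.1 (by rw [List.count_append]; omega)
    obtain ⟨r₂, s₂, hrB, hcr₂⟩ := List.eq_append_cons_of_mem hcB
    rw [hrB] at hu₁ hI₁ hcount ⊢
    have e1 : Deriv identitiesJ (p ++ c :: (r₂ ++ c :: s₂)) (p ++ c :: c :: (r₂ ++ s₂)) := by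
      -- A linear letter between the first two `c` of the word being sorted would have fewer letters
      -- `c` before it than in the target, where it can only come after the second `c`.
      refine deriv_pull hcr₂ fun k hk => hu₁.two_le_count (by simp [hk]) fun hk1 => ?_
      have hkc : k ≠ c := ne_of_mem_of_not_mem hk hcr₂
      have hkv := (hcount k).symm.trans hk1
      obtain ⟨r₃, r₄, rfl⟩ := List.append_of_mem hk
      have hkq₁ : k ∉ q₁ := fun hk' => hq₁ k hk' hkv
      simp only [List.mem_append, List.mem_cons, not_or] at hcr₂
      have hk1' := hk1
      have hkv' := hkv
      simp only [List.count_append, List.count_cons_self, List.count_cons_of_ne hkc.symm,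
        List.count_eq_zero_of_not_mem hkq₁] at hk1' hkv'
      obtain ⟨X, Y, rfl⟩ := List.append_of_mem (List.count_pos_iff.1 (by omega : 0 < q₂.count k))
      have h2 : Indist (LangJ a b t s) ((p ++ c :: r₃) ++ k :: (r₄ ++ c :: s₂))
          ((p ++ c :: (q₁ ++ c :: X)) ++ k :: Y) := by simpa using hI₁
      have h3 := hsep.count_prefix_eq h2 (by simpa using hu₁) (by simpa using hv)
        (by simpa using hk1) c
      simp only [List.count_append, List.count_cons_self,
        List.count_eq_zero_of_not_mem hcr₂.1] at h3
      omega
    have e2 : Deriv identitiesJ (p ++ c :: (q₁ ++ c :: q₂)) (p ++ c :: c :: (q₁ ++ q₂)) :=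
      deriv_pull hcq₁ fun k hk => hv.two_le_count (by simp [hk]) (hq₁ k hk)
    have e3 := ih (q₁ ++ q₂).length (by simp at hn ⊢; omega) (q₁ ++ q₂) (p ++ [c, c]) (r₂ ++ s₂)
      rfl hS.pull
      (by simpa using hu₁.of_perm (List.Perm.append_left p (List.perm_middle.cons c)))
      (by simpa using hv.of_perm (List.Perm.append_left p (List.perm_middle.cons c)))
      (by simpa using (hSL e1).symm.trans (hI₁.trans (hSL e2)))
    exact e1.trans (Deriv.trans (by simpa using e3) e2.symm)

theorem varietyJ_eq (hd : [a, b, t, s].Nodup) :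
    varietyJ.{w} = generatedVariety.{w} (MTau (tauOne ⊓ zetaCon)
        (conClass (tauOne ⊓ zetaCon)
          (letter a * letter t * letter b * letter a * letter s * letter b))) ∧
      generatedVariety.{w} (MTau (tauOne ⊓ zetaCon)
        (conClass (tauOne ⊓ zetaCon)
          (letter a * letter t * letter b * letter a * letter s * letter b))) =
      generatedVariety.{w} (SyntacticMonoid
        ({letter a} * {letter t} * {letter b} * plus a * {letter s} * plus b)) := by
  obtain ⟨⟨hab, hat, has⟩, ⟨hbt, hbs⟩, -⟩ :
      (a ≠ b ∧ a ≠ t ∧ a ≠ s) ∧ (b ≠ t ∧ b ≠ s) ∧ t ≠ s := by simpa using hd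
  have h1 : ∀ e, Satisfies (MTau (tauOne ⊓ zetaCon) (conClass (tauOne ⊓ zetaCon)
      (letter a * letter t * letter b * letter a * letter s * letter b))) e →
      Satisfies (SyntacticMonoid
        ({letter a} * {letter t} * {letter b} * plus a * {letter s} * plus b)) e := by
    intro e h
    have := h.quotient_mono (reesCon_le_syntacticCon _ _)
    rwa [conClass_languageJ hd] at this
  have hsound := fun e he => h1 e (identitiesJ_sound hd he)
  have hSL : ∀ {u v}, Deriv identitiesJ u v → Indist (LangJ a b t s) u v :=
    fun h => h.indist (fun _ => mem_languageJ_iff_langJ) hsound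
  have hcomplete : ∀ u v, Satisfies (SyntacticMonoid
      ({letter a} * {letter t} * {letter b} * plus a * {letter s} * plus b)) (u, v) →
      derivCon identitiesJ u v := by
    intro u v h
    have hI : Indist (LangJ a b t s) u.toList v.toList :=
      indist_of_satisfies (fun _ => mem_languageJ_iff_langJ) h
    obtain ⟨u', hu, hu'⟩ := hasBasic_identitiesJ.exists_reduced u.toList
    obtain ⟨v', hv, hv'⟩ := hasBasic_identitiesJ.exists_reduced v.toList
    have hS : Spread [] v' := fun y p₁ p₂ q₁ q₂ hp => by simp at hp
    have := deriv_of_indist_J hab hat has hbt hbs hSL _ v' [] u' rfl hS hu' hv'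
      ((hSL hu).symm.trans (hI.trans (hSL hv)))
    exact hu.trans (this.trans hv.symm)
  have h2 := varOf_eq_generatedVariety.{w}
    (fun e he => identitiesJ_sound hd he) (fun u v h => hcomplete u v (h1 _ h))
  have h3 := varOf_eq_generatedVariety.{w} hsound hcomplete
  exact ⟨h2, h2.symm.trans h3⟩

end Complete

/-! ### The theorem -/

theorem mainTheorem7 (a b t s : ℕ) (hdistinct : [a, b, t, s].Nodup) :
    (generatedVariety.{w} (WithOne SemigroupA0) =
        generatedVariety.{w} (MTau tauOne (conClass tauOne (letter a * letter b))) ∧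
      generatedVariety.{w} (MTau tauOne (conClass tauOne (letter a * letter b))) =
        generatedVariety.{w} (SyntacticMonoid (plus a * plus b))) ∧
    (generatedVariety.{w} (WithOne SemigroupA) =
        generatedVariety.{w} (MTau (tauOne ⊓ gammaCon)
          (conClass (tauOne ⊓ gammaCon) (letter a * letter b ^ 2 * letter t * letter a))) ∧
      generatedVariety.{w} (MTau (tauOne ⊓ gammaCon)
          (conClass (tauOne ⊓ gammaCon) (letter a * letter b ^ 2 * letter t * letter a))) =
        generatedVariety.{w}
          (SyntacticMonoid (plus a * {letter b} * plus b * {letter t} * plus a))) ∧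
    (varietyJ.{w} =
        generatedVariety.{w} (MTau (tauOne ⊓ zetaCon)
          (conClass (tauOne ⊓ zetaCon)
            (letter a * letter t * letter b * letter a * letter s * letter b))) ∧
      generatedVariety.{w} (MTau (tauOne ⊓ zetaCon)
          (conClass (tauOne ⊓ zetaCon)
            (letter a * letter t * letter b * letter a * letter s * letter b))) =
        generatedVariety.{w}
          (SyntacticMonoid
            ({letter a} * {letter t} * {letter b} * plus a * {letter s} * plus b))) ∧
    (varietyK.{w} =
        generatedVariety.{w} (MTau (tauOne ⊓ zetaCon)
          (conClass (tauOne ⊓ zetaCon)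
            (letter a * letter t * letter b ^ 2 * letter a))) ∧
      generatedVariety.{w} (MTau (tauOne ⊓ zetaCon)
          (conClass (tauOne ⊓ zetaCon)
            (letter a * letter t * letter b ^ 2 * letter a))) =
        generatedVariety.{w}
          (SyntacticMonoid
            ({letter a} * {letter t} * {letter b} * plus b * plus a))) := by
  obtain ⟨⟨hab, hat, -⟩, ⟨hbt, -⟩, -⟩ :
      (a ≠ b ∧ a ≠ t ∧ a ≠ s) ∧ (b ≠ t ∧ b ≠ s) ∧ t ≠ s := by simpa using hdistinct
  exact ⟨⟨generatedVariety_congr fun e => (satisfies_A0_iff a b hab e).1,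
      generatedVariety_congr fun e => (satisfies_A0_iff a b hab e).2⟩,
    ⟨generatedVariety_congr fun e => (satisfies_A_iff a b t hab hat hbt e).1,
      generatedVariety_congr fun e => (satisfies_A_iff a b t hab hat hbt e).2⟩,
    varietyJ_eq hdistinct, varietyK_eq hab hat hbt⟩
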